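/- Let $\Gamma_1$ and $\Gamma_2$ be finitely generated virtually abelian groups (each has an abelian subgroup of finite index; finite groups are allowed). Let $\nu$ be a probability measure on $\Gamma_1\times\Gamma_2$, and for $i=1,2$ let $\mu^{(i)}$ be the marginal (pushforward) of $\nu$ on $\Gamma_i$. For a probability measure $\mu$ on a group let $\mu_n$ denote its $n$-fold convolution power, i.e. the law of $\gamma_1\cdots\gamma_n$ with $\gamma_1,\dots,\gamma_n$ independent of law $\mu$. Assume that - $\nu$ is aperiodic: the greatest common divisor of all $n\ge 1$ with $\nu_n(\mathrm{id})>0$ is $1$; - $\nu$ has finite second moment: $\sum_{\gamma}|\gamma|^2\,\nu(\gamma)<\infty$, where $|\cdot|$ is the word length on $\Gamma_1\times\Gamma_2$ with respect to a finite generating set (the condition does not depend on the choice of the generating set); - the support of $\nu$ generates $\Gamma_1\times\Gamma_2$ as a semigroup. If $\Gamma_1$ admits no nonzero homomorphism onto $\mathbb{Z}$, then $$\big\|\nu_n-\mu^{(1)}_n\times\mu^{(2)}_n\big\|_{\mathrm{TV}}\to 0\quad\text{as } n\to\infty,$$ where $\|\alpha-\beta\|_{\mathrm{TV}}=\sup_{A\subset\Gamma_1\times\Gamma_2}|\alpha(A)-\beta(A)|$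 is the total variation distance. -/

import Mathlib

open scoped ENNReal

noncomputable section

namespace RandomWalk

/-- A group is virtually abelian if it has an abelian subgroup of finite index
(finite groups are included). -/
def VirtuallyAbelian (G : Type*) [Group G] : Prop :=
  ∃ H : Subgroup G, H.FiniteIndex ∧ ∀ a ∈ H, ∀ b ∈ H, a * b = b * a

/-- Word length of `g` with respect to `S`: the least length of a word in the letters
`S ∪ S⁻¹` that represents `g`. It is only used for generating sets `S`. -/
def wordLength {G : Type*} [Group G] (S : Set G) (g : G) : ℕ :=
  sInf {n | ∃ l : List G, l.length = n ∧ (∀ s ∈ l, s ∈ S ∨ s⁻¹ ∈ S) ∧ l.prod = g}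

/-- `∑ |g|² μ(g) < ∞` for the word length of some finite generating set
(equivalently, on a finitely generated group, of every finite generating set). -/
def FiniteSecondMoment {G : Type*} [Group G] (μ : PMF G) : Prop :=
  ∃ S : Finset G, Subgroup.closure (S : Set G) = ⊤ ∧
    ∑' g : G, ((wordLength (S : Set G) g : ℝ≥0∞) ^ 2 * μ g) < ∞

/-- The law of `γ₁ ⋯ γₙ` with `γ₁, …, γₙ` independent of law `μ`, that is, the
`n`-fold convolution power of `μ`. -/
def convPow {G : Type*} [Group G] (μ : PMF G) : ℕ → PMF G
  | 0 => PMF.pure 1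
  | n + 1 => (convPow μ n).bind fun g => μ.map fun h => g * h

/-- The period: the greatest common divisor of the lengths `n ≥ 1` of the
positive-probability paths of the walk from `1` to `1`. -/
def period {G : Type*} [Group G] (μ : PMF G) : ℕ :=
  Nat.setGcd {n | 0 < n ∧ convPow μ n 1 ≠ 0}

/-- `μ` is aperiodic if its period is `1`. -/
def Aperiodic {G : Type*} [Group G] (μ : PMF G) : Prop :=
  period μ = 1

/-- The product measure `μ₁ × μ₂`. -/
def prodPMF {α β : Type*} (μ₁ : PMF α) (μ₂ : PMF β) : PMF (α × β) :=
  μ₁.bind fun a => μ₂.map fun b => (a, b)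

/-- Total variation distance, `sup_A |μ₁(A) - μ₂(A)|`. -/
def tvDist {α : Type*} (μ₁ μ₂ : PMF α) : ℝ :=
  ⨆ A : Set α, |(μ₁.toOuterMeasure A).toReal - (μ₂.toOuterMeasure A).toReal|

end RandomWalk

end

/-! Work in the Banach algebra `L1 Γ`, `Γ = Γ₁ × Γ₂`, and let `g` be the product of the marginals of
`ν`. The two factors commute, so `g ^ n` is the product of the marginals of `ν ^ n`, and it suffices
that `‖ν ^ n - g ^ n‖ → 0`.

Smallness is measured against a central element `η`, a product of lazy steps `(1 + s) / 2` over a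
conjugation-invariant finite set of letters in a normal abelian subgroup of finite index. Each `s -
1` satisfies `‖(s - 1) η ^ n‖ = O(n^(-1/2))`, and by centrality products of such differences gain
further orders. Aperiodicity and generation give `ν ^ N = ε η + ρ` with `‖ρ‖ ≤ 1 - ε`. As `ρ`
commutes with `η`, a bound `‖x η ^ n‖ = o(1/n)` passes to `ν ^ n x`, and likewise to `x g ^ n`. By
telescoping, `ν ^ n u - u g ^ n → 0` whenever `ν u - u g` is of this order
(`tendsto_pow_mul_sub_mul_pow`). If moreover `u` is approximable of mass one, then `ν ^ n (1 - u)`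
and `(1 - u) g ^ n` tend to zero, so `ν ^ n` and `g ^ n` are asymptotic.

Take `u = p(ν) p'(g)`, with polynomials that suppress every eigenvalue but one in a finite quotient
(`exists_polynomial`). Then `x = ν u - u g = p(ν) (ν - g) p'(g)` has vanishing marginals and, to
second order, is annihilated by powers of `1 - ν` on the left and of `1 - g` on the right. The
second moment provides a second-order Taylor expansion (`mem_approximable_of_moment`). Vanishing
marginals leave only mixed terms `(s - 1) (t - 1)`, with `s` in `Γ₁` and `t` in `Γ₂`. Approximate
left invariance of `x` permits averaging over `Γ₁ ⧸ A₁`, which replaces `s - 1` by a sum over the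
conjugates of `s`; to first order this is the product of the conjugates minus one. That product is
the transfer of `s`, a torsion element because `Γ₁` has no surjection to `ℤ`, so the mixed term
disappears (`mem_littleO_two`). In probabilistic terms, invariance under `Γ₁` kills the asymptotic
covariance between the factors. -/

noncomputable section

open scoped Pointwise
open Filter Topology

/-! ### The `ℓ¹` group algebra -/

/-- Absolutely summable real functions on `G`; for a group `G` this is a Banach algebra under
convolution. -/
def L1 (G : Type*) : Type _ := lp (fun _ : G => ℝ) 1

namespace L1

instance (G : Type*) : NormedAddCommGroup (L1 G) :=
  inferInstanceAs (NormedAddCommGroup (lp (fun _ : G => ℝ) 1))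

instance (G : Type*) : NormedSpace ℝ (L1 G) :=
  inferInstanceAs (NormedSpace ℝ (lp (fun _ : G => ℝ) 1))

instance (G : Type*) : CompleteSpace (L1 G) :=
  inferInstanceAs (CompleteSpace (lp (fun _ : G => ℝ) 1))

variable {G H E : Type*} [NormedAddCommGroup E] [NormedSpace ℝ E] [CompleteSpace E]

/-- The coefficients of an element of `L1 G`. -/
def coeff (x : L1 G) (g : G) : ℝ := (show lp (fun _ : G => ℝ) 1 from x) g

theorem hasSum_norm_coeff (x : L1 G) : HasSum (fun g => ‖coeff x g‖) ‖x‖ := by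
  have := lp.hasSum_norm (p := 1) (by simp) (show lp (fun _ : G => ℝ) 1 from x)
  simp only [ENNReal.toReal_one, Real.rpow_one] at this
  exact this

open Classical in
/-- The Dirac mass at `g`. -/
def δ (g : G) : L1 G := lp.single (E := fun _ : G => ℝ) 1 g (1 : ℝ)

@[simp] theorem norm_δ (g : G) : ‖δ g‖ = 1 := by
  classical
  have := lp.norm_single (E := fun _ : G => ℝ) (p := 1) (by simp) g (1 : ℝ)
  rw [norm_one] at this
  exact this

theorem hasSum_coeff (x : L1 G) : HasSum (fun g => coeff x g • δ g) x := by
  classical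
  have := lp.hasSum_single (p := 1) (by simp) (show lp (fun _ : G => ℝ) 1 from x)
  have h2 : ∀ g : G, coeff x g • δ g =
      (lp.single (E := fun _ : G => ℝ) 1 g (coeff x g) : L1 G) := by
    intro g
    have := lp.single_smul (E := fun _ : G => ℝ) (𝕜 := ℝ) 1 g (coeff x g) (1 : ℝ)
    simp only [smul_eq_mul, mul_one] at this
    exact this.symm
  simp only [h2]
  exact this

/-- Dirac masses span a dense subspace. The algebraic identities in `L1 G` are reduced to identities
in `G` through this. -/
theorem ext_clm {V : Type*} [NormedAddCommGroup V] [NormedSpace ℝ V] {f f' : L1 G →L[ℝ] V}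
    (h : ∀ g, f (δ g) = f' (δ g)) : f = f' := by
  ext x
  have h1 := (hasSum_coeff x).mapL f
  have h2 := (hasSum_coeff x).mapL f'
  simp only [map_smul, h] at h1 h2
  exact h1.unique h2

theorem summable_coeff_smul (x : L1 G) {b : G → E} (hb : ∀ g, ‖b g‖ ≤ 1) :
    Summable fun g => coeff x g • b g := by
  refine Summable.of_norm_bounded (hasSum_norm_coeff x).summable fun g => ?_
  rw [norm_smul]
  exact mul_le_of_le_one_right (norm_nonneg _) (hb g)

/-- The linear extension of a function on `G` with values in the unit ball of a Banach space. -/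
def lift (b : G → E) (hb : ∀ g, ‖b g‖ ≤ 1) : L1 G →L[ℝ] E :=
  LinearMap.mkContinuous
    { toFun := fun x => ∑' g, coeff x g • b g
      map_add' := fun x y => by
        rw [← (summable_coeff_smul x hb).tsum_add (summable_coeff_smul y hb)]
        exact tsum_congr fun g => add_smul (coeff x g) (coeff y g) (b g)
      map_smul' := fun c x => by
        rw [RingHom.id_apply, ← (summable_coeff_smul x hb).tsum_const_smul]
        exact tsum_congr fun g => mul_smul c (coeff x g) (b g) }
    1 fun x => by
      rw [one_mul]
      refine tsum_of_norm_bounded (hasSum_norm_coeff x) fun g => ?_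
      rw [norm_smul]
      exact mul_le_of_le_one_right (norm_nonneg _) (hb g)

theorem norm_lift_le (b : G → E) (hb : ∀ g, ‖b g‖ ≤ 1) : ‖lift b hb‖ ≤ 1 :=
  LinearMap.mkContinuous_norm_le _ zero_le_one _

theorem norm_lift_apply_le (b : G → E) (hb : ∀ g, ‖b g‖ ≤ 1) (x : L1 G) : ‖lift b hb x‖ ≤ ‖x‖ :=
  ((lift b hb).le_of_opNorm_le (norm_lift_le b hb) x).trans_eq (one_mul _)

@[simp] theorem lift_δ (b : G → E) (hb : ∀ g, ‖b g‖ ≤ 1) (g : G) : lift b hb (δ g) = b g := by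
  classical
  change ∑' k, coeff (δ g) k • b k = b g
  have h : ∀ k, coeff (δ g) k = if k = g then 1 else 0 := by
    intro k
    have := lp.single_apply (E := fun _ : G => ℝ) 1 g (1 : ℝ) k
    refine (show coeff (δ g) k = _ from this).trans ?_
    simp [Pi.single_apply]
  simp [h]

variable [Group G] [Group H]

/-- Convolution. -/
def mulCLM : L1 G →L[ℝ] L1 G →L[ℝ] L1 G :=
  lift (fun g => lift (fun h => δ (g * h)) fun _ => (norm_δ _).le) fun _ => norm_lift_le _ _

instance : Mul (L1 G) := ⟨fun x y => mulCLM x y⟩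

instance : One (L1 G) := ⟨δ 1⟩

theorem one_def : (1 : L1 G) = δ 1 := rfl

theorem mul_def (x y : L1 G) : x * y = mulCLM x y := rfl

@[simp] theorem δ_mul_δ (g h : G) : (δ g * δ h : L1 G) = δ (g * h) := by
  simp [mul_def, mulCLM]

@[simp] theorem δ_one : (δ 1 : L1 G) = 1 := rfl

protected theorem mul_assoc' (x y z : L1 G) : x * y * z = x * (y * z) := by
  -- Both sides are continuous and trilinear; the three arguments are released from Dirac masses one
  -- at a time.
  have h1 : ∀ g h : G, ∀ z : L1 G,
      mulCLM (mulCLM (δ g) (δ h)) z = mulCLM (δ g) (mulCLM (δ h) z) := by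
    intro g h z
    have : mulCLM (mulCLM (δ g) (δ h)) = (mulCLM (δ g)).comp (mulCLM (δ h)) := by
      refine ext_clm fun k => ?_
      simp only [ContinuousLinearMap.comp_apply]
      simp only [← mul_def, δ_mul_δ, mul_assoc]
    rw [this]; rfl
  have h2 : ∀ (g : G) (y z : L1 G), mulCLM (mulCLM (δ g) y) z = mulCLM (δ g) (mulCLM y z) := by
    intro g y z
    have : (mulCLM.flip z).comp (mulCLM (δ g)) = (mulCLM (δ g)).comp (mulCLM.flip z) :=
      ext_clm fun k => by simpa using h1 g k z
    exact DFunLike.congr_fun this y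
  have : (mulCLM.flip z).comp (mulCLM.flip y) = mulCLM.flip (mulCLM y z) :=
    ext_clm fun k => by simpa using h2 k y z
  exact DFunLike.congr_fun this x

protected theorem one_mul' (x : L1 G) : 1 * x = x := by
  have : mulCLM (δ (1 : G)) = ContinuousLinearMap.id ℝ (L1 G) :=
    ext_clm fun k => by rw [← mul_def, δ_mul_δ, one_mul]; rfl
  exact DFunLike.congr_fun this x

protected theorem mul_one' (x : L1 G) : x * 1 = x := by
  have : mulCLM.flip (δ (1 : G)) = ContinuousLinearMap.id ℝ (L1 G) :=
    ext_clm fun k => by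
      rw [ContinuousLinearMap.flip_apply, ← mul_def, δ_mul_δ, mul_one]; rfl
  exact DFunLike.congr_fun this x

instance : NormedRing (L1 G) :=
  { (inferInstance : NormedAddCommGroup (L1 G)), (inferInstance : Mul (L1 G)),
    (inferInstance : One (L1 G)) with
    left_distrib := fun x y z => map_add (mulCLM x) y z
    right_distrib := fun x y z => by simp [mul_def]
    zero_mul := fun x => by simp [mul_def]
    mul_zero := fun x => map_zero (mulCLM x)
    mul_assoc := L1.mul_assoc'
    one_mul := L1.one_mul'
    mul_one := L1.mul_one'
    norm_mul_le := fun x y =>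
      (mulCLM x).le_of_opNorm_le (norm_lift_apply_le _ _ x) y }

instance : NormedAlgebra ℝ (L1 G) :=
  { Algebra.ofModule (fun c x y => by simp [mul_def]) (fun c x y => by simp [mul_def]) with
    norm_smul_le := fun c x => norm_smul_le c x }

instance : NormOneClass (L1 G) := ⟨norm_δ 1⟩

/-- The Dirac masses as a monoid homomorphism. -/
def δHom : G →* L1 G where
  toFun := δ
  map_one' := rfl
  map_mul' g h := (δ_mul_δ g h).symm

variable {B : Type*} [NormedRing B] [NormedAlgebra ℝ B]

/-- The algebra homomorphism extending a homomorphism of `G` into the unit ball of a Banach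
algebra. -/
def liftAlgHom [CompleteSpace B] (f : G →* B) (hf : ∀ g, ‖f g‖ ≤ 1) : L1 G →ₐ[ℝ] B :=
  AlgHom.ofLinearMap (lift f hf).toLinearMap
    (by change lift f hf (δ 1) = 1; rw [lift_δ, map_one])
    (by
      intro x y
      change lift f hf (x * y) = lift f hf x * lift f hf y
      have h1 : ∀ (g : G) (y : L1 G), lift f hf (δ g * y) = f g * lift f hf y := by
        intro g y
        have : (lift f hf).comp (mulCLM (δ g)) =
            (ContinuousLinearMap.mul ℝ B (f g)).comp (lift f hf) :=
          ext_clm fun k => by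
            simp only [ContinuousLinearMap.comp_apply, ← mul_def]; simp
        exact DFunLike.congr_fun this y
      have : (lift f hf).comp (mulCLM.flip y) =
          ((ContinuousLinearMap.mul ℝ B).flip (lift f hf y)).comp (lift f hf) :=
        ext_clm fun k => by
          have := h1 k y
          simpa [mul_def] using this
      exact DFunLike.congr_fun this x)

@[simp] theorem liftAlgHom_δ [CompleteSpace B] (f : G →* B) (hf : ∀ g, ‖f g‖ ≤ 1) (g : G) :
    liftAlgHom f hf (δ g) = f g := lift_δ f hf g

theorem norm_liftAlgHom_le [CompleteSpace B] (f : G →* B) (hf : ∀ g, ‖f g‖ ≤ 1) (x : L1 G) :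
    ‖liftAlgHom f hf x‖ ≤ ‖x‖ := norm_lift_apply_le f hf x

theorem liftAlgHom_eq_lift [CompleteSpace B] (f : G →* B) (hf : ∀ g, ‖f g‖ ≤ 1) (x : L1 G) :
    liftAlgHom f hf x = lift f hf x := rfl

/-- The functoriality of `L1`: push-forward along a homomorphism. -/
def map (φ : G →* H) : L1 G →ₐ[ℝ] L1 H :=
  liftAlgHom (δHom.comp φ) fun _ => (norm_δ _).le

@[simp] theorem map_δ (φ : G →* H) (g : G) : map φ (δ g) = δ (φ g) := liftAlgHom_δ _ _ g

theorem norm_map_le (φ : G →* H) (x : L1 G) : ‖map φ x‖ ≤ ‖x‖ := norm_liftAlgHom_le _ _ x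

/-- The total mass. -/
def mass : L1 G →ₐ[ℝ] ℝ := liftAlgHom 1 fun _ => by simp

@[simp] theorem mass_δ (g : G) : mass (δ g) = 1 := liftAlgHom_δ _ _ g

theorem norm_mass_le (x : L1 G) : ‖mass x‖ ≤ ‖x‖ := norm_liftAlgHom_le _ _ x

/-- Two algebra homomorphisms out of `L1 G` that do not increase norms agree if they agree on
Dirac masses. -/
theorem algHom_ext {f f' : L1 G →ₐ[ℝ] B} (hf : ∀ x, ‖f x‖ ≤ ‖x‖) (hf' : ∀ x, ‖f' x‖ ≤ ‖x‖)
    (h : ∀ g, f (δ g) = f' (δ g)) : f = f' := by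
  have : f.toLinearMap.mkContinuous 1 (fun x => (hf x).trans_eq (one_mul _).symm) =
      f'.toLinearMap.mkContinuous 1 (fun x => (hf' x).trans_eq (one_mul _).symm) :=
    ext_clm h
  ext x
  exact DFunLike.congr_fun this x

theorem map_map {K : Type*} [Group K] (φ : G →* H) (ψ : H →* K) (x : L1 G) :
    map ψ (map φ x) = map (ψ.comp φ) x := by
  have : (map ψ).comp (map φ) = map (ψ.comp φ) :=
    algHom_ext (fun x => (norm_map_le _ _).trans (norm_map_le _ _)) (norm_map_le _) (by simp)
  exact DFunLike.congr_fun this x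

@[simp] theorem mass_map (φ : G →* H) (x : L1 G) : mass (map φ x) = mass x := by
  have : mass.comp (map φ) = mass :=
    algHom_ext (fun x => (norm_mass_le _).trans (norm_map_le _ _)) norm_mass_le (by simp)
  exact DFunLike.congr_fun this x

theorem map_one_hom (x : L1 G) : map (1 : G →* H) x = algebraMap ℝ (L1 H) (mass x) := by
  have : map (1 : G →* H) = (Algebra.ofId ℝ (L1 H)).comp (mass (G := G)) :=
    algHom_ext (norm_map_le _)
      (fun x => by
        refine le_trans ?_ (norm_mass_le x)
        exact (norm_algebraMap' (L1 H) (mass x)).le) (by simp)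
  exact DFunLike.congr_fun this x

end L1

/-! ### Orders of vanishing along the powers of a central contraction -/

/-- A central element of norm at most one. -/
structure CentralContraction {B : Type*} [NormedRing B] (η : B) : Prop where
  comm : ∀ x, η * x = x * η
  norm_le : ‖η‖ ≤ 1

namespace CentralContraction

variable {B : Type*} [NormedRing B] {η : B}

theorem pow_comm (h : CentralContraction η) (n : ℕ) (x : B) : η ^ n * x = x * η ^ n :=
  (show Commute η x from h.comm x).pow_left n

theorem norm_pow_le' [NormOneClass B] (h : CentralContraction η) (n : ℕ) : ‖η ^ n‖ ≤ 1 :=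
  (norm_pow_le η n).trans (pow_le_one₀ (norm_nonneg _) h.norm_le)

/-- Centrality lets each factor take its own share of the power of `η`. This is why orders of
vanishing add up under multiplication. -/
theorem norm_mul_mul_pow_le (h : CentralContraction η) (p q : B) (k m : ℕ) :
    ‖p * q * η ^ (k + m)‖ ≤ ‖p * η ^ k‖ * ‖q * η ^ m‖ := by
  have : p * q * η ^ (k + m) = (p * η ^ k) * (q * η ^ m) := by
    rw [pow_add, mul_assoc p, mul_assoc p, ← mul_assoc (η ^ k) q, h.pow_comm k q]
    simp only [mul_assoc]
  rw [this]
  exact norm_mul_le _ _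

variable [NormedAlgebra ℝ B]

/-- The elements `r` with `‖r ηⁿ‖ = o(n^(-i/2))`. -/
def littleO (η : B) (i : ℕ) : Submodule ℝ B where
  carrier := {r | Tendsto (fun n : ℕ => √(n : ℝ) ^ i * ‖r * η ^ n‖) atTop (𝓝 0)}
  zero_mem' := by simp
  add_mem' := by
    intro a b ha hb
    have h := ha.add hb
    rw [add_zero] at h
    refine squeeze_zero (fun n => by positivity) (fun n => ?_) h
    rw [← mul_add, add_mul]
    gcongr
    exact norm_add_le _ _
  smul_mem' := by
    intro c a ha
    have h := Tendsto.const_mul ‖c‖ ha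
    rw [mul_zero] at h
    refine h.congr fun n => ?_
    rw [smul_mul_assoc, norm_smul]
    ring

/-- The elements `r` with `‖r ηⁿ‖ = O(n^(-1/2))`. -/
def bigO (η : B) : Submodule ℝ B where
  carrier := {r | ∃ C : ℝ, ∀ n : ℕ, √(n : ℝ) * ‖r * η ^ n‖ ≤ C}
  zero_mem' := ⟨0, by simp⟩
  add_mem' := by
    rintro a b ⟨C, ha⟩ ⟨D, hb⟩
    refine ⟨C + D, fun n => ?_⟩
    refine le_trans ?_ (add_le_add (ha n) (hb n))
    rw [← mul_add, add_mul]
    gcongr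
    exact norm_add_le _ _
  smul_mem' := by
    rintro c a ⟨C, ha⟩
    refine ⟨‖c‖ * C, fun n => ?_⟩
    refine le_trans (le_of_eq ?_) (mul_le_mul_of_nonneg_left (ha n) (norm_nonneg c))
    rw [smul_mul_assoc, norm_smul]
    ring

theorem mem_littleO {i : ℕ} {r : B} :
    r ∈ littleO η i ↔ Tendsto (fun n : ℕ => √(n : ℝ) ^ i * ‖r * η ^ n‖) atTop (𝓝 0) := Iff.rfl

theorem mem_bigO {r : B} : r ∈ bigO η ↔ ∃ C : ℝ, ∀ n : ℕ, √(n : ℝ) * ‖r * η ^ n‖ ≤ C := Iff.rfl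

theorem littleO_mul_left {i : ℕ} {r : B} (hr : r ∈ littleO η i) (b : B) : b * r ∈ littleO η i := by
  have h1 := Tendsto.const_mul ‖b‖ hr
  rw [mul_zero] at h1
  refine squeeze_zero (fun n => by positivity) (fun n => ?_) h1
  rw [mul_left_comm, mul_assoc]
  gcongr
  exact norm_mul_le _ _

theorem littleO_mul_right (h : CentralContraction η) {i : ℕ} {r : B} (hr : r ∈ littleO η i)
    (b : B) :
    r * b ∈ littleO η i := by
  have h1 := Tendsto.mul_const ‖b‖ hr
  rw [zero_mul] at h1
  refine squeeze_zero (fun n => by positivity) (fun n => ?_) h1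
  rw [mul_assoc r, ← h.pow_comm, ← mul_assoc r, mul_assoc (√(n : ℝ) ^ i)]
  gcongr
  exact norm_mul_le (r * η ^ n) b

theorem bigO_mul_right (h : CentralContraction η) {r : B} (hr : r ∈ bigO η) (b : B) :
    r * b ∈ bigO η := by
  obtain ⟨C, hC⟩ := hr
  refine ⟨C * ‖b‖, fun n => ?_⟩
  refine le_trans ?_ (mul_le_mul_of_nonneg_right (hC n) (norm_nonneg b))
  rw [mul_assoc r, ← h.pow_comm, ← mul_assoc r, mul_assoc (√(n : ℝ))]
  gcongr
  exact norm_mul_le (r * η ^ n) b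

theorem littleO_succ_le (i : ℕ) : littleO η (i + 1) ≤ littleO η i := by
  intro r hr
  refine squeeze_zero' (Eventually.of_forall fun n => by positivity) ?_ hr
  filter_upwards [eventually_ge_atTop 1] with n hn
  have : (1 : ℝ) ≤ √(n : ℝ) := Real.one_le_sqrt.2 (by exact_mod_cast hn)
  gcongr
  exact Nat.le_succ i

theorem bigO_le_littleO : bigO η ≤ littleO η 0 := by
  rintro r ⟨C, hC⟩
  have h1 : Tendsto (fun n : ℕ => C / √(n : ℝ)) atTop (𝓝 0) :=
    Tendsto.div_atTop tendsto_const_nhds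
      (Real.tendsto_sqrt_atTop.comp tendsto_natCast_atTop_atTop)
  refine squeeze_zero' (Eventually.of_forall fun n => by positivity) ?_ h1
  filter_upwards [eventually_ge_atTop 1] with n hn
  have : (0 : ℝ) < √(n : ℝ) := Real.sqrt_pos.2 (by exact_mod_cast hn)
  rw [pow_zero, one_mul, le_div_iff₀ this, mul_comm]
  exact hC n

theorem littleO_one_le_bigO : littleO η 1 ≤ bigO η := by
  intro r hr
  obtain ⟨C, hC⟩ := Tendsto.bddAbove_range hr
  exact ⟨C, fun n => by simpa using hC ⟨n, rfl⟩⟩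

theorem littleO_two_le_bigO : littleO η 2 ≤ bigO η :=
  (littleO_succ_le 1).trans littleO_one_le_bigO

/-- With `n` cut into two halves, one half supplies `n^(-1/2)` and the other `o(n^(-i/2))`; halving
costs only constants. -/
theorem littleO_of_norm_le {i : ℕ} {r s t : B} (hr : r ∈ bigO η) (hs : s ∈ littleO η i)
    (ht : ∀ k m, ‖t * η ^ (k + m)‖ ≤ ‖r * η ^ k‖ * ‖s * η ^ m‖) : t ∈ littleO η (i + 1) := by
  obtain ⟨C, hC⟩ := hr
  have h1 : Tendsto (fun n : ℕ => 2 * C * 2 ^ i * (√((n / 2 : ℕ) : ℝ) ^ i * ‖s * η ^ (n / 2)‖))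
      atTop (𝓝 0) := by
    have := Tendsto.const_mul (2 * C * 2 ^ i)
      (Tendsto.comp hs (Nat.tendsto_div_const_atTop (two_ne_zero)))
    rw [mul_zero] at this
    exact this
  refine squeeze_zero' (Eventually.of_forall fun n => by positivity) ?_ h1
  filter_upwards [eventually_ge_atTop 2] with n hn
  -- The bounds `n ≤ 4 k` and `n ≤ 4 m` become `√n ≤ 2 √k` and `√n ≤ 2 √m`; the second one needs `n
  -- ≥ 2`.
  obtain ⟨k, m, hk, hm, rfl, hkm⟩ : ∃ k m, n ≤ 4 * k ∧ n ≤ 4 * m ∧ n = k + m ∧ n / 2 = m :=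
    ⟨n - n / 2, n / 2, by omega, by omega, by omega, rfl⟩
  rw [hkm]
  have e1 : √((k + m : ℕ) : ℝ) ≤ 2 * √(k : ℝ) := by
    rw [Real.sqrt_le_left (by positivity), mul_pow, Real.sq_sqrt (by positivity)]
    exact_mod_cast (by omega)
  have e2 : √((k + m : ℕ) : ℝ) ≤ 2 * √(m : ℝ) := by
    rw [Real.sqrt_le_left (by positivity), mul_pow, Real.sq_sqrt (by positivity)]
    exact_mod_cast (by omega)
  calc √((k + m : ℕ) : ℝ) ^ (i + 1) * ‖t * η ^ (k + m)‖
      ≤ ((2 * √(m : ℝ)) ^ i * (2 * √(k : ℝ))) * (‖r * η ^ k‖ * ‖s * η ^ m‖) := by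
        rw [pow_succ]
        gcongr
        exact ht k m
    _ = (2 * (√(k : ℝ) * ‖r * η ^ k‖)) * (2 ^ i * (√(m : ℝ) ^ i * ‖s * η ^ m‖)) := by
        rw [mul_pow]; ring
    _ ≤ (2 * C) * (2 ^ i * (√(m : ℝ) ^ i * ‖s * η ^ m‖)) := by
        gcongr
        exact hC k
    _ = _ := by ring

theorem bigO_mul_littleO (h : CentralContraction η) {i : ℕ} {r s : B} (hr : r ∈ bigO η)
    (hs : s ∈ littleO η i) :
    r * s ∈ littleO η (i + 1) :=
  littleO_of_norm_le hr hs fun k m => h.norm_mul_mul_pow_le r s k m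

theorem littleO_mul_bigO (h : CentralContraction η) {i : ℕ} {r s : B} (hr : r ∈ littleO η i)
    (hs : s ∈ bigO η) :
    r * s ∈ littleO η (i + 1) :=
  littleO_of_norm_le hs hr fun k m => by
    rw [add_comm k m, mul_comm]
    exact h.norm_mul_mul_pow_le r s m k

theorem bigO_mul_bigO (h : CentralContraction η) {r s : B} (hr : r ∈ bigO η) (hs : s ∈ bigO η) :
    r * s ∈ littleO η 1 :=
  h.bigO_mul_littleO hr (bigO_le_littleO hs)

end CentralContraction

/-! ### Minorization of powers and decay -/

/-- The binomial average of a null sequence is a null sequence. -/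
theorem tendsto_binomial_average {ε : ℝ} (h0 : 0 < ε) (h1 : ε ≤ 1) {b : ℕ → ℝ} (hb : ∀ i, 0 ≤ b i)
    (hlim : Tendsto b atTop (𝓝 0)) :
    Tendsto (fun m : ℕ => ∑ i ∈ Finset.range (m + 1),
      (m.choose i : ℝ) * ε ^ i * (1 - ε) ^ (m - i) * b i) atTop (𝓝 0) := by
  have h1' : 0 ≤ 1 - ε := by linarith
  obtain ⟨M, hM⟩ := hlim.bddAbove_range
  have hM : ∀ i, b i ≤ M := fun i => hM ⟨i, rfl⟩
  have hM0 : 0 ≤ M := (hb 0).trans (hM 0)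
  -- For fixed `i` the binomial weight is, after a shift by `i`, a constant times the general term
  -- of a convergent series.
  have hterm : ∀ i, Tendsto (fun m : ℕ => (m.choose i : ℝ) * ε ^ i * (1 - ε) ^ (m - i))
      atTop (𝓝 0) := by
    intro i
    rw [← tendsto_add_atTop_iff_nat i]
    have hs := (summable_choose_mul_geometric_of_norm_lt_one (R := ℝ) i (r := 1 - ε)
      (by rw [Real.norm_eq_abs, abs_of_nonneg h1']; linarith)).tendsto_atTop_zero
    have := hs.const_mul (ε ^ i)
    rw [mul_zero] at this
    refine this.congr fun m => ?_
    rw [Nat.add_sub_cancel]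
    ring
  rw [Metric.tendsto_atTop]
  intro δ hδ
  -- Indices beyond `I` contribute at most `δ / 2` because the weights sum to one; the finitely many
  -- others have vanishing weights.
  obtain ⟨I, hI⟩ := eventually_atTop.1 (hlim.eventually (gt_mem_nhds (half_pos hδ)))
  have hfin : Tendsto (fun m : ℕ => ∑ i ∈ Finset.range I,
      M * ((m.choose i : ℝ) * ε ^ i * (1 - ε) ^ (m - i))) atTop (𝓝 0) := by
    have := tendsto_finsetSum (Finset.range I) fun i _ => (hterm i).const_mul M
    simpa using this
  obtain ⟨m0, hm0⟩ := eventually_atTop.1 (hfin.eventually (gt_mem_nhds (half_pos hδ)))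
  refine ⟨max m0 I, fun m hm => ?_⟩
  have hp : ∀ i, 0 ≤ (m.choose i : ℝ) * ε ^ i * (1 - ε) ^ (m - i) := fun i => by positivity
  rw [Real.dist_eq, sub_zero, abs_of_nonneg (Finset.sum_nonneg fun i _ => mul_nonneg (hp i) (hb i))]
  have hsub : Finset.range I ⊆ Finset.range (m + 1) :=
    Finset.range_mono ((le_max_right _ _).trans (hm.trans (Nat.le_succ m)))
  have htot : ∑ i ∈ Finset.range (m + 1), (m.choose i : ℝ) * ε ^ i * (1 - ε) ^ (m - i) = 1 := by
    have := add_pow ε (1 - ε) m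
    rw [add_sub_cancel, one_pow] at this
    refine Eq.trans ?_ this.symm
    exact Finset.sum_congr rfl fun i _ => by ring
  calc ∑ i ∈ Finset.range (m + 1), (m.choose i : ℝ) * ε ^ i * (1 - ε) ^ (m - i) * b i
      ≤ ∑ i ∈ Finset.range (m + 1), ((m.choose i : ℝ) * ε ^ i * (1 - ε) ^ (m - i) * (δ / 2) +
          if i ∈ Finset.range I then M * ((m.choose i : ℝ) * ε ^ i * (1 - ε) ^ (m - i))
          else 0) := by
        refine Finset.sum_le_sum fun i _ => ?_
        split_ifs with hi
        · have := mul_le_mul_of_nonneg_left (hM i) (hp i)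
          have := mul_nonneg (hp i) (half_pos hδ).le
          linarith
        · have := (hI i (by simpa using hi)).le
          rw [add_zero]
          exact mul_le_mul_of_nonneg_left this (hp i)
    _ = δ / 2 + ∑ i ∈ Finset.range I, M * ((m.choose i : ℝ) * ε ^ i * (1 - ε) ^ (m - i)) := by
        rw [Finset.sum_add_distrib, ← Finset.sum_mul, htot, one_mul, Finset.sum_ite_mem,
          Finset.inter_eq_right.2 hsub]
    _ < δ := by
        have := hm0 m ((le_max_left _ _).trans hm)
        linarith

/-- The binomial average of a sequence `o(1/i)` is `o(1/m)`. -/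
theorem tendsto_mul_binomial_average {ε : ℝ} (h0 : 0 < ε) (h1 : ε ≤ 1) {a : ℕ → ℝ}
    (ha : ∀ i, 0 ≤ a i) (hlim : Tendsto (fun i : ℕ => ((i : ℝ) + 1) * a i) atTop (𝓝 0)) :
    Tendsto (fun m : ℕ => ((m : ℝ) + 1) * ∑ i ∈ Finset.range (m + 1),
      (m.choose i : ℝ) * ε ^ i * (1 - ε) ^ (m - i) * a i) atTop (𝓝 0) := by
  -- The identity `(m + 1) C(m, i) = (i + 1) C(m + 1, i + 1)` turns the claim into a binomial
  -- average at `m + 1` of the null sequence `i * a (i - 1)`. The truncated value at `i = 0` is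
  -- harmless, being multiplied by zero.
  have hlim' : Tendsto (fun i : ℕ => (i : ℝ) * a (i - 1)) atTop (𝓝 0) := by
    rw [← tendsto_add_atTop_iff_nat 1]
    refine hlim.congr fun i => ?_
    simp
  have key := (tendsto_binomial_average h0 h1
    (fun i => mul_nonneg (Nat.cast_nonneg i) (ha (i - 1))) hlim')
  rw [← tendsto_add_atTop_iff_nat 1] at key
  have key2 := key.const_mul ε⁻¹
  rw [mul_zero] at key2
  refine key2.congr fun m => ?_
  rw [Finset.sum_range_succ', Finset.mul_sum]
  simp only [Nat.cast_zero, zero_mul, mul_zero, add_zero]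
  rw [Finset.mul_sum]
  refine Finset.sum_congr rfl fun i _ => ?_
  have hc : ((m : ℝ) + 1) * (m.choose i : ℝ) = ((m + 1).choose (i + 1) : ℝ) * ((i : ℝ) + 1) := by
    exact_mod_cast Nat.add_one_mul_choose_eq m i
  have e : m + 1 - (i + 1) = m - i := by omega
  rw [e, Nat.add_sub_cancel]
  push_cast
  have : ε⁻¹ * ε ^ (i + 1) = ε ^ i := by
    rw [pow_succ]; field_simp
  calc ε⁻¹ * (((m + 1).choose (i + 1) : ℝ) * ε ^ (i + 1) * (1 - ε) ^ (m - i) *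
          (((i : ℝ) + 1) * a i))
      = (((m + 1).choose (i + 1) : ℝ) * ((i : ℝ) + 1)) * (ε⁻¹ * ε ^ (i + 1)) * (1 - ε) ^ (m - i) *
          a i := by ring
    _ = _ := by rw [← hc, this]; ring

section Minorization

variable {B : Type*} [NormedRing B] [NormedAlgebra ℝ B]

/-- `p` dominates a positive multiple of `y`, in the sense of norms: for small `ε > 0`, the
difference `p - ε y` has norm at most `1 - ε`. -/
def Dominates (p y : B) : Prop := ∀ᶠ ε : ℝ in 𝓝[>] 0, ‖p - ε • y‖ ≤ 1 - ε

/-- For `e < ε` the element `p - e • y` is a convex combination of `p` and `p - ε • y`, so one good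
`ε` gives all smaller ones. -/
theorem Dominates.of_exists {p y : B} (hp : ‖p‖ ≤ 1) {ε : ℝ} (h0 : 0 < ε)
    (h : ‖p - ε • y‖ ≤ 1 - ε) : Dominates p y := by
  filter_upwards [Ioo_mem_nhdsGT h0] with e he
  have h1 : p - e • y = (1 - e / ε) • p + (e / ε) • (p - ε • y) := by
    rw [smul_sub, smul_smul, div_mul_cancel₀ _ h0.ne', sub_smul, one_smul]
    abel
  have h2 : 0 ≤ e / ε := div_nonneg he.1.le h0.le
  have h3 : 0 ≤ 1 - e / ε := by
    rw [sub_nonneg, div_le_one h0]; exact he.2.le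
  calc ‖p - e • y‖ ≤ ‖(1 - e / ε) • p‖ + ‖(e / ε) • (p - ε • y)‖ := by
        rw [h1]; exact norm_add_le _ _
    _ ≤ (1 - e / ε) * 1 + (e / ε) * (1 - ε) := by
        rw [norm_smul, norm_smul, Real.norm_of_nonneg h2, Real.norm_of_nonneg h3]
        gcongr
    _ = 1 - e := by field_simp; ring

theorem Dominates.exists_pos {p y : B} (h : Dominates p y) :
    ∃ ε : ℝ, 0 < ε ∧ ε ≤ 1 ∧ ‖p - ε • y‖ ≤ 1 - ε := by
  obtain ⟨ε, h1, h2⟩ := (h.and self_mem_nhdsWithin).exists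
  exact ⟨ε, h2, by linarith [norm_nonneg (p - ε • y)], h1⟩

theorem Dominates.mul {p q y z : B} (hp : ‖p‖ ≤ 1) (hq : ‖q‖ ≤ 1) (hy : ‖y‖ ≤ 1)
    (h : Dominates p y) (h' : Dominates q z) : Dominates (p * q) (y * z) := by
  obtain ⟨ε, h0, h1, h2⟩ := h.exists_pos
  obtain ⟨e, g0, g1, g2⟩ := h'.exists_pos
  refine Dominates.of_exists ((norm_mul_le _ _).trans (mul_le_one₀ hp (norm_nonneg _) hq))
    (mul_pos h0 g0) ?_
  have e1 : p * q - (ε * e) • (y * z) = (p - ε • y) * q + ε • (y * (q - e • z)) := by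
    rw [sub_mul, mul_sub, smul_sub, smul_mul_assoc, mul_smul_comm, smul_smul]
    abel
  calc ‖p * q - (ε * e) • (y * z)‖ ≤ ‖p - ε • y‖ * ‖q‖ + ε * (‖y‖ * ‖q - e • z‖) := by
        rw [e1]
        refine (norm_add_le _ _).trans (add_le_add (norm_mul_le _ _) ?_)
        rw [norm_smul, Real.norm_of_nonneg h0.le]
        gcongr
        exact norm_mul_le _ _
    _ ≤ (1 - ε) * 1 + ε * (1 * (1 - e)) := by
        have := norm_nonneg (q - e • z)
        have : 0 ≤ 1 - ε := by linarith
        gcongr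
    _ = 1 - ε * e := by ring

/-- Finitely many dominations share a common `ε`; this is the benefit of asking for all small `ε` in
the definition. -/
theorem Dominates.sum {ι : Type*} {s : Finset ι} {w : ι → ℝ} {y : ι → B} {p : B}
    (hw : ∀ i ∈ s, 0 ≤ w i) (hs : ∑ i ∈ s, w i = 1) (h : ∀ i ∈ s, Dominates p (y i)) :
    Dominates p (∑ i ∈ s, w i • y i) := by
  have := (Filter.eventually_all_finset s).2 h
  filter_upwards [this] with ε hε
  have e1 : p - ε • ∑ i ∈ s, w i • y i = ∑ i ∈ s, w i • (p - ε • y i) := by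
    simp only [smul_sub, Finset.sum_sub_distrib, ← Finset.sum_smul, hs, one_smul, Finset.smul_sum]
    congr 1
    exact Finset.sum_congr rfl fun i _ => smul_comm _ _ _
  rw [e1]
  calc ‖∑ i ∈ s, w i • (p - ε • y i)‖ ≤ ∑ i ∈ s, w i * (1 - ε) := by
        refine norm_sum_le_of_le _ fun i hi => ?_
        rw [norm_smul, Real.norm_of_nonneg (hw i hi)]
        exact mul_le_mul_of_nonneg_left (hε i hi) (hw i hi)
    _ = 1 - ε := by rw [← Finset.sum_mul, hs, one_mul]

end Minorization

namespace CentralContraction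

variable {B : Type*} [NormedRing B] {η f : B}

theorem antitone_norm_mul_pow (hf1 : ‖f‖ ≤ 1) (x : B) : Antitone fun k : ℕ => ‖x * f ^ k‖ := by
  refine antitone_nat_of_succ_le fun n => ?_
  rw [pow_succ, ← mul_assoc]
  exact (norm_mul_le _ _).trans (mul_le_of_le_one_right (norm_nonneg _) hf1)

theorem antitone_norm_pow_mul (hf1 : ‖f‖ ≤ 1) (x : B) : Antitone fun k : ℕ => ‖f ^ k * x‖ := by
  refine antitone_nat_of_succ_le fun n => ?_
  rw [pow_succ', mul_assoc]
  exact (norm_mul_le _ _).trans (mul_le_of_le_one_left (norm_nonneg _) hf1)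

theorem pow_mul_sub_mul_pow (f g u : B) (n : ℕ) :
    f ^ n * u - u * g ^ n = ∑ j ∈ Finset.range n, f ^ j * (f * u - u * g) * g ^ (n - 1 - j) := by
  induction n with
  | zero => simp
  | succ n ih =>
    rw [Finset.sum_range_succ, Nat.add_sub_cancel, Nat.sub_self, pow_zero, mul_one]
    have : ∑ j ∈ Finset.range n, f ^ j * (f * u - u * g) * g ^ (n - j) =
        (∑ j ∈ Finset.range n, f ^ j * (f * u - u * g) * g ^ (n - 1 - j)) * g := by
      rw [Finset.sum_mul]
      refine Finset.sum_congr rfl fun j hj => ?_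
      have : n - j = n - 1 - j + 1 := by have := Finset.mem_range.1 hj; omega
      rw [this, pow_succ, mul_assoc _ _ g]
    rw [this, ← ih]
    simp only [pow_succ, sub_mul, mul_sub, mul_assoc]
    abel

variable [NormOneClass B]

/-- An approximate intertwining relation `f u ≈ u g` passes to high powers. -/
theorem tendsto_pow_mul_sub_mul_pow {f g u : B} (hf : ‖f‖ ≤ 1) (hg : ‖g‖ ≤ 1)
    (h1 : Tendsto (fun k : ℕ => (k : ℝ) * ‖f ^ k * (f * u - u * g)‖) atTop (𝓝 0))
    (h2 : Tendsto (fun k : ℕ => (k : ℝ) * ‖(f * u - u * g) * g ^ k‖) atTop (𝓝 0)) :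
    Tendsto (fun n : ℕ => ‖f ^ n * u - u * g ^ n‖) atTop (𝓝 0) := by
  set x := f * u - u * g with hx
  have T : Tendsto (fun n : ℕ => 4 * ((((n - 1) / 2 : ℕ) : ℝ) * ‖f ^ ((n - 1) / 2) * x‖ +
      (((n - 1) / 2 : ℕ) : ℝ) * ‖x * g ^ ((n - 1) / 2)‖)) atTop (𝓝 0) := by
    have hlim : Tendsto (fun n : ℕ => (n - 1) / 2) atTop atTop :=
      (Nat.tendsto_div_const_atTop two_ne_zero).comp (tendsto_sub_atTop_nat 1)
    have := ((h1.add h2).comp hlim).const_mul 4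
    simpa using this
  refine squeeze_zero' (Eventually.of_forall fun _ => norm_nonneg _) ?_ T
  filter_upwards [eventually_ge_atTop 3] with n hn
  have hgp : ∀ k, ‖g ^ k‖ ≤ 1 := fun k =>
    (norm_pow_le g k).trans (pow_le_one₀ (norm_nonneg _) hg)
  have hfp : ∀ k, ‖f ^ k‖ ≤ 1 := fun k =>
    (norm_pow_le f k).trans (pow_le_one₀ (norm_nonneg _) hf)
  rw [pow_mul_sub_mul_pow]
  -- In every summand one of the exponents `j`, `n - 1 - j` is at least `k`. The `n ≤ 4 k` summands
  -- are thus each bounded by quantities that are `o(1/k)`.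
  obtain ⟨k, hk⟩ : ∃ k, k = (n - 1) / 2 := ⟨_, rfl⟩
  rw [← hk]
  have hkn : (n : ℝ) ≤ 4 * k := by exact_mod_cast (by omega : n ≤ 4 * k)
  calc ‖∑ j ∈ Finset.range n, f ^ j * x * g ^ (n - 1 - j)‖
      ≤ ∑ j ∈ Finset.range n, (‖f ^ k * x‖ + ‖x * g ^ k‖) := by
        refine norm_sum_le_of_le _ fun j hj => ?_
        have hj := Finset.mem_range.1 hj
        rcases le_or_gt k j with hkj | hkj
        · calc ‖f ^ j * x * g ^ (n - 1 - j)‖ ≤ ‖f ^ j * x‖ * 1 :=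
                (norm_mul_le _ _).trans (by gcongr; exact hgp _)
            _ ≤ ‖f ^ k * x‖ + ‖x * g ^ k‖ := by
                have := antitone_norm_pow_mul hf x hkj
                simp only at this
                linarith [norm_nonneg (x * g ^ k)]
        · calc ‖f ^ j * x * g ^ (n - 1 - j)‖ ≤ 1 * ‖x * g ^ (n - 1 - j)‖ := by
                rw [mul_assoc]
                exact (norm_mul_le _ _).trans (by gcongr; exact hfp _)
            _ ≤ ‖f ^ k * x‖ + ‖x * g ^ k‖ := by
                have := antitone_norm_mul_pow hg x (show k ≤ n - 1 - j by omega)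
                simp only at this
                linarith [norm_nonneg (f ^ k * x)]
    _ = (n : ℝ) * (‖f ^ k * x‖ + ‖x * g ^ k‖) := by
        rw [Finset.sum_const, Finset.card_range, nsmul_eq_mul]
    _ ≤ (4 * k) * (‖f ^ k * x‖ + ‖x * g ^ k‖) := by gcongr
    _ = _ := by ring

variable [NormedAlgebra ℝ B]

/-- A binomial bound for the norms of `x fᵐ` and `fᵐ x`. -/
theorem norm_mul_pow_le_binomial (h : CentralContraction η) {ε : ℝ} (h0 : 0 < ε)
    (hf : ‖f - ε • η‖ ≤ 1 - ε) (x : B) (m : ℕ) :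
    ‖x * f ^ m‖ ≤ ∑ i ∈ Finset.range (m + 1),
        (m.choose i : ℝ) * ε ^ i * (1 - ε) ^ (m - i) * ‖x * η ^ i‖ ∧
    ‖f ^ m * x‖ ≤ ∑ i ∈ Finset.range (m + 1),
        (m.choose i : ℝ) * ε ^ i * (1 - ε) ^ (m - i) * ‖x * η ^ i‖ := by
  set ρ := f - ε • η with hρ
  have hfe : f = ε • η + ρ := by rw [hρ]; abel
  -- Centrality of `η` makes the binomial theorem available for `f = ε • η + ρ`, whatever `f` is.
  have hc : Commute (ε • η) ρ := by
    refine Commute.smul_left (h.comm ρ) ε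
  have hpow : f ^ m = ∑ i ∈ Finset.range (m + 1),
      ((m.choose i : ℝ) * ε ^ i) • (η ^ i * ρ ^ (m - i)) := by
    rw [hfe, hc.add_pow]
    refine Finset.sum_congr rfl fun i _ => ?_
    rw [smul_pow, ← Nat.cast_comm, ← nsmul_eq_mul, ← Nat.cast_smul_eq_nsmul ℝ, smul_mul_assoc,
      smul_smul]
  have hr : ∀ k, ‖ρ ^ k‖ ≤ (1 - ε) ^ k := fun k =>
    (norm_pow_le ρ k).trans (pow_le_pow_left₀ (norm_nonneg _) hf k)
  constructor
  · rw [hpow, Finset.mul_sum]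
    refine norm_sum_le_of_le _ fun i _ => ?_
    rw [mul_smul_comm, norm_smul, Real.norm_of_nonneg (by positivity), ← mul_assoc x]
    have := (norm_mul_le (x * η ^ i) (ρ ^ (m - i))).trans
      (mul_le_mul_of_nonneg_left (hr (m - i)) (norm_nonneg _))
    exact (mul_le_mul_of_nonneg_left this (by positivity)).trans_eq (by ring)
  · rw [hpow, Finset.sum_mul]
    refine norm_sum_le_of_le _ fun i _ => ?_
    rw [smul_mul_assoc, norm_smul, Real.norm_of_nonneg (by positivity), h.pow_comm,
      mul_assoc (ρ ^ _), h.pow_comm]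
    have := (norm_mul_le (ρ ^ (m - i)) (x * η ^ i)).trans
      (mul_le_mul_of_nonneg_right (hr (m - i)) (norm_nonneg _))
    exact (mul_le_mul_of_nonneg_left this (by positivity)).trans_eq (by ring)

/-- Decay along `η` transfers to decay along `f`: a power of `f` is a binomial mixture of powers of
`η` and a remainder of geometric size. Exponents that are not multiples of `N` are covered by
monotonicity. -/
theorem tendsto_zero_of_dominates (h : CentralContraction η) (hf1 : ‖f‖ ≤ 1) {N : ℕ}
    (hN : 0 < N) (hd : Dominates (f ^ N) η) {x : B} (hx : x ∈ littleO η 0) :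
    Tendsto (fun k : ℕ => ‖x * f ^ k‖) atTop (𝓝 0) ∧
      Tendsto (fun k : ℕ => ‖f ^ k * x‖) atTop (𝓝 0) := by
  obtain ⟨ε, h0, h1, h2⟩ := hd.exists_pos
  have hx' : Tendsto (fun n : ℕ => ‖x * η ^ n‖) atTop (𝓝 0) := by
    simpa using mem_littleO.1 hx
  have T := (tendsto_binomial_average h0 h1 (fun _ => norm_nonneg _) hx').comp
    (Nat.tendsto_div_const_atTop hN.ne')
  constructor
  · refine squeeze_zero (fun _ => norm_nonneg _) (fun k => ?_) T
    refine le_trans (antitone_norm_mul_pow hf1 x (Nat.mul_div_le k N)) ?_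
    simp only [pow_mul]
    exact (h.norm_mul_pow_le_binomial h0 h2 x (k / N)).1
  · refine squeeze_zero (fun _ => norm_nonneg _) (fun k => ?_) T
    refine le_trans (antitone_norm_pow_mul hf1 x (Nat.mul_div_le k N)) ?_
    simp only [pow_mul]
    exact (h.norm_mul_pow_le_binomial h0 h2 x (k / N)).2

theorem tendsto_mul_zero_of_dominates (h : CentralContraction η) (hf1 : ‖f‖ ≤ 1) {N : ℕ}
    (hN : 0 < N) (hd : Dominates (f ^ N) η) {x : B} (hx : x ∈ littleO η 2) :
    Tendsto (fun k : ℕ => (k : ℝ) * ‖x * f ^ k‖) atTop (𝓝 0) ∧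
      Tendsto (fun k : ℕ => (k : ℝ) * ‖f ^ k * x‖) atTop (𝓝 0) := by
  obtain ⟨ε, h0, h1, h2⟩ := hd.exists_pos
  have hx0 : Tendsto (fun n : ℕ => ‖x * η ^ n‖) atTop (𝓝 0) := by
    simpa using mem_littleO.1 (littleO_succ_le 0 (littleO_succ_le 1 hx))
  have hx' : Tendsto (fun n : ℕ => ((n : ℝ) + 1) * ‖x * η ^ n‖) atTop (𝓝 0) := by
    have := (mem_littleO.1 hx).add hx0
    simp only [Real.sq_sqrt (Nat.cast_nonneg _), add_zero] at this
    refine this.congr fun n => by ring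
  have T := ((tendsto_mul_binomial_average h0 h1 (fun _ => norm_nonneg _) hx').comp
    (Nat.tendsto_div_const_atTop hN.ne')).const_mul (N : ℝ)
  rw [mul_zero] at T
  have hk : ∀ k : ℕ, (k : ℝ) ≤ (N : ℝ) * (((k / N : ℕ) : ℝ) + 1) := fun k => by
    have := (Nat.lt_mul_div_succ k hN).le
    exact_mod_cast this
  constructor
  · refine squeeze_zero (fun _ => by positivity) (fun k => ?_) T
    rw [Function.comp, ← mul_assoc]
    refine mul_le_mul (hk k) ?_ (norm_nonneg _) (by positivity)
    refine le_trans (antitone_norm_mul_pow hf1 x (Nat.mul_div_le k N)) ?_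
    simp only [pow_mul]
    exact (h.norm_mul_pow_le_binomial h0 h2 x (k / N)).1
  · refine squeeze_zero (fun _ => by positivity) (fun k => ?_) T
    rw [Function.comp, ← mul_assoc]
    refine mul_le_mul (hk k) ?_ (norm_nonneg _) (by positivity)
    refine le_trans (antitone_norm_pow_mul hf1 x (Nat.mul_div_le k N)) ?_
    simp only [pow_mul]
    exact (h.norm_mul_pow_le_binomial h0 h2 x (k / N)).2

end CentralContraction

/-! ### Finitely supported approximation and Taylor expansion of words -/

namespace L1

open CentralContraction

variable {G F : Type*} [Group G] [Group F]

/-- The span of the Dirac masses, i.e. the finitely supported functions. -/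
def finSupp (G : Type*) [Group G] : Submodule ℝ (L1 G) := Submodule.span ℝ (Set.range δ)

theorem δ_mem_finSupp (g : G) : δ g ∈ finSupp G := Submodule.subset_span ⟨g, rfl⟩

theorem mul_mem_finSupp {x y : L1 G} (hx : x ∈ finSupp G) (hy : y ∈ finSupp G) :
    x * y ∈ finSupp G := by
  have h := Submodule.mul_mem_mul hx hy
  rw [finSupp, Submodule.span_mul_span] at h
  refine Submodule.span_mono ?_ h
  rintro _ ⟨_, ⟨g, rfl⟩, _, ⟨k, rfl⟩, rfl⟩
  exact ⟨g * k, (δ_mul_δ g k).symm⟩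

theorem map_mem_finSupp (q : G →* F) {x : L1 G} (hx : x ∈ finSupp G) : map q x ∈ finSupp F := by
  induction hx using Submodule.span_induction with
  | mem x h => obtain ⟨g, rfl⟩ := h; rw [map_δ]; exact δ_mem_finSupp _
  | zero => rw [map_zero]; exact zero_mem _
  | add x y _ _ hx hy => rw [map_add]; exact add_mem hx hy
  | smul c x _ hx => rw [map_smul]; exact Submodule.smul_mem _ _ hx

/-- The elements that agree with a finitely supported one up to second order. -/
def approximable {η : L1 G} (h : CentralContraction η) : Subalgebra ℝ (L1 G) where
  carrier := {x | ∃ y ∈ finSupp G, x - y ∈ littleO η 2}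
  algebraMap_mem' c := by
    refine ⟨algebraMap ℝ (L1 G) c, ?_, by simp⟩
    rw [Algebra.algebraMap_eq_smul_one, one_def]
    exact Submodule.smul_mem _ _ (δ_mem_finSupp 1)
  add_mem' := by
    rintro a b ⟨a', ha, ha'⟩ ⟨b', hb, hb'⟩
    refine ⟨a' + b', add_mem ha hb, ?_⟩
    rw [add_sub_add_comm]
    exact add_mem ha' hb'
  mul_mem' := by
    rintro a b ⟨a', ha, ha'⟩ ⟨b', hb, hb'⟩
    refine ⟨a' * b', mul_mem_finSupp ha hb, ?_⟩
    have : a * b - a' * b' = (a - a') * b + a' * (b - b') := by noncomm_ring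
    rw [this]
    exact add_mem (littleO_mul_right h ha' b) (littleO_mul_left hb' a')

theorem mem_approximable {η : L1 G} {h : CentralContraction η} {x : L1 G} :
    x ∈ approximable h ↔ ∃ y ∈ finSupp G, x - y ∈ littleO η 2 := Iff.rfl

theorem finSupp_le_approximable {η : L1 G} (h : CentralContraction η) {x : L1 G}
    (hx : x ∈ finSupp G) : x ∈ approximable h := ⟨x, hx, by simp⟩

/-- The image of `r * η ^ n` is that of `r` for every `n`, while its norm is at most `‖r * η ^ n‖`,
which tends to zero. -/
theorem map_eq_zero_of_littleO {η : L1 G} {q : G →* F} (hq : map q η = 1) {r : L1 G}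
    (hr : r ∈ littleO η 0) : map q r = 0 := by
  have h0 : Tendsto (fun n : ℕ => ‖r * η ^ n‖) atTop (𝓝 0) := by simpa using mem_littleO.1 hr
  have : ‖map q r‖ ≤ 0 := ge_of_tendsto' h0 fun n => by
    refine le_trans (le_of_eq ?_) (norm_map_le q _)
    rw [map_mul, map_pow, hq, one_pow, mul_one]
  exact norm_le_zero_iff.1 this

/-- First-order part of the Taylor expansion of the product of a word. -/
def taylorOne (l : List G) : L1 G := (l.map fun s => δ s - 1).sum

/-- Second-order part of the Taylor expansion of the product of a word. -/
def taylorTwo : List G → L1 G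
  | [] => 0
  | s :: l => taylorTwo l + (δ s - 1) * taylorOne l

theorem taylorOne_cons (s : G) (l : List G) : taylorOne (s :: l) = (δ s - 1) + taylorOne l := by
  simp [taylorOne]

/-- A finite quotient `q` of `G` with a section `r`, such that every element is a word in `S` times
a value of the section, and a central smoothing element `η`. -/
structure Frame (q : G →* F) (r : F → G) (S : Finset G) (η : L1 G) : Prop where
  central : CentralContraction η
  map_section : ∀ f, q (r f) = f
  letter_bigO : ∀ s ∈ S, δ s - 1 ∈ bigO η
  map_eq_one : map q η = 1
  exists_word : ∀ g, ∃ l : List G, (∀ s ∈ l, s ∈ S) ∧ g = l.prod * r (q g)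

/-- The linear extension of a section. -/
def liftSection (r : F → G) : L1 F →L[ℝ] L1 G := lift (fun f => δ (r f)) fun _ => (norm_δ _).le

theorem liftSection_mem_finSupp [Finite F] (y : L1 F) :
    liftSection r y ∈ finSupp G := by
  cases nonempty_fintype F
  have := (hasSum_coeff y).unique (hasSum_fintype _)
  rw [this, map_sum]
  refine sum_mem fun f _ => ?_
  rw [map_smul, liftSection, lift_δ]
  exact Submodule.smul_mem _ _ (δ_mem_finSupp _)

namespace Frame

variable {q : G →* F} {r : F → G} {S : Finset G} {η : L1 G} (h : Frame q r S η)
include h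

theorem δ_prod_sub_one_mem {l : List G} (hl : ∀ s ∈ l, s ∈ S) : δ l.prod - 1 ∈ bigO η := by
  induction l with
  | nil => simp
  | cons s l ih =>
    have h1 := ih fun t ht => hl t (List.mem_cons_of_mem _ ht)
    have h2 := h.letter_bigO s (hl s List.mem_cons_self)
    have : (δ (s :: l).prod - 1 : L1 G) = (δ s - 1) * δ l.prod + (δ l.prod - 1) := by
      rw [List.prod_cons, ← δ_mul_δ]; noncomm_ring
    rw [this]
    exact add_mem (bigO_mul_right h.central h2 _) h1

theorem δ_prod_sub_taylorOne_mem {l : List G} (hl : ∀ s ∈ l, s ∈ S) :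
    δ l.prod - 1 - taylorOne l ∈ littleO η 1 := by
  induction l with
  | nil => simp [taylorOne]
  | cons s l ih =>
    have hl' : ∀ t ∈ l, t ∈ S := fun t ht => hl t (List.mem_cons_of_mem _ ht)
    have h2 := h.letter_bigO s (hl s List.mem_cons_self)
    have : (δ (s :: l).prod - 1 - taylorOne (s :: l) : L1 G) =
        (δ s - 1) * (δ l.prod - 1) + (δ l.prod - 1 - taylorOne l) := by
      rw [List.prod_cons, ← δ_mul_δ, taylorOne_cons]; noncomm_ring
    rw [this]
    exact add_mem (bigO_mul_bigO h.central h2 (h.δ_prod_sub_one_mem hl')) (ih hl')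

/-- Prepending a letter adds `δ s - 1` times the first-order remainder, that is, a half-order times
an order-one term. -/
theorem δ_prod_sub_taylorTwo_mem {l : List G} (hl : ∀ s ∈ l, s ∈ S) :
    δ l.prod - 1 - taylorOne l - taylorTwo l ∈ littleO η 2 := by
  induction l with
  | nil => simp [taylorOne, taylorTwo]
  | cons s l ih =>
    have hl' : ∀ t ∈ l, t ∈ S := fun t ht => hl t (List.mem_cons_of_mem _ ht)
    have h2 := h.letter_bigO s (hl s List.mem_cons_self)
    have : (δ (s :: l).prod - 1 - taylorOne (s :: l) - taylorTwo (s :: l) : L1 G) =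
        (δ s - 1) * (δ l.prod - 1 - taylorOne l) + (δ l.prod - 1 - taylorOne l - taylorTwo l) := by
      rw [List.prod_cons, ← δ_mul_δ, taylorOne_cons, taylorTwo]; noncomm_ring
    rw [this]
    exact add_mem (bigO_mul_littleO h.central h2 (h.δ_prod_sub_taylorOne_mem hl')) (ih hl')

theorem map_liftSection (y : L1 F) : map q (liftSection r y) = y := by
  have : ((map q).toLinearMap.mkContinuous 1
      (fun x => (norm_map_le q x).trans_eq (one_mul _).symm)).comp (liftSection r) =
      ContinuousLinearMap.id ℝ (L1 F) :=
    ext_clm fun f => by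
      change map q (lift _ _ (δ f)) = δ f
      rw [lift_δ, map_δ, h.map_section]
  exact DFunLike.congr_fun this y

/-- On a Dirac mass at `g`, the difference is `δ l.prod - 1` times a Dirac mass, with `l` the word
of `g`; the finite quotient carries all the zeroth-order information. -/
theorem sub_liftSection_mem_bigO {x : L1 G} (hx : x ∈ approximable h.central) :
    x - liftSection r (map q x) ∈ bigO η := by
  obtain ⟨y, hy, hxy⟩ := hx
  have h1 : y - liftSection r (map q y) ∈ bigO η := by
    clear hxy
    induction hy using Submodule.span_induction with
    | mem x hx =>
      obtain ⟨g, rfl⟩ := hx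
      obtain ⟨l, hl, hg⟩ := h.exists_word g
      rw [map_δ, liftSection, lift_δ]
      have : (δ g - δ (r (q g)) : L1 G) = (δ l.prod - 1) * δ (r (q g)) := by
        rw [sub_mul, δ_mul_δ, ← hg, one_mul]
      rw [this]
      exact bigO_mul_right h.central (h.δ_prod_sub_one_mem hl) _
    | zero => simp
    | add x y _ _ hx hy =>
      rw [map_add, map_add, add_sub_add_comm]
      exact add_mem hx hy
    | smul c x _ hx =>
      rw [map_smul, map_smul, ← smul_sub]
      exact Submodule.smul_mem _ _ hx
  have h2 : map q x = map q y := by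
    rw [← sub_eq_zero, ← map_sub]
    exact map_eq_zero_of_littleO h.map_eq_one (littleO_succ_le 0 (littleO_succ_le 1 hxy))
  rw [h2, ← sub_add_sub_cancel x y]
  exact add_mem (littleO_two_le_bigO hxy) h1

/-- An identity in the finite-dimensional algebra `L1 F` thereby lifts to `L1 G` with an error in
`bigO η`. -/
theorem mem_bigO_of_map_eq_zero {x : L1 G} (hx : x ∈ approximable h.central) (h0 : map q x = 0) :
    x ∈ bigO η := by
  have := h.sub_liftSection_mem_bigO hx
  rwa [h0, map_zero, sub_zero] at this

end Frame

/-! ### Finite groups -/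

/-- The uniform distribution on a finite group. -/
def uniform (F : Type*) [Fintype F] : L1 F := (Fintype.card F : ℝ)⁻¹ • ∑ f, δ f

theorem δ_mul_uniform [Fintype F] (f : F) : δ f * uniform F = uniform F := by
  rw [uniform, mul_smul_comm, Finset.mul_sum]
  simp only [δ_mul_δ]
  congr 1
  exact Fintype.sum_equiv (Equiv.mulLeft f) _ _ fun _ => rfl

theorem uniform_mul_δ [Fintype F] (f : F) : uniform F * δ f = uniform F := by
  rw [uniform, smul_mul_assoc, Finset.sum_mul]
  simp only [δ_mul_δ]
  congr 1
  exact Fintype.sum_equiv (Equiv.mulRight f) _ _ fun _ => rfl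

theorem mul_uniform [Fintype F] (y : L1 F) : y * uniform F = mass y • uniform F := by
  have := (hasSum_coeff y).unique (hasSum_fintype _)
  rw [this, Finset.sum_mul, map_sum, Finset.sum_smul]
  refine Finset.sum_congr rfl fun f _ => ?_
  rw [smul_mul_assoc, δ_mul_uniform, map_smul, mass_δ, smul_eq_mul, mul_one]

theorem uniform_mul [Fintype F] (y : L1 F) : uniform F * y = mass y • uniform F := by
  have := (hasSum_coeff y).unique (hasSum_fintype _)
  rw [this, Finset.mul_sum, map_sum, Finset.sum_smul]
  refine Finset.sum_congr rfl fun f _ => ?_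
  rw [mul_smul_comm, uniform_mul_δ, map_smul, mass_δ, smul_eq_mul, mul_one]

@[simp] theorem mass_uniform [Fintype F] : mass (uniform F) = 1 := by
  simp [uniform]

theorem uniform_mul_self [Fintype F] : uniform F * uniform F = uniform F := by
  rw [mul_uniform, mass_uniform, one_smul]

instance [Finite F] : FiniteDimensional ℝ (L1 F) := by
  cases nonempty_fintype F
  let f : L1 F →ₗ[ℝ] F → ℝ :=
    { toFun := coeff
      map_add' := fun x y => rfl
      map_smul' := fun c x => rfl }
  refine FiniteDimensional.of_injective f fun x y hxy => ?_
  have h1 := (hasSum_coeff x).unique (hasSum_fintype _)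
  have h2 := (hasSum_coeff y).unique (hasSum_fintype _)
  rw [h1, h2]
  have : coeff x = coeff y := hxy
  rw [this]

theorem _root_.Dominates.map {p y : L1 G} (hd : Dominates p y) (q : G →* F) :
    Dominates (L1.map q p) (L1.map q y) := by
  filter_upwards [hd] with ε hε
  refine le_trans ?_ hε
  rw [← map_smul, ← map_sub]
  exact norm_map_le q _

/-- The complement of the uniform distribution is a multiple of `1 - f`, for a distribution `f`
some power of which dominates the uniform distribution. -/
theorem exists_mul_one_sub_eq [Fintype F] {f : L1 F} (hm : mass f = 1) {N : ℕ}
    (hd : Dominates (f ^ N) (uniform F)) :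
    ∃ z, Commute z f ∧ z * (1 - f) = 1 - uniform F := by
  obtain ⟨c, h0, h1, h2⟩ := hd.exists_pos
  set U := uniform F
  set w := f ^ N - c • U with hw
  have hUf : Commute f U := by
    show f * U = U * f
    rw [mul_uniform, uniform_mul]
  have hfw : Commute f w := by
    refine Commute.sub_right (Commute.self_pow f N) (hUf.smul_right c)
  -- Domination makes `w` a strict contraction, so `1 - w` is invertible. Since `(1 - w) * (1 - U) =
  -- 1 - f ^ N`, the geometric sum then exhibits `1 - U` as a multiple of `1 - f`.
  obtain ⟨v, hv⟩ := isUnit_one_sub_of_norm_lt_one (show ‖w‖ < 1 by linarith)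
  have e1 : (1 - w) * (1 - U) = 1 - f ^ N := by
    have : w * U = (1 - c) • U := by
      rw [hw, sub_mul, mul_uniform, map_pow, hm, smul_mul_assoc, uniform_mul_self, sub_smul,
        one_pow]
    rw [sub_mul, mul_sub, mul_sub, this, hw]
    simp only [one_mul, mul_one, sub_smul, one_smul]
    abel
  refine ⟨↑v⁻¹ * ∑ i ∈ Finset.range N, f ^ i, ?_, ?_⟩
  · refine Commute.mul_left ?_ ?_
    · refine Commute.units_inv_left ?_
      rw [hv]
      exact (Commute.one_left f).sub_left hfw.symm
    · exact Commute.sum_left _ _ _ fun i _ => Commute.pow_self f i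
  · rw [mul_assoc, geom_sum_mul_neg, ← e1, ← hv, Units.inv_mul_cancel_left]

/-- Raise the previous identity to the power `a`: `1 - uniform F` is idempotent and everything
commutes. -/
theorem exists_mul_one_sub_pow_eq [Fintype F] {f : L1 F} (hm : mass f = 1) {N : ℕ}
    (hd : Dominates (f ^ N) (uniform F)) {a : ℕ} (ha : a ≠ 0) :
    ∃ z, z * (1 - f) ^ a = 1 - uniform F ∧ (1 - f) ^ a * z = 1 - uniform F := by
  obtain ⟨z, hz, h1⟩ := exists_mul_one_sub_eq hm hd
  have hz' : Commute z (1 - f) := (Commute.one_right z).sub_right hz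
  have hid : IsIdempotentElem (1 - uniform F) :=
    IsIdempotentElem.one_sub uniform_mul_self
  have h2 : z ^ a * (1 - f) ^ a = 1 - uniform F := by
    rw [← hz'.mul_pow, h1]
    exact hid.pow_eq ha
  exact ⟨z ^ a, h2, by rw [← (hz'.pow_pow a a).eq, h2]⟩

end L1

/-! ### Bounds in terms of word length, and lifting from the finite quotient -/

namespace L1

open CentralContraction

variable {G F : Type*} [Group G] [Group F]

theorem centralContraction_uniform [Fintype F] : CentralContraction (uniform F) where
  comm x := by rw [uniform_mul, mul_uniform]
  norm_le := by
    rw [uniform, norm_smul, norm_inv, Real.norm_natCast, inv_mul_le_iff₀ (by positivity), mul_one]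
    refine (norm_sum_le _ _).trans ?_
    simp

theorem mem_littleO_uniform_of_mass_eq_zero [Fintype F] {x : L1 F} (hx : mass x = 0) :
    x ∈ littleO (uniform F) 0 := by
  rw [mem_littleO]
  refine tendsto_const_nhds.congr' ?_
  filter_upwards [eventually_ge_atTop 1] with n hn
  obtain ⟨m, rfl⟩ := Nat.exists_eq_add_of_le' hn
  rw [pow_succ' (uniform F), ← mul_assoc, mul_uniform, hx]
  simp

/-- Linear growth in the length, uniformly in `n`, feeds the quadratic bounds for the dominated
convergence under the second moment. -/
theorem taylorOne_bound {S : Finset G} {η : L1 G} {M : ℝ}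
    (hM : ∀ s ∈ S, ∀ n : ℕ, √(n : ℝ) * ‖(δ s - 1) * η ^ n‖ ≤ M)
    {l : List G} (hl : ∀ s ∈ l, s ∈ S) (n : ℕ) :
    √(n : ℝ) * ‖taylorOne l * η ^ n‖ ≤ l.length * M ∧
      √(n : ℝ) * ‖(δ l.prod - 1) * η ^ n‖ ≤ l.length * M := by
  induction l with
  | nil => simp [taylorOne]
  | cons s l ih =>
    obtain ⟨i1, i2⟩ := ih fun t ht => hl t (List.mem_cons_of_mem _ ht)
    have hs := hM s (hl s List.mem_cons_self) n
    have hcast : (((s :: l).length : ℕ) : ℝ) = l.length + 1 := by simp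
    constructor
    · have e : taylorOne (s :: l) * η ^ n = (δ s - 1) * η ^ n + taylorOne l * η ^ n := by
        rw [taylorOne_cons, add_mul]
      rw [e, hcast]
      have := mul_le_mul_of_nonneg_left (norm_add_le ((δ s - 1) * η ^ n) (taylorOne l * η ^ n))
        (Real.sqrt_nonneg (n : ℝ))
      linarith
    · have e : (δ (s :: l).prod - 1) * η ^ n =
          δ s * ((δ l.prod - 1) * η ^ n) + (δ s - 1) * η ^ n := by
        rw [List.prod_cons, ← δ_mul_δ]; noncomm_ring
      have e2 : ‖δ s * ((δ l.prod - 1) * η ^ n)‖ ≤ ‖(δ l.prod - 1) * η ^ n‖ :=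
        (norm_mul_le _ _).trans (by rw [norm_δ, one_mul])
      rw [e, hcast]
      have := mul_le_mul_of_nonneg_left ((norm_add_le (δ s * ((δ l.prod - 1) * η ^ n))
        ((δ s - 1) * η ^ n)).trans (add_le_add_left e2 _))
        (Real.sqrt_nonneg (n : ℝ))
      linarith

theorem mul_bound {η : L1 G} (h : CentralContraction η) {x y : L1 G} {a b : ℝ}
    (hx : ∀ n : ℕ, √(n : ℝ) * ‖x * η ^ n‖ ≤ a)
    (hy : ∀ n : ℕ, √(n : ℝ) * ‖y * η ^ n‖ ≤ b) {n : ℕ} (hn : 2 ≤ n) :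
    (n : ℝ) * ‖x * y * η ^ n‖ ≤ 4 * a * b := by
  obtain ⟨k, m, hk, hm, rfl⟩ : ∃ k m, n ≤ 4 * k ∧ n ≤ 4 * m ∧ n = k + m :=
    ⟨n - n / 2, n / 2, by omega, by omega, by omega⟩
  have e1 : √((k + m : ℕ) : ℝ) ≤ 2 * √(k : ℝ) := by
    rw [Real.sqrt_le_left (by positivity), mul_pow, Real.sq_sqrt (by positivity)]
    exact_mod_cast (by omega)
  have e2 : √((k + m : ℕ) : ℝ) ≤ 2 * √(m : ℝ) := by
    rw [Real.sqrt_le_left (by positivity), mul_pow, Real.sq_sqrt (by positivity)]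
    exact_mod_cast (by omega)
  have ha : 0 ≤ a := le_trans (by positivity) (hx 0)
  calc ((k + m : ℕ) : ℝ) * ‖x * y * η ^ (k + m)‖
      = √((k + m : ℕ) : ℝ) * √((k + m : ℕ) : ℝ) * ‖x * y * η ^ (k + m)‖ := by
        rw [Real.mul_self_sqrt (by positivity)]
    _ ≤ (2 * √(k : ℝ)) * (2 * √(m : ℝ)) * (‖x * η ^ k‖ * ‖y * η ^ m‖) := by
        gcongr
        exact h.norm_mul_mul_pow_le x y k m
    _ = 4 * (√(k : ℝ) * ‖x * η ^ k‖) * (√(m : ℝ) * ‖y * η ^ m‖) := by ring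
    _ ≤ 4 * a * b := by
        gcongr
        exacts [hx k, hy m]

namespace Frame

variable {q : G →* F} {r : F → G} {S : Finset G} {η : L1 G} (h : Frame q r S η)
include h

section Complement

variable [Fintype F] {u f : L1 G} {N : ℕ} (hu : u ∈ finSupp G) (hqu : map q u = uniform F)
  (hf : f ∈ approximable h.central) (hm : mass f = 1) (hdu : Dominates (f ^ N) u)
include hu hqu hf hm hdu

/-- In the quotient the complement of the uniform distribution is an exact multiple of `(1 - map q
f) ^ a`; the lifted identity has an error in `bigO η`. -/
theorem exists_complement_sub_mem_bigO {a : ℕ} (ha : a ≠ 0) :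
    (∃ z, 1 - u - z * (1 - f) ^ a ∈ bigO η) ∧ ∃ z, 1 - u - (1 - f) ^ a * z ∈ bigO η := by
  have hd : Dominates (map q f ^ N) (uniform F) := by
    have := hdu.map q
    rwa [hqu, map_pow] at this
  obtain ⟨z, h1, h2⟩ := exists_mul_one_sub_pow_eq (by rw [mass_map, hm]) hd ha
  have hz := finSupp_le_approximable h.central (liftSection_mem_finSupp (r := r) z)
  have hu' := finSupp_le_approximable h.central hu
  have hfa : (1 - f) ^ a ∈ approximable h.central := pow_mem (sub_mem (one_mem _) hf) a
  refine ⟨⟨liftSection r z, h.mem_bigO_of_map_eq_zero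
    (sub_mem (sub_mem (one_mem _) hu') (mul_mem hz hfa)) ?_⟩, ⟨liftSection r z,
    h.mem_bigO_of_map_eq_zero (sub_mem (sub_mem (one_mem _) hu') (mul_mem hfa hz)) ?_⟩⟩
  · simp only [map_sub, map_mul, map_pow, map_one, hqu, h.map_liftSection, h1, sub_self]
  · simp only [map_sub, map_mul, map_pow, map_one, hqu, h.map_liftSection, h2, sub_self]

/-- Up to an element of `bigO η`, the factor `1 - u` is a multiple of `(1 - f) ^ a`, which
annihilates `x` to second order. The error times `x` is half an order better than `x`. -/
theorem complement_mul_mem {a : ℕ} (ha : a ≠ 0) {i : ℕ} (hi : i ≤ 1) {x : L1 G}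
    (hx : x ∈ littleO η i) (hxa : (1 - f) ^ a * x ∈ littleO η 2) :
    (1 - u) * x ∈ littleO η (i + 1) := by
  obtain ⟨⟨z, hz⟩, -⟩ := h.exists_complement_sub_mem_bigO hu hqu hf hm hdu ha
  have e : (1 - u) * x = (1 - u - z * (1 - f) ^ a) * x + z * ((1 - f) ^ a * x) := by
    noncomm_ring
  have hle : littleO η 2 ≤ littleO η (i + 1) := by
    interval_cases i
    exacts [littleO_succ_le 1, le_rfl]
  rw [e]
  exact add_mem (bigO_mul_littleO h.central hz hx) (hle (littleO_mul_left hxa z))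

theorem mul_complement_mem {a : ℕ} (ha : a ≠ 0) {i : ℕ} (hi : i ≤ 1) {x : L1 G}
    (hx : x ∈ littleO η i) (hxa : x * (1 - f) ^ a ∈ littleO η 2) :
    x * (1 - u) ∈ littleO η (i + 1) := by
  obtain ⟨-, ⟨z, hz⟩⟩ := h.exists_complement_sub_mem_bigO hu hqu hf hm hdu ha
  have e : x * (1 - u) = x * (1 - u - (1 - f) ^ a * z) + x * (1 - f) ^ a * z := by
    noncomm_ring
  have hle : littleO η 2 ≤ littleO η (i + 1) := by
    interval_cases i
    exacts [littleO_succ_le 1, le_rfl]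
  rw [e]
  exact add_mem (littleO_mul_bigO h.central hx hz) (hle (littleO_mul_right h.central hxa z))

end Complement

/-- Elements of mass zero are killed by high powers of `f`. -/
theorem tendsto_zero_of_mass_eq_zero [Fintype F] {u f : L1 G} {N : ℕ}
    (hqu : map q u = uniform F) (hf : f ∈ approximable h.central) (hdu : Dominates (f ^ N) u)
    (hf1 : ‖f‖ ≤ 1) (hN : 0 < N) (hdη : Dominates (f ^ N) η)
    {σ : L1 G} (hσ : σ ∈ approximable h.central) (hσ0 : mass σ = 0) :
    Tendsto (fun k : ℕ => ‖σ * f ^ k‖) atTop (𝓝 0) ∧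
      Tendsto (fun k : ℕ => ‖f ^ k * σ‖) atTop (𝓝 0) := by
  have hd : Dominates (map q f ^ N) (uniform F) := by
    have := hdu.map q
    rwa [hqu, map_pow] at this
  have hf1' : ‖map q f‖ ≤ 1 := (norm_map_le q f).trans hf1
  obtain ⟨t1, t2⟩ := centralContraction_uniform.tendsto_zero_of_dominates hf1' hN hd
    (mem_littleO_uniform_of_mass_eq_zero (x := map q σ) (by rw [mass_map, hσ0]))
  have hpow : ∀ k, ‖f ^ k‖ ≤ 1 := fun k =>
    (norm_pow_le f k).trans (pow_le_one₀ (norm_nonneg _) hf1)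
  have hfk : ∀ k, f ^ k ∈ approximable h.central := fun k => pow_mem hf k
  -- Split `y` into the lift of its image, of norm at most `‖map q y‖`, and a `bigO η` part killed
  -- by powers of `f`.
  have key : ∀ y ∈ approximable h.central, ∀ e > 0, ‖map q y‖ < e →
      (∀ᶠ k : ℕ in atTop, ‖y * f ^ k‖ < e) ∧ ∀ᶠ k : ℕ in atTop, ‖f ^ k * y‖ < e := by
    intro y hy e he hye
    set s := liftSection r (map q y)
    have hs : ‖s‖ ≤ ‖map q y‖ := norm_lift_apply_le _ _ _
    obtain ⟨s1, s2⟩ := h.central.tendsto_zero_of_dominates hf1 hN hdη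
      (bigO_le_littleO (h.sub_liftSection_mem_bigO hy))
    have he' : 0 < e - ‖map q y‖ := by linarith
    constructor
    · filter_upwards [s1.eventually (gt_mem_nhds he')] with k hk
      have e1 : y * f ^ k = (y - s) * f ^ k + s * f ^ k := by noncomm_ring
      have e2 : ‖s * f ^ k‖ ≤ ‖s‖ :=
        (norm_mul_le _ _).trans (mul_le_of_le_one_right (norm_nonneg _) (hpow k))
      have := norm_add_le ((y - s) * f ^ k) (s * f ^ k)
      rw [e1]
      linarith
    · filter_upwards [s2.eventually (gt_mem_nhds he')] with k hk
      have e1 : f ^ k * y = f ^ k * (y - s) + f ^ k * s := by noncomm_ring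
      have e2 : ‖f ^ k * s‖ ≤ ‖s‖ :=
        (norm_mul_le _ _).trans (mul_le_of_le_one_left (norm_nonneg _) (hpow k))
      have := norm_add_le (f ^ k * (y - s)) (f ^ k * s)
      rw [e1]
      linarith
  constructor
  · rw [Metric.tendsto_atTop]
    intro e he
    obtain ⟨k0, hk0⟩ := (t1.eventually (gt_mem_nhds he)).exists
    rw [← map_pow, ← map_mul] at hk0
    obtain ⟨k1, hk1⟩ := eventually_atTop.1 (key _ (mul_mem hσ (hfk k0)) e he hk0).1
    refine ⟨k0 + k1, fun k hk => ?_⟩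
    obtain ⟨m, rfl⟩ := Nat.exists_eq_add_of_le ((Nat.le_add_right k0 k1).trans hk)
    rw [Real.dist_eq, sub_zero, abs_norm, pow_add, ← mul_assoc]
    exact hk1 m (by omega)
  · rw [Metric.tendsto_atTop]
    intro e he
    obtain ⟨k0, hk0⟩ := (t2.eventually (gt_mem_nhds he)).exists
    rw [← map_pow, ← map_mul] at hk0
    obtain ⟨k1, hk1⟩ := eventually_atTop.1 (key _ (mul_mem (hfk k0) hσ) e he hk0).2
    refine ⟨k0 + k1, fun k hk => ?_⟩
    obtain ⟨m, rfl⟩ := Nat.exists_eq_add_of_le ((Nat.le_add_right k0 k1).trans hk)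
    rw [Real.dist_eq, sub_zero, abs_norm, add_comm k0, pow_add, mul_assoc]
    exact hk1 m (by omega)

/-- A polynomial in `f`, of mass one, that annihilates everything but the generalized eigenspace
of the eigenvalue one, up to second order. -/
theorem exists_polynomial [Finite F] {f : L1 G} (hf : f ∈ approximable h.central) :
    ∃ (p : Polynomial ℝ) (a : ℕ), p.eval 1 = 1 ∧ a ≠ 0 ∧
      (1 - f) ^ a * Polynomial.aeval f p ∈ littleO η 2 := by
  have hint : IsIntegral ℝ (map q f) := IsIntegral.of_finite ℝ _
  obtain ⟨q0, h1, h2⟩ := Polynomial.exists_eq_pow_rootMultiplicity_mul_and_not_dvd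
    (minpoly ℝ (map q f)) (minpoly.ne_zero hint) 1
  set b := (minpoly ℝ (map q f)).rootMultiplicity 1
  have hc : q0.eval 1 ≠ 0 := fun h0 => h2 (Polynomial.dvd_iff_isRoot.2 h0)
  have hfm : 1 - f ∈ approximable h.central := sub_mem (one_mem _) hf
  have hq0 : Polynomial.aeval f q0 ∈ approximable h.central :=
    Algebra.adjoin_le (Set.singleton_subset_iff.2 hf) (Polynomial.aeval_mem_adjoin_singleton ℝ f)
  -- Up to sign this is the minimal polynomial of `map q f` evaluated at `f`, so it maps to zero and
  -- lies in `bigO η`.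
  set y := (1 - f) ^ b * Polynomial.aeval f q0 with hy
  have hcomm : Commute (1 - f) (Polynomial.aeval f q0) := by
    have : (1 - f) = Polynomial.aeval f (1 - Polynomial.X : Polynomial ℝ) := by simp
    rw [this, Commute, SemiconjBy, ← map_mul, mul_comm, map_mul]
  have hyO : y ∈ bigO η := by
    refine h.mem_bigO_of_map_eq_zero (mul_mem (pow_mem hfm b) hq0) ?_
    have h0 := minpoly.aeval ℝ (map q f)
    rw [h1, map_mul, map_pow, map_sub, Polynomial.aeval_X, Polynomial.aeval_C, map_one] at h0
    have e : (1 - map q f) ^ b = (-1) ^ b * (map q f - 1) ^ b := by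
      rw [← neg_sub, neg_pow]
    rw [hy, map_mul, map_pow, map_sub, map_one, ← Polynomial.aeval_algHom_apply, e, mul_assoc, h0,
      mul_zero]
  -- The cube of `y` is of second order, as a product of three `bigO η` elements. The extra `+ 1`
  -- only ensures that the exponent is nonzero.
  refine ⟨(Polynomial.C (q0.eval 1)⁻¹ * q0) ^ 3, 3 * b + 1, ?_, by omega, ?_⟩
  · simp [hc]
  · have e : (1 - f) ^ (3 * b + 1) *
        Polynomial.aeval f ((Polynomial.C (q0.eval 1)⁻¹ * q0) ^ 3) =
        ((q0.eval 1)⁻¹ ^ 3) • ((1 - f) * (y * (y * y))) := by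
      have e1 : y * (y * y) = (1 - f) ^ (3 * b) * Polynomial.aeval f q0 ^ 3 := by
        have : y * (y * y) = y ^ 3 := by noncomm_ring
        rw [this, hy, (hcomm.pow_left b).mul_pow, ← pow_mul, mul_comm b]
      rw [e1, map_pow, map_mul, Polynomial.aeval_C, ← Algebra.smul_def, smul_pow, mul_smul_comm,
        pow_succ' (1 - f), mul_assoc]
    rw [e]
    exact Submodule.smul_mem _ _ (littleO_mul_left
      (bigO_mul_littleO h.central hyO (bigO_mul_bigO h.central hyO hyO)) _)

section Moments

/-- Each new letter adds a product of two half-order terms, of size linear in the length; summation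
gives quadratic growth, matching the second moment. -/
theorem taylorTwo_bound {M : ℝ} (hM : ∀ s ∈ S, ∀ n : ℕ, √(n : ℝ) * ‖(δ s - 1) * η ^ n‖ ≤ M)
    {l : List G} (hl : ∀ s ∈ l, s ∈ S) {n : ℕ} (hn : 2 ≤ n) :
    (n : ℝ) * ‖taylorTwo l * η ^ n‖ ≤ 4 * M ^ 2 * (l.length : ℝ) ^ 2 ∧
      (n : ℝ) * ‖(δ l.prod - 1 - taylorOne l) * η ^ n‖ ≤ 4 * M ^ 2 * (l.length : ℝ) ^ 2 := by
  induction l with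
  | nil => simp [taylorOne, taylorTwo]
  | cons s l ih =>
    have hl' : ∀ t ∈ l, t ∈ S := fun t ht => hl t (List.mem_cons_of_mem _ ht)
    obtain ⟨i1, i2⟩ := ih hl'
    have hs := hM s (hl s List.mem_cons_self)
    have b1 := mul_bound h.central hs (fun m => (taylorOne_bound hM hl' m).1) hn
    have b2 := mul_bound h.central hs (fun m => (taylorOne_bound hM hl' m).2) hn
    have hcast : (((s :: l).length : ℕ) : ℝ) = l.length + 1 := by simp
    have hle : 4 * M ^ 2 * (l.length : ℝ) ^ 2 + 4 * M * (l.length * M) ≤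
        4 * M ^ 2 * ((l.length : ℝ) + 1) ^ 2 := by
      have : 0 ≤ M ^ 2 * (l.length : ℝ) := by positivity
      nlinarith [sq_nonneg M]
    rw [hcast]
    constructor
    · have e : taylorTwo (s :: l) * η ^ n =
          taylorTwo l * η ^ n + (δ s - 1) * taylorOne l * η ^ n := by
        rw [taylorTwo, add_mul]
      rw [e]
      have := mul_le_mul_of_nonneg_left (norm_add_le (taylorTwo l * η ^ n)
        ((δ s - 1) * taylorOne l * η ^ n)) (Nat.cast_nonneg (α := ℝ) n)
      linarith
    · have e : (δ (s :: l).prod - 1 - taylorOne (s :: l)) * η ^ n =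
          (δ l.prod - 1 - taylorOne l) * η ^ n + (δ s - 1) * (δ l.prod - 1) * η ^ n := by
        rw [List.prod_cons, ← δ_mul_δ, taylorOne_cons]; noncomm_ring
      rw [e]
      have := mul_le_mul_of_nonneg_left (norm_add_le ((δ l.prod - 1 - taylorOne l) * η ^ n)
        ((δ s - 1) * (δ l.prod - 1) * η ^ n)) (Nat.cast_nonneg (α := ℝ) n)
      linarith

end Moments

end Frame

theorem norm_δ_sub_one_le (s : G) : ‖(δ s - 1 : L1 G)‖ ≤ 2 := by
  refine (norm_sub_le _ _).trans ?_
  rw [norm_δ, norm_one]; norm_num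

theorem norm_taylorOne_le (l : List G) : ‖taylorOne l‖ ≤ 2 * l.length := by
  induction l with
  | nil => simp [taylorOne]
  | cons s l ih =>
    rw [taylorOne_cons, List.length_cons]
    push_cast
    have := norm_add_le (δ s - 1) (taylorOne l)
    have := norm_δ_sub_one_le s
    linarith

theorem norm_taylorTwo_le (l : List G) : ‖taylorTwo l‖ ≤ 4 * (l.length : ℝ) ^ 2 := by
  induction l with
  | nil => simp [taylorTwo]
  | cons s l ih =>
    rw [taylorTwo, List.length_cons]
    push_cast
    have h1 := norm_add_le (taylorTwo l) ((δ s - 1) * taylorOne l)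
    have h2 : ‖(δ s - 1) * taylorOne l‖ ≤ 2 * (2 * l.length) :=
      (norm_mul_le _ _).trans (mul_le_mul (norm_δ_sub_one_le s) (norm_taylorOne_le l)
        (norm_nonneg _) (by norm_num))
    nlinarith

/-- The span of `1` and the first differences `δ s - 1`. -/
def firstDifferences (S : Finset G) : Submodule ℝ (L1 G) :=
  Submodule.span ℝ (insert 1 ((fun s => δ s - 1) '' (S : Set G)))

theorem taylorOne_mem {S : Finset G} {l : List G} (hl : ∀ s ∈ l, s ∈ S) :
    taylorOne l ∈ firstDifferences S := by
  refine list_sum_mem fun x hx => ?_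
  obtain ⟨s, hs, rfl⟩ := List.mem_map.1 hx
  exact Submodule.subset_span (Or.inr ⟨s, hl s hs, rfl⟩)

theorem one_mem_firstDifferences (S : Finset G) : (1 : L1 G) ∈ firstDifferences S :=
  Submodule.subset_span (Or.inl rfl)

theorem taylorTwo_mem {S : Finset G} {l : List G} (hl : ∀ s ∈ l, s ∈ S) :
    taylorTwo l ∈ firstDifferences S * firstDifferences S := by
  induction l with
  | nil => exact zero_mem _
  | cons s l ih =>
    have hl' : ∀ t ∈ l, t ∈ S := fun t ht => hl t (List.mem_cons_of_mem _ ht)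
    exact add_mem (ih hl') (Submodule.mul_mem_mul
      (Submodule.subset_span (Or.inr ⟨s, hl s List.mem_cons_self, rfl⟩)) (taylorOne_mem hl'))

theorem firstDifferences_le_finSupp (S : Finset G) : firstDifferences S ≤ finSupp G := by
  rw [firstDifferences, Submodule.span_le]
  rintro _ (rfl | ⟨s, -, rfl⟩)
  · exact δ_mem_finSupp 1
  · exact sub_mem (δ_mem_finSupp s) (δ_mem_finSupp 1)

/-- A summable family with a finite second moment along words is approximable. -/
theorem Frame.mem_approximable_of_moment {q : G →* F} {r : F → G} {S : Finset G} {η : L1 G}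
    (h : Frame q r S η) [Finite F] {ν : L1 G} (w : G → List G) (hw : ∀ g, ∀ s ∈ w g, s ∈ S)
    (hwg : ∀ g, g = (w g).prod * r (q g))
    (hν : Summable fun g => |coeff ν g| * ((w g).length + 1 : ℝ) ^ 2) :
    ν ∈ approximable h.central := by
  set V := firstDifferences S
  -- All second-order Taylor polynomials lie in `W`, as `V` contains `1`. Being finite-dimensional,
  -- `W` is closed, so their infinite sum is still finitely supported.
  set W := V * V * Submodule.span ℝ (Set.range fun f => (δ (r f) : L1 G)) with hW
  let T : G → L1 G := fun g => (1 + taylorOne (w g) + taylorTwo (w g)) * δ (r (q g))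
  have hVfg : V.FG := Submodule.fg_span ((S.finite_toSet.image _).insert _)
  have hWfg : W.FG := (hVfg.mul hVfg).mul (Submodule.fg_span (Set.finite_range _))
  have : FiniteDimensional ℝ W := Module.Finite.iff_fg.2 hWfg
  have hTW : ∀ g, T g ∈ W := fun g => by
    refine Submodule.mul_mem_mul (add_mem (add_mem ?_ ?_) (taylorTwo_mem (hw g)))
      (Submodule.subset_span ⟨q g, rfl⟩)
    · have := Submodule.mul_mem_mul (one_mem_firstDifferences S) (one_mem_firstDifferences S)
      rwa [one_mul] at this
    · have := Submodule.mul_mem_mul (one_mem_firstDifferences S) (taylorOne_mem (hw g))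
      rwa [one_mul] at this
  have hWfin : W ≤ finSupp G := by
    have hmul : finSupp G * finSupp G ≤ finSupp G :=
      Submodule.mul_le.2 fun x hx y hy => mul_mem_finSupp hx hy
    have hV := firstDifferences_le_finSupp S
    refine (mul_le_mul' ((mul_le_mul' hV hV).trans hmul) ?_).trans hmul
    rw [Submodule.span_le]
    rintro _ ⟨f, rfl⟩
    exact δ_mem_finSupp _
  have hTn : ∀ g, ‖T g‖ ≤ 4 * ((w g).length + 1 : ℝ) ^ 2 := fun g => by
    refine (norm_mul_le _ _).trans ?_
    rw [norm_δ, mul_one]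
    have h1 := norm_add₃_le (a := (1 : L1 G)) (b := taylorOne (w g)) (c := taylorTwo (w g))
    have h2 := norm_taylorOne_le (w g)
    have h3 := norm_taylorTwo_le (w g)
    rw [norm_one] at h1
    nlinarith [Nat.cast_nonneg (α := ℝ) (w g).length]
  have hsumT : Summable fun g => coeff ν g • T g := by
    refine Summable.of_norm_bounded (hν.mul_left 4) fun g => ?_
    rw [norm_smul, Real.norm_eq_abs, mul_left_comm]
    exact mul_le_mul_of_nonneg_left (hTn g) (abs_nonneg _)
  have hyW : ∑' g, coeff ν g • T g ∈ W := by
    refine (Submodule.closed_of_finiteDimensional W).mem_of_tendsto hsumT.hasSum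
      (Eventually.of_forall fun s => ?_)
    exact sum_mem fun g _ => Submodule.smul_mem _ _ (hTW g)
  refine ⟨_, hWfin hyW, ?_⟩
  set R : G → L1 G := fun g => δ g - T g
  have hR : ∀ g, R g = (δ (w g).prod - 1 - taylorOne (w g) - taylorTwo (w g)) * δ (r (q g)) := by
    intro g
    have : (δ g : L1 G) = δ (w g).prod * δ (r (q g)) := by rw [δ_mul_δ, ← hwg g]
    simp only [R, T, this]
    noncomm_ring
  have hdiff : HasSum (fun g => coeff ν g • R g) (ν - ∑' g, coeff ν g • T g) := by
    have := (hasSum_coeff ν).sub hsumT.hasSum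
    simpa only [← smul_sub] using this
  have hlim : ∀ g, Tendsto (fun n : ℕ => |coeff ν g| * ((n : ℝ) * ‖R g * η ^ n‖)) atTop (𝓝 0) := by
    intro g
    have hmem : R g ∈ littleO η 2 := by
      rw [hR]
      exact littleO_mul_right h.central (h.δ_prod_sub_taylorTwo_mem (hw g)) _
    have := (mem_littleO.1 hmem).const_mul |coeff ν g|
    simpa only [Real.sq_sqrt (Nat.cast_nonneg _), mul_zero] using this
  obtain ⟨M, hM⟩ : ∃ M, ∀ s ∈ S, ∀ n : ℕ, √(n : ℝ) * ‖(δ s - 1) * η ^ n‖ ≤ M := by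
    choose! C hC using fun s (hs : s ∈ S) => mem_bigO.1 (h.letter_bigO s hs)
    obtain ⟨M, hM⟩ := (S.finite_toSet.image C).bddAbove
    exact ⟨M, fun s hs n => (hC s hs n).trans (hM ⟨s, hs, rfl⟩)⟩
  have hdom : ∀ n : ℕ, 2 ≤ n → ∀ g, (n : ℝ) * ‖R g * η ^ n‖ ≤
      8 * M ^ 2 * ((w g).length + 1 : ℝ) ^ 2 := by
    intro n hn g
    obtain ⟨b1, b2⟩ := h.taylorTwo_bound hM (hw g) hn
    have e : R g * η ^ n = ((δ (w g).prod - 1 - taylorOne (w g)) * η ^ n -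
        taylorTwo (w g) * η ^ n) * δ (r (q g)) := by
      rw [hR, mul_assoc, ← h.central.pow_comm, ← mul_assoc, ← sub_mul]
    have e2 : ‖R g * η ^ n‖ ≤ ‖(δ (w g).prod - 1 - taylorOne (w g)) * η ^ n‖ +
        ‖taylorTwo (w g) * η ^ n‖ := by
      rw [e]
      refine (norm_mul_le _ _).trans ?_
      rw [norm_δ, mul_one]
      exact norm_sub_le _ _
    have := mul_le_mul_of_nonneg_left e2 (Nat.cast_nonneg (α := ℝ) n)
    have : (l : ℝ) → 0 ≤ l → 8 * M ^ 2 * l ^ 2 ≤ 8 * M ^ 2 * (l + 1) ^ 2 := fun l hl => by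
      gcongr; linarith
    have := this (w g).length (Nat.cast_nonneg _)
    linarith
  -- Each remainder is `o(1/n)` by itself; the second moment supplies a summable bound uniform in
  -- `n`.
  have hconv := tendsto_tsum_of_dominated_convergence
    (bound := fun g => 8 * M ^ 2 * (|coeff ν g| * ((w g).length + 1 : ℝ) ^ 2))
    (hν.mul_left _) hlim (by
      filter_upwards [eventually_ge_atTop 2] with n hn g
      rw [Real.norm_of_nonneg (by positivity), mul_left_comm (8 * M ^ 2)]
      exact mul_le_mul_of_nonneg_left (hdom n hn g) (abs_nonneg _))
  rw [tsum_zero] at hconv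
  rw [mem_littleO]
  refine squeeze_zero' (Eventually.of_forall fun _ => by positivity) ?_ hconv
  filter_upwards [eventually_ge_atTop 2] with n hn
  rw [Real.sq_sqrt (Nat.cast_nonneg _)]
  have hs1 : Summable fun g => |coeff ν g| * ((n : ℝ) * ‖R g * η ^ n‖) := by
    refine Summable.of_nonneg_of_le (fun g => by positivity) (fun g => ?_)
      (hν.mul_left (8 * M ^ 2))
    rw [mul_left_comm (8 * M ^ 2)]
    exact mul_le_mul_of_nonneg_left (hdom n hn g) (abs_nonneg _)
  have hs2 := (hdiff.mul_right (η ^ n)).const_smul (n : ℝ)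
  have := tsum_of_norm_bounded (hs1.hasSum) (f := fun g => (n : ℝ) • (coeff ν g • R g * η ^ n))
    fun g => by
      rw [norm_smul, smul_mul_assoc, norm_smul, Real.norm_natCast, Real.norm_eq_abs, mul_left_comm]
  rw [hs2.tsum_eq, norm_smul, Real.norm_natCast] at this
  exact this

end L1

/-! ### Lazy steps and central smoothing elements -/

/-- Use `(n + 1) (X - 1) (1 + X) ^ n = 2 X P' - (n + 1) P` for `P = (1 + X) ^ (n + 1)`. The
coefficients are binomial weights times the centred variable, ready for a variance estimate. -/
theorem Polynomial.add_one_mul_one_add_X_pow_mul_X_sub_one (n : ℕ) :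
    ((n : ℝ) + 1) • ((Polynomial.X - 1) * (1 + Polynomial.X : Polynomial ℝ) ^ n) =
      ∑ j ∈ Finset.range (n + 2), ((2 * (j : ℝ) - (n + 1)) * ((n + 1).choose j : ℝ)) •
        (Polynomial.X : Polynomial ℝ) ^ j := by
  have h1 : (1 + Polynomial.X : Polynomial ℝ) ^ (n + 1) =
      ∑ j ∈ Finset.range (n + 2), ((n + 1).choose j : ℝ) • (Polynomial.X : Polynomial ℝ) ^ j := by
    rw [add_comm, add_pow]
    refine Finset.sum_congr rfl fun j _ => ?_
    rw [one_pow, mul_one, Polynomial.smul_eq_C_mul, map_natCast, mul_comm]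
  have h2 : ((n : ℝ) + 1) • (Polynomial.X * (1 + Polynomial.X : Polynomial ℝ) ^ n) =
      ∑ j ∈ Finset.range (n + 2), ((j : ℝ) * ((n + 1).choose j : ℝ)) •
        (Polynomial.X : Polynomial ℝ) ^ j := by
    have := congrArg (fun p : Polynomial ℝ => Polynomial.X * Polynomial.derivative p) h1
    simp only [Polynomial.derivative_pow, Polynomial.derivative_sum, Polynomial.derivative_smul,
      Finset.mul_sum] at this
    simp only [Nat.add_sub_cancel, map_add, Polynomial.derivative_one, Polynomial.derivative_X,
      zero_add, mul_one] at this
    rw [Polynomial.smul_eq_C_mul]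
    simp only [Nat.cast_add, Nat.cast_one, map_add, map_one] at this ⊢
    rw [mul_left_comm, this]
    refine Finset.sum_congr rfl fun j _ => ?_
    rcases j with _ | j
    · simp
    · simp only [Nat.add_sub_cancel, Polynomial.smul_eq_C_mul, map_mul]
      ring
  have h3 : ((n : ℝ) + 1) • ((Polynomial.X - 1) * (1 + Polynomial.X : Polynomial ℝ) ^ n) =
      (2 : ℝ) • (((n : ℝ) + 1) • (Polynomial.X * (1 + Polynomial.X : Polynomial ℝ) ^ n)) -
      ((n : ℝ) + 1) • (1 + Polynomial.X : Polynomial ℝ) ^ (n + 1) := by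
    simp only [Polynomial.smul_eq_C_mul, map_ofNat]
    ring
  rw [h3, h2, h1, Finset.smul_sum, Finset.smul_sum, ← Finset.sum_sub_distrib]
  refine Finset.sum_congr rfl fun j _ => ?_
  rw [smul_smul, smul_smul, ← sub_smul]
  congr 1
  ring

/-- This is the variance of the symmetric binomial law, read off from Bernstein polynomials at `1 /
2`. -/
theorem sum_sq_mul_choose (N : ℕ) :
    ∑ j ∈ Finset.range (N + 1), (2 * (j : ℝ) - N) ^ 2 * (N.choose j : ℝ) = (N : ℝ) * 2 ^ N := by
  have h := congrArg (Polynomial.eval (1 / 2 : ℝ)) (bernsteinPolynomial.variance ℝ N)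
  simp only [Polynomial.eval_finsetSum, bernsteinPolynomial, Polynomial.eval_mul,
    Polynomial.eval_pow, Polynomial.eval_sub, nsmul_eq_mul, Polynomial.eval_natCast,
    Polynomial.eval_X, Polynomial.eval_one] at h
  have e : ∀ j ∈ Finset.range (N + 1), (2 * (j : ℝ) - N) ^ 2 * (N.choose j : ℝ) =
      4 * 2 ^ N * (((N : ℝ) * (1 / 2) - j) ^ 2 *
        ((N.choose j : ℝ) * (1 / 2) ^ j * (1 - 1 / 2) ^ (N - j))) := by
    intro j hj
    have hj : j ≤ N := by simpa [Nat.lt_succ_iff] using hj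
    have h1 : (1 / 2 : ℝ) ^ j * (1 - 1 / 2) ^ (N - j) = (1 / 2) ^ N := by
      rw [show (1 - 1 / 2 : ℝ) = 1 / 2 by norm_num, ← pow_add, Nat.add_sub_cancel' hj]
    have h2 : (2 : ℝ) ^ N * (1 / 2) ^ N = 1 := by rw [← mul_pow]; norm_num
    rw [mul_assoc (N.choose j : ℝ), h1]
    linear_combination (-((2 * (j : ℝ) - N) ^ 2 * (N.choose j : ℝ))) * h2
  rw [Finset.sum_congr rfl e, ← Finset.mul_sum, h]
  ring

/-- Cauchy–Schwarz for the binomial weights bounds the first absolute moment by the variance. -/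
theorem sum_abs_mul_choose_le (N : ℕ) :
    ∑ j ∈ Finset.range (N + 1), |(2 * (j : ℝ) - N) * (N.choose j : ℝ)| ≤ √(N : ℝ) * 2 ^ N := by
  have h := Finset.sum_mul_sq_le_sq_mul_sq (Finset.range (N + 1))
    (fun j => |2 * (j : ℝ) - N| * √(N.choose j : ℝ)) (fun j => √(N.choose j : ℝ))
  simp only [mul_pow, sq_abs, Real.sq_sqrt (Nat.cast_nonneg _), sum_sq_mul_choose] at h
  have h2 : ∑ j ∈ Finset.range (N + 1), (N.choose j : ℝ) = 2 ^ N := by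
    exact_mod_cast Nat.sum_range_choose N
  rw [h2] at h
  have e : ∀ j : ℕ, |2 * (j : ℝ) - N| * √(N.choose j : ℝ) * √(N.choose j : ℝ) =
      |(2 * (j : ℝ) - N) * (N.choose j : ℝ)| := fun j => by
    rw [mul_assoc, Real.mul_self_sqrt (Nat.cast_nonneg _), abs_mul, Nat.abs_cast]
  simp only [e] at h
  refine abs_le_of_sq_le_sq' ?_ (by positivity) |>.2
  rw [mul_pow, Real.sq_sqrt (Nat.cast_nonneg _)]
  exact h.trans_eq (by ring)

namespace L1

open CentralContraction

variable {G F : Type*} [Group G] [Group F]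

/-- The lazy step `(1 + s) / 2`. -/
def lazy (s : G) : L1 G := (1 / 2 : ℝ) • (1 + δ s)

theorem norm_lazy_le (s : G) : ‖lazy s‖ ≤ 1 := by
  rw [lazy, norm_smul]
  have : ‖(1 + δ s : L1 G)‖ ≤ 2 := by
    refine (norm_add_le _ _).trans ?_
    rw [norm_one, norm_δ]; norm_num
  rw [Real.norm_of_nonneg (by norm_num)]
  linarith

/-- One difference of a binomial law costs a factor of order `n^(-1/2)`. This is the analytic source
of all decay rates in the argument. -/
theorem sqrt_mul_norm_lazy_pow_le (s : G) (n : ℕ) :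
    √(n : ℝ) * ‖(δ s - 1) * lazy s ^ n‖ ≤ 2 := by
  have h := congrArg (Polynomial.aeval (δ s : L1 G))
    (Polynomial.add_one_mul_one_add_X_pow_mul_X_sub_one n)
  simp only [map_smul, map_mul, map_sub, map_pow, map_add, map_one, map_sum,
    Polynomial.aeval_X] at h
  have h1 : ((n : ℝ) + 1) * ‖(δ s - 1) * (1 + δ s : L1 G) ^ n‖ ≤
      √((n + 1 : ℕ) : ℝ) * 2 ^ (n + 1) := by
    have e : ((n : ℝ) + 1) * ‖(δ s - 1) * (1 + δ s : L1 G) ^ n‖ =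
        ‖((n : ℝ) + 1) • ((δ s - 1) * (1 + δ s : L1 G) ^ n)‖ := by
      rw [norm_smul, Real.norm_of_nonneg (by positivity)]
    rw [e, h]
    refine le_trans ?_ (sum_abs_mul_choose_le (n + 1))
    refine norm_sum_le_of_le _ fun j _ => ?_
    rw [norm_smul, Real.norm_eq_abs]
    have : ‖(δ s : L1 G) ^ j‖ ≤ 1 :=
      (norm_pow_le _ j).trans (pow_le_one₀ (norm_nonneg _) (norm_δ s).le)
    push_cast
    exact mul_le_of_le_one_right (abs_nonneg _) this
  have h2 : ‖(δ s - 1) * lazy s ^ n‖ = (1 / 2) ^ n * ‖(δ s - 1) * (1 + δ s : L1 G) ^ n‖ := by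
    rw [lazy, smul_pow, mul_smul_comm, norm_smul, Real.norm_of_nonneg (by positivity)]
  have h3 : √((n + 1 : ℕ) : ℝ) * √((n + 1 : ℕ) : ℝ) = (n : ℝ) + 1 := by
    rw [Real.mul_self_sqrt (by positivity)]; push_cast; ring
  have hpos : 0 < √((n + 1 : ℕ) : ℝ) := Real.sqrt_pos.2 (by positivity)
  rw [← h3, mul_assoc] at h1
  have h4 := le_of_mul_le_mul_left h1 hpos
  have h5 : √(n : ℝ) ≤ √((n + 1 : ℕ) : ℝ) := Real.sqrt_le_sqrt (by push_cast; linarith)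
  calc √(n : ℝ) * ‖(δ s - 1) * lazy s ^ n‖
      ≤ (1 / 2) ^ n * (√((n + 1 : ℕ) : ℝ) * ‖(δ s - 1) * (1 + δ s : L1 G) ^ n‖) := by
        rw [h2, mul_left_comm]
        gcongr
    _ ≤ (1 / 2) ^ n * 2 ^ (n + 1) := by gcongr
    _ = 2 := by rw [pow_succ, ← mul_assoc, ← mul_pow]; norm_num

theorem norm_le_one_of_mem_closure {S : Set G} {x : L1 G}
    (hx : x ∈ Submonoid.closure (lazy '' S)) : ‖x‖ ≤ 1 := by
  induction hx using Submonoid.closure_induction with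
  | mem x h => obtain ⟨s, -, rfl⟩ := h; exact norm_lazy_le s
  | one => exact norm_one.le
  | mul x y _ _ hx hy => exact (norm_mul_le _ _).trans (mul_le_one₀ hx (norm_nonneg _) hy)

theorem commute_of_forall_δ {y : L1 G} (h : ∀ g, δ g * y = y * δ g) (x : L1 G) :
    x * y = y * x := by
  have : (mulCLM (G := G)).flip y = mulCLM y := ext_clm fun g => h g
  exact DFunLike.congr_fun this x

/-- A finite set of commuting elements that is invariant under conjugation has a central smoothing
element. -/
theorem exists_smoothing {S : Finset G} (hcomm : ∀ s ∈ S, ∀ t ∈ S, s * t = t * s)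
    (hconj : ∀ g, ∀ s ∈ S, g * s * g⁻¹ ∈ S) :
    ∃ η ∈ Submonoid.closure (lazy '' (S : Set G)), CentralContraction η ∧
      ∀ s ∈ S, δ s - 1 ∈ bigO η := by
  classical
  have hcl : ∀ s ∈ S, ∀ t ∈ S, Commute (lazy s) (lazy t) := by
    intro s hs t ht
    refine Commute.smul_right (Commute.smul_left ?_ _) _
    have : Commute (δ s : L1 G) (δ t) := by
      show δ s * δ t = δ t * δ s
      rw [δ_mul_δ, δ_mul_δ, hcomm s hs t ht]
    exact (Commute.one_left _).add_left ((Commute.one_right _).add_right this)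
  have hpw : (S : Set G).Pairwise (Function.onFun Commute (lazy (G := G))) :=
    fun s hs t ht _ => hcl s hs t ht
  have hmem : ∀ T ⊆ S, ∀ hT : (T : Set G).Pairwise (Function.onFun Commute (lazy (G := G))),
      T.noncommProd lazy hT ∈ Submonoid.closure (lazy '' (S : Set G)) := fun T hTS hT =>
    Submonoid.noncommProd_mem _ _ _ _ fun s hs => Submonoid.subset_closure ⟨s, hTS hs, rfl⟩
  set η := S.noncommProd lazy hpw with hη
  have hηc := hmem S subset_rfl hpw
  have hcentral : CentralContraction η := by
    refine ⟨fun x => (commute_of_forall_δ (fun g => ?_) x).symm, norm_le_one_of_mem_closure hηc⟩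
    -- Conjugation by `δ g` is multiplicative and permutes the commuting lazy factors, hence fixes
    -- their product.
    let c : L1 G →* L1 G :=
      { toFun := fun x => δ g * x * δ g⁻¹
        map_one' := by rw [mul_one, δ_mul_δ, mul_inv_cancel, δ_one]
        map_mul' := fun x y => by
          have : (δ g⁻¹ * δ g : L1 G) = 1 := by rw [δ_mul_δ, inv_mul_cancel, δ_one]
          calc δ g * (x * y) * δ g⁻¹ = δ g * x * 1 * y * δ g⁻¹ := by noncomm_ring
            _ = _ := by rw [← this]; noncomm_ring }
    have hcη : c η = η := by
      have hmul : ∀ (s t : Multiset (L1 G)) (_ : s = t) (hs) (ht),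
          s.noncommProd hs = t.noncommProd ht := by
        intro s t hst hs ht; subst hst; rfl
      rw [hη, Finset.map_noncommProd]
      refine hmul _ _ ?_ _ _
      let e : G ↪ G := (MulAut.conj g).toEquiv.toEmbedding
      have hS : S.map e = S := by
        refine Finset.eq_of_subset_of_card_le ?_ (Finset.card_map e).ge
        intro x hx
        obtain ⟨s, hs, rfl⟩ := Finset.mem_map.1 hx
        exact hconj g s hs
      conv_rhs => rw [← hS]
      rw [Finset.map_val, Multiset.map_map]
      refine Multiset.map_congr rfl fun s _ => ?_
      show δ g * lazy s * δ g⁻¹ = lazy (g * s * g⁻¹)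
      rw [lazy, lazy, mul_smul_comm, smul_mul_assoc, mul_add, add_mul, mul_one, δ_mul_δ, δ_mul_δ,
        δ_mul_δ, mul_inv_cancel, δ_one]
    calc δ g * η = δ g * η * (δ g⁻¹ * δ g) := by rw [δ_mul_δ, inv_mul_cancel, δ_one, mul_one]
      _ = c η * δ g := by rw [← mul_assoc]; rfl
      _ = η * δ g := by rw [hcη]
  refine ⟨η, hηc, hcentral, fun s hs => ?_⟩
  -- The factor `lazy s` alone gives the decay for `δ s - 1`; the other factors have norm at most
  -- one.
  have hpw' : ((S.erase s : Finset G) : Set G).Pairwise (Function.onFun Commute (lazy (G := G))) :=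
    hpw.mono (Finset.coe_subset.2 (Finset.erase_subset s S))
  have hsplit : lazy s * (S.erase s).noncommProd lazy hpw' = η :=
    Finset.mul_noncommProd_erase S hs lazy hpw hpw'
  have hc : Commute (lazy s) ((S.erase s).noncommProd lazy hpw') :=
    Finset.noncommProd_commute _ _ _ _ fun t ht => hcl s hs t (Finset.mem_of_mem_erase ht)
  refine ⟨2, fun n => le_trans ?_ (sqrt_mul_norm_lazy_pow_le s n)⟩
  gcongr
  rw [← hsplit, hc.mul_pow, ← mul_assoc]
  refine (norm_mul_le _ _).trans (mul_le_of_le_one_right (norm_nonneg _) ?_)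
  exact norm_le_one_of_mem_closure (S := (S : Set G))
    (pow_mem (hmem _ (Finset.erase_subset s S) hpw') n)

/-- The product of two central contractions. -/
theorem _root_.CentralContraction.mul {η η' : L1 G} (h : CentralContraction η)
    (h' : CentralContraction η') : CentralContraction (η * η') where
  comm x := by rw [mul_assoc, h'.comm, ← mul_assoc, h.comm, mul_assoc]
  norm_le := (norm_mul_le _ _).trans (mul_le_one₀ h.norm_le (norm_nonneg _) h'.norm_le)

theorem norm_mul_mul_pow_le_left {η η' : L1 G} (h : CentralContraction η)
    (h' : CentralContraction η') (x : L1 G) (n : ℕ) : ‖x * (η * η') ^ n‖ ≤ ‖x * η ^ n‖ := by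
  rw [(show Commute η η' from h.comm η').mul_pow, ← mul_assoc]
  exact (norm_mul_le _ _).trans (mul_le_of_le_one_right (norm_nonneg _) (h'.norm_pow_le' n))

theorem bigO_mul_right_le {η η' : L1 G} (h : CentralContraction η) (h' : CentralContraction η') :
    bigO η ≤ bigO (η * η') := by
  rintro x ⟨C, hC⟩
  refine ⟨C, fun n => le_trans ?_ (hC n)⟩
  gcongr
  exact norm_mul_mul_pow_le_left h h' x n

theorem map_eq_self_of_mem_closure {φ : G →* G} {S : Set G} (hφ : ∀ s ∈ S, φ s = s) {x : L1 G}
    (hx : x ∈ Submonoid.closure (lazy '' S)) : map φ x = x := by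
  induction hx using Submonoid.closure_induction with
  | mem x h => obtain ⟨s, hs, rfl⟩ := h; simp [lazy, hφ s hs]
  | one => exact map_one _
  | mul x y _ _ hx hy => rw [map_mul, hx, hy]

theorem map_eq_one_of_mem_closure {φ : G →* F} {S : Set G} (hφ : ∀ s ∈ S, φ s = 1) {x : L1 G}
    (hx : x ∈ Submonoid.closure (lazy '' S)) : map φ x = 1 := by
  induction hx using Submonoid.closure_induction with
  | mem x h =>
    obtain ⟨s, hs, rfl⟩ := h
    simp only [lazy, map_smul, map_add, map_one, map_δ, hφ s hs, δ_one]
    rw [← two_smul ℝ (1 : L1 F), smul_smul]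
    norm_num
  | one => exact map_one _
  | mul x y _ _ hx hy => rw [map_mul, hx, hy, mul_one]

end L1

/-! ### Taylor expansion of elements of the kernel of the finite quotient -/

namespace L1

open CentralContraction

section Kernel

variable {G F : Type*} [Group G] [Group F]

theorem hasSum_map (φ : G →* F) (x : L1 G) :
    HasSum (fun g => coeff x g • δ (φ g)) (map φ x) := by
  have := (hasSum_coeff x).mapL (lift (δHom.comp φ) fun _ => (norm_δ _).le)
  refine (this.congr_fun fun g => ?_)
  rw [map_smul]
  exact congrArg (coeff x g • ·) (lift_δ (δHom.comp φ) _ g).symm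

/-- The span of the first differences `δ s - 1`, for `s` in a set. -/
def differences (S : Set G) : Submodule ℝ (L1 G) := Submodule.span ℝ ((fun s => δ s - 1) '' S)

theorem taylorOne_mem_differences {S : Set G} {l : List G} (hl : ∀ s ∈ l, s ∈ S) :
    taylorOne l ∈ differences S := by
  refine list_sum_mem fun x hx => ?_
  obtain ⟨s, hs, rfl⟩ := List.mem_map.1 hx
  exact Submodule.subset_span ⟨s, hl s hs, rfl⟩

theorem taylorTwo_mem_differences {S : Set G} {l : List G} (hl : ∀ s ∈ l, s ∈ S) :
    taylorTwo l ∈ differences S * differences S := by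
  induction l with
  | nil => exact zero_mem _
  | cons s l ih =>
    have hl' : ∀ t ∈ l, t ∈ S := fun t ht => hl t (List.mem_cons_of_mem _ ht)
    exact add_mem (ih hl') (Submodule.mul_mem_mul
      (Submodule.subset_span ⟨s, hl s List.mem_cons_self, rfl⟩) (taylorOne_mem_differences hl'))

namespace Frame

variable {q : G →* F} {r : F → G} {S : Finset G} {η : L1 G} (h : Frame q r S η)
include h

theorem differences_le_bigO : differences (S : Set G) ≤ bigO η := by
  rw [differences, Submodule.span_le]
  rintro _ ⟨s, hs, rfl⟩
  exact h.letter_bigO s hs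

theorem differences_mul_le : differences (S : Set G) * differences (S : Set G) ≤ littleO η 1 :=
  Submodule.mul_le.2 fun _ hx _ hy =>
    bigO_mul_bigO h.central (h.differences_le_bigO hx) (h.differences_le_bigO hy)

/-- To check that a submodule contains all approximable elements of the kernel of `q`, look at the
elements `(δ a - 1) * δ t`. -/
theorem mem_of_map_eq_zero (E : Submodule ℝ (L1 G)) (hE : littleO η 2 ≤ E)
    (hw : ∀ l : List G, (∀ s ∈ l, s ∈ S) → ∀ g, (δ l.prod - 1) * δ g ∈ E)
    {k : L1 G} (hk : k ∈ approximable h.central) (h0 : map q k = 0) : k ∈ E := by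
  obtain ⟨y, hy, hky⟩ := hk
  have h1 : y - liftSection r (map q y) ∈ E := by
    clear hky
    induction hy using Submodule.span_induction with
    | mem x hx =>
      obtain ⟨g, rfl⟩ := hx
      obtain ⟨l, hl, hg⟩ := h.exists_word g
      rw [map_δ, liftSection, lift_δ]
      have : (δ g - δ (r (q g)) : L1 G) = (δ l.prod - 1) * δ (r (q g)) := by
        rw [sub_mul, δ_mul_δ, ← hg, one_mul]
      rw [this]
      exact hw l hl _
    | zero => simp
    | add x y _ _ hx hy =>
      rw [map_add, map_add, add_sub_add_comm]
      exact add_mem hx hy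
    | smul c x _ hx =>
      rw [map_smul, map_smul, ← smul_sub]
      exact Submodule.smul_mem _ _ hx
  have h2 : map q y = 0 := by
    have := map_eq_zero_of_littleO h.map_eq_one (littleO_succ_le 0 (littleO_succ_le 1 hky))
    rwa [map_sub, h0, zero_sub, neg_eq_zero] at this
  rw [h2, map_zero, sub_zero] at h1
  rw [← sub_add_cancel k y]
  exact add_mem (hE hky) h1

variable [Fintype F] {u : L1 G} (hu : u ∈ finSupp G) (hqu : map q u = uniform F)
include hu hqu

theorem δ_mul_sub_mem_bigO (g : G) : δ g * u - u ∈ bigO η := by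
  refine h.mem_bigO_of_map_eq_zero (finSupp_le_approximable _
    (sub_mem (mul_mem_finSupp (δ_mem_finSupp g) hu) hu)) ?_
  rw [map_sub, map_mul, map_δ, hqu, δ_mul_uniform, sub_self]

theorem sub_mul_self_mem_bigO : u - u * u ∈ bigO η := by
  refine h.mem_bigO_of_map_eq_zero (finSupp_le_approximable _
    (sub_mem hu (mul_mem_finSupp hu hu))) ?_
  rw [map_sub, map_mul, hqu, uniform_mul_self, sub_self]

/-- Right multiplication by `u` absorbs the coset representative: `δ g * u - u` lies in `bigO η`, so
in front of `u` the element `(δ l.prod - 1) * δ g` agrees with `taylorOne l` up to order one. -/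
theorem exists_firstOrder {k : L1 G} (hk : k ∈ approximable h.central) (h0 : map q k = 0) :
    ∃ y ∈ differences (S : Set G), (k - y) * u ∈ littleO η 1 := by
  have key : k ∈ differences (S : Set G) ⊔ (littleO η 1).comap (LinearMap.mulRight ℝ u) := by
    refine h.mem_of_map_eq_zero _ ?_ ?_ hk h0
    · refine le_trans (fun x hx => ?_) le_sup_right
      exact littleO_mul_right h.central (littleO_succ_le 1 hx) u
    · intro l hl g
      refine Submodule.mem_sup.2 ⟨taylorOne l, taylorOne_mem_differences hl,
        (δ l.prod - 1) * δ g - taylorOne l, ?_, by abel⟩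
      rw [Submodule.mem_comap, LinearMap.mulRight_apply]
      have e : ((δ l.prod - 1) * δ g - taylorOne l) * u =
          (δ l.prod - 1) * (δ g * u - u) + (δ l.prod - 1 - taylorOne l) * u := by noncomm_ring
      rw [e]
      exact add_mem
        (bigO_mul_bigO h.central (h.δ_prod_sub_one_mem hl) (h.δ_mul_sub_mem_bigO hu hqu g))
        (littleO_mul_right h.central (h.δ_prod_sub_taylorOne_mem hl) u)
  obtain ⟨y, hy, z, hz, rfl⟩ := Submodule.mem_sup.1 key
  exact ⟨y, hy, by rwa [add_sub_cancel_left]⟩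

/-- To second order the absorption of `δ g` is no longer free. Its error `δ g * u - u` is itself in
the kernel, and its first-order part `y` contributes `taylorOne l * y`; this expansion uses up a
second factor `u`. -/
theorem exists_secondOrder {k : L1 G} (hk : k ∈ approximable h.central) (h0 : map q k = 0) :
    ∃ y ∈ differences (S : Set G) ⊔ differences (S : Set G) * differences (S : Set G),
      (k - y) * (u * u) ∈ littleO η 2 := by
  have key : k ∈ (differences (S : Set G) ⊔ differences (S : Set G) * differences (S : Set G)) ⊔
      (littleO η 2).comap (LinearMap.mulRight ℝ (u * u)) := by
    refine h.mem_of_map_eq_zero _ ?_ ?_ hk h0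
    · refine le_trans (fun x hx => ?_) le_sup_right
      exact littleO_mul_right h.central hx _
    · intro l hl g
      obtain ⟨y, hy, hy'⟩ := h.exists_firstOrder hu hqu (k := δ g * u - u)
        (finSupp_le_approximable _ (sub_mem (mul_mem_finSupp (δ_mem_finSupp g) hu) hu))
        (by rw [map_sub, map_mul, map_δ, hqu, δ_mul_uniform, sub_self])
      have m1 : taylorOne l ∈ differences (S : Set G) := taylorOne_mem_differences hl
      have m2 : taylorTwo l ∈ differences (S : Set G) * differences (S : Set G) :=
        taylorTwo_mem_differences hl
      refine Submodule.mem_sup.2 ⟨taylorOne l + (taylorTwo l + taylorOne l * y),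
        Submodule.add_mem_sup m1 (add_mem m2 (Submodule.mul_mem_mul m1 hy)),
        (δ l.prod - 1) * δ g - (taylorOne l + (taylorTwo l + taylorOne l * y)), ?_, by abel⟩
      rw [Submodule.mem_comap, LinearMap.mulRight_apply]
      have e : ((δ l.prod - 1) * δ g - (taylorOne l + (taylorTwo l + taylorOne l * y))) * (u * u) =
          (δ l.prod - 1 - taylorOne l - taylorTwo l) * (δ g * (u * u)) +
          taylorTwo l * (δ g * u - u) * u +
          taylorOne l * ((δ g * u - u - y) * u) +
          taylorOne l * (y * (u - u * u)) := by noncomm_ring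
      have b1 := h.differences_le_bigO m1
      rw [e]
      refine add_mem (add_mem (add_mem ?_ ?_) ?_) ?_
      · exact littleO_mul_right h.central (h.δ_prod_sub_taylorTwo_mem hl) _
      · exact littleO_mul_right h.central (littleO_mul_bigO h.central (h.differences_mul_le m2)
          (h.δ_mul_sub_mem_bigO hu hqu g)) _
      · exact bigO_mul_littleO h.central b1 hy'
      · exact bigO_mul_littleO h.central b1 (bigO_mul_bigO h.central (h.differences_le_bigO hy)
          (h.sub_mul_self_mem_bigO hu hqu))
  obtain ⟨y, hy, z, hz, rfl⟩ := Submodule.mem_sup.1 key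
  exact ⟨y, hy, by rwa [add_sub_cancel_left]⟩

end Frame

/-- For `η = η₁ * η₂` and `φ` a projection to one factor, `map φ` turns `x * η ^ n` into `map φ x`
times a power of the surviving factor. Restoring the lost factor does not increase the norm, so
orders pass to marginals. -/
theorem map_mem_littleO {η η' : L1 G} {φ : G →* G} (hφ : map φ η = η')
    (hle : ∀ (y : L1 G) (n : ℕ), ‖y * η ^ n‖ ≤ ‖y * η' ^ n‖) {i : ℕ} {x : L1 G}
    (hx : x ∈ littleO η i) : map φ x ∈ littleO η i := by
  refine squeeze_zero (fun n => by positivity) (fun n => ?_) hx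
  gcongr
  refine (hle _ n).trans ?_
  rw [← hφ, ← map_pow, ← map_mul]
  exact norm_map_le φ _

end Kernel

/-! ### Product groups: marginals and mixed second differences -/

section Product

variable {Γ₁ Γ₂ F : Type*} [Group Γ₁] [Group Γ₂] [Group F]

/-- The projection of `Γ₁ × Γ₂` to its first factor, as an endomorphism. -/
def projFst (Γ₁ Γ₂ : Type*) [Group Γ₁] [Group Γ₂] : Γ₁ × Γ₂ →* Γ₁ × Γ₂ :=
  (MonoidHom.inl Γ₁ Γ₂).comp (MonoidHom.fst Γ₁ Γ₂)

/-- The projection of `Γ₁ × Γ₂` to its second factor, as an endomorphism. -/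
def projSnd (Γ₁ Γ₂ : Type*) [Group Γ₁] [Group Γ₂] : Γ₁ × Γ₂ →* Γ₁ × Γ₂ :=
  (MonoidHom.inr Γ₁ Γ₂).comp (MonoidHom.snd Γ₁ Γ₂)

@[simp] theorem projFst_apply (g : Γ₁ × Γ₂) : projFst Γ₁ Γ₂ g = (g.1, 1) := rfl

@[simp] theorem projSnd_apply (g : Γ₁ × Γ₂) : projSnd Γ₁ Γ₂ g = (1, g.2) := rfl

theorem commute_map_proj (a b : L1 (Γ₁ × Γ₂)) :
    Commute (map (projFst Γ₁ Γ₂) a) (map (projSnd Γ₁ Γ₂) b) := by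
  have hδ : ∀ g k : Γ₁ × Γ₂, (δ (projFst Γ₁ Γ₂ g) * δ (projSnd Γ₁ Γ₂ k) : L1 (Γ₁ × Γ₂)) =
      δ (projSnd Γ₁ Γ₂ k) * δ (projFst Γ₁ Γ₂ g) := fun g k => by simp
  have h1 := hasSum_map (projFst Γ₁ Γ₂) a
  have h2 := hasSum_map (projSnd Γ₁ Γ₂) b
  have h3 : ∀ g, Commute (δ (projFst Γ₁ Γ₂ g)) (map (projSnd Γ₁ Γ₂) b) := by
    intro g
    refine (h2.mul_left (δ (projFst Γ₁ Γ₂ g))).unique ?_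
    refine (h2.mul_right (δ (projFst Γ₁ Γ₂ g))).congr_fun ?_
    intro k
    rw [mul_smul_comm, smul_mul_assoc, hδ]
  refine (h1.mul_right _).unique ?_
  refine (h1.mul_left _).congr_fun ?_
  intro g
  rw [mul_smul_comm, smul_mul_assoc, (h3 g).eq]

theorem map_mixed {S : Finset (Γ₁ × Γ₂)} {m : L1 (Γ₁ × Γ₂)}
    (hm : m ∈ differences {s | s ∈ S ∧ s.2 = 1} * differences {s | s ∈ S ∧ s.1 = 1}) :
    map (projFst Γ₁ Γ₂) m = 0 ∧ map (projSnd Γ₁ Γ₂) m = 0 := by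
  have hle : differences {s | s ∈ S ∧ s.2 = 1} * differences {s | s ∈ S ∧ s.1 = 1} ≤
      LinearMap.ker (map (projFst Γ₁ Γ₂)).toLinearMap ⊓
        LinearMap.ker (map (projSnd Γ₁ Γ₂)).toLinearMap := by
    rw [differences, differences, Submodule.span_mul_span, Submodule.span_le]
    rintro _ ⟨_, ⟨⟨a, b⟩, ⟨-, hb⟩, rfl⟩, _, ⟨⟨c, d⟩, ⟨-, hc⟩, rfl⟩, rfl⟩
    obtain rfl : b = 1 := hb
    obtain rfl : c = 1 := hc
    constructor
    · change map (projFst Γ₁ Γ₂) ((δ (a, 1) - 1) * (δ (1, d) - 1)) = 0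
      rw [map_mul, map_sub _ (δ (1, d)), map_δ, map_one, projFst_apply, ← Prod.one_eq_mk, δ_one,
        sub_self, mul_zero]
    · change map (projSnd Γ₁ Γ₂) ((δ (a, 1) - 1) * (δ (1, d) - 1)) = 0
      rw [map_mul, map_sub _ (δ (a, 1)), map_δ, map_one, projSnd_apply, ← Prod.one_eq_mk, δ_one,
        sub_self, zero_mul]
  exact hle hm

/-- A frame for a product whose data respect the two factors, with an approximately invariant
finitely supported `U₁ * U₂` that kills the mixed second differences. -/
structure ProductFrame [Fintype F] (q : Γ₁ × Γ₂ →* F) (r : F → Γ₁ × Γ₂) (S : Finset (Γ₁ × Γ₂))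
    (η₁ η₂ U₁ U₂ : L1 (Γ₁ × Γ₂)) : Prop where
  frame : Frame q r S (η₁ * η₂)
  central₁ : CentralContraction η₁
  central₂ : CentralContraction η₂
  letter : ∀ s ∈ S, s.1 = 1 ∨ s.2 = 1
  fst_η₁ : map (projFst Γ₁ Γ₂) η₁ = η₁
  fst_η₂ : map (projFst Γ₁ Γ₂) η₂ = 1
  snd_η₁ : map (projSnd Γ₁ Γ₂) η₁ = 1
  snd_η₂ : map (projSnd Γ₁ Γ₂) η₂ = η₂
  fst_U₁ : map (projFst Γ₁ Γ₂) U₁ = U₁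
  fst_U₂ : map (projFst Γ₁ Γ₂) U₂ = 1
  snd_U₁ : map (projSnd Γ₁ Γ₂) U₁ = 1
  snd_U₂ : map (projSnd Γ₁ Γ₂) U₂ = U₂
  U₁_mem : U₁ ∈ finSupp (Γ₁ × Γ₂)
  U₂_mem : U₂ ∈ finSupp (Γ₁ × Γ₂)
  map_U : map q (U₁ * U₂) = uniform F
  mixed : ∀ s ∈ S, s.2 = 1 → ∀ t ∈ S, t.1 = 1 →
    U₁ * ((δ s - 1) * (δ t - 1)) * (U₁ * U₂ * (U₁ * U₂)) ∈ littleO (η₁ * η₂) 2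

namespace ProductFrame

variable [Fintype F] {q : Γ₁ × Γ₂ →* F} {r : F → Γ₁ × Γ₂} {S : Finset (Γ₁ × Γ₂)}
  {η₁ η₂ U₁ U₂ : L1 (Γ₁ × Γ₂)} (h : ProductFrame q r S η₁ η₂ U₁ U₂)
include h

theorem U_mem : U₁ * U₂ ∈ finSupp (Γ₁ × Γ₂) := mul_mem_finSupp h.U₁_mem h.U₂_mem

theorem commute_U : Commute U₁ U₂ := by
  rw [← h.fst_U₁, ← h.snd_U₂]
  exact commute_map_proj _ _

theorem mass_U₁ : mass U₁ = 1 := by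
  rw [← mass_map (projSnd Γ₁ Γ₂), h.snd_U₁, map_one]

theorem fst_mem_littleO {i : ℕ} {x : L1 (Γ₁ × Γ₂)} (hx : x ∈ littleO (η₁ * η₂) i) :
    map (projFst Γ₁ Γ₂) x ∈ littleO (η₁ * η₂) i :=
  map_mem_littleO (η' := η₁) (by rw [map_mul, h.fst_η₁, h.fst_η₂, mul_one])
    (norm_mul_mul_pow_le_left h.central₁ h.central₂) hx

theorem snd_mem_littleO {i : ℕ} {x : L1 (Γ₁ × Γ₂)} (hx : x ∈ littleO (η₁ * η₂) i) :
    map (projSnd Γ₁ Γ₂) x ∈ littleO (η₁ * η₂) i :=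
  map_mem_littleO (η' := η₂) (by rw [map_mul, h.snd_η₁, h.snd_η₂, one_mul])
    (fun y n => by
      rw [h.central₁.comm]
      exact norm_mul_mul_pow_le_left h.central₂ h.central₁ y n) hx

/-- Second-order polynomials in the differences split into a part from the first factor, a part
from the second factor and a mixed part. -/
theorem exists_split {y : L1 (Γ₁ × Γ₂)}
    (hy : y ∈ differences (S : Set (Γ₁ × Γ₂)) ⊔
      differences (S : Set (Γ₁ × Γ₂)) * differences (S : Set (Γ₁ × Γ₂))) :
    ∃ y₁ y₂, ∃ m ∈ differences {s | s ∈ S ∧ s.2 = 1} * differences {s | s ∈ S ∧ s.1 = 1},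
      y = y₁ + y₂ + m ∧ map (projFst Γ₁ Γ₂) y₁ = y₁ ∧ map (projSnd Γ₁ Γ₂) y₁ = 0 ∧
        map (projFst Γ₁ Γ₂) y₂ = 0 ∧ map (projSnd Γ₁ Γ₂) y₂ = y₂ := by
  set Y₁ : Submodule ℝ (L1 (Γ₁ × Γ₂)) := differences {s | s ∈ S ∧ s.2 = 1} with hY₁
  set Y₂ : Submodule ℝ (L1 (Γ₁ × Γ₂)) := differences {s | s ∈ S ∧ s.1 = 1} with hY₂
  let φ₁ := (map (projFst Γ₁ Γ₂)).toLinearMap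
  let φ₂ := (map (projSnd Γ₁ Γ₂)).toLinearMap
  set V₁ : Submodule ℝ (L1 (Γ₁ × Γ₂)) := LinearMap.eqLocus φ₁ LinearMap.id ⊓ LinearMap.ker φ₂
  set V₂ : Submodule ℝ (L1 (Γ₁ × Γ₂)) := LinearMap.ker φ₁ ⊓ LinearMap.eqLocus φ₂ LinearMap.id
  have mem₁ : ∀ y, y ∈ V₁ ↔ map (projFst Γ₁ Γ₂) y = y ∧ map (projSnd Γ₁ Γ₂) y = 0 :=
    fun y => Iff.rfl
  have mem₂ : ∀ y, y ∈ V₂ ↔ map (projFst Γ₁ Γ₂) y = 0 ∧ map (projSnd Γ₁ Γ₂) y = y :=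
    fun y => Iff.rfl
  have hYV₁ : Y₁ ≤ V₁ := by
    rw [hY₁, differences, Submodule.span_le]
    rintro _ ⟨⟨a, b⟩, ⟨-, hb⟩, rfl⟩
    obtain rfl : b = 1 := hb
    refine (mem₁ _).2 ⟨by simp, ?_⟩
    rw [map_sub, map_δ, map_one, projSnd_apply, ← Prod.one_eq_mk, δ_one, sub_self]
  have hYV₂ : Y₂ ≤ V₂ := by
    rw [hY₂, differences, Submodule.span_le]
    rintro _ ⟨⟨a, b⟩, ⟨-, ha⟩, rfl⟩
    obtain rfl : a = 1 := ha
    refine (mem₂ _).2 ⟨?_, by simp⟩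
    rw [map_sub, map_δ, map_one, projFst_apply, ← Prod.one_eq_mk, δ_one, sub_self]
  have hV₁ : V₁ * V₁ ≤ V₁ := Submodule.mul_le.2 fun a ha b hb => by
    rw [mem₁] at *
    rw [map_mul, map_mul, ha.1, hb.1, ha.2, zero_mul]
    exact ⟨rfl, rfl⟩
  have hV₂ : V₂ * V₂ ≤ V₂ := Submodule.mul_le.2 fun a ha b hb => by
    rw [mem₂] at *
    rw [map_mul, map_mul, ha.1, hb.2, ha.2, zero_mul]
    exact ⟨rfl, rfl⟩
  have hY : differences (S : Set (Γ₁ × Γ₂)) ≤ Y₁ ⊔ Y₂ := by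
    rw [differences, Submodule.span_le]
    rintro _ ⟨s, hs, rfl⟩
    rcases h.letter s hs with h1 | h1
    · exact Submodule.mem_sup_right (Submodule.subset_span ⟨s, ⟨hs, h1⟩, rfl⟩)
    · exact Submodule.mem_sup_left (Submodule.subset_span ⟨s, ⟨hs, h1⟩, rfl⟩)
  -- Differences from distinct factors commute, so both mixed products can be put in the same order.
  have hcomm : Y₂ * Y₁ ≤ Y₁ * Y₂ := Submodule.mul_le.2 fun b hb a ha => by
    have e : b * a = a * b := by
      rw [← ((mem₁ a).1 (hYV₁ ha)).1, ← ((mem₂ b).1 (hYV₂ hb)).2]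
      exact (commute_map_proj a b).symm.eq
    rw [e]
    exact Submodule.mul_mem_mul ha hb
  have hle : differences (S : Set (Γ₁ × Γ₂)) ⊔
      differences (S : Set (Γ₁ × Γ₂)) * differences (S : Set (Γ₁ × Γ₂)) ≤ V₁ ⊔ V₂ ⊔ Y₁ * Y₂ := by
    refine sup_le ?_ ((mul_le_mul' hY hY).trans ?_)
    · exact (hY.trans (sup_le_sup hYV₁ hYV₂)).trans le_sup_left
    · rw [Submodule.mul_sup, Submodule.sup_mul, Submodule.sup_mul]
      refine sup_le (sup_le ?_ ?_) (sup_le ?_ ?_)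
      · exact ((mul_le_mul' hYV₁ hYV₁).trans hV₁).trans (le_sup_left.trans le_sup_left)
      · exact hcomm.trans le_sup_right
      · exact le_sup_right
      · exact ((mul_le_mul' hYV₂ hYV₂).trans hV₂).trans (le_sup_right.trans le_sup_left)
  obtain ⟨z, hz, m, hm, rfl⟩ := Submodule.mem_sup.1 (hle hy)
  obtain ⟨y₁, h1, y₂, h2, rfl⟩ := Submodule.mem_sup.1 hz
  exact ⟨y₁, y₂, m, hm, rfl, ((mem₁ _).1 h1).1, ((mem₁ _).1 h1).2, ((mem₂ _).1 h2).1,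
    ((mem₂ _).1 h2).2⟩

/-- If both marginals of `x` vanish, then `x` agrees with a mixed second-order term. -/
theorem mixed_of_marginals {x y w₁ w₂ : L1 (Γ₁ × Γ₂)} {i : ℕ}
    (hx₁ : map (projFst Γ₁ Γ₂) x = 0) (hx₂ : map (projSnd Γ₁ Γ₂) x = 0)
    (hy : y ∈ differences (S : Set (Γ₁ × Γ₂)) ⊔
      differences (S : Set (Γ₁ × Γ₂)) * differences (S : Set (Γ₁ × Γ₂)))
    (hw₁ : map (projFst Γ₁ Γ₂) w₁ = w₁) (hw₁' : map (projSnd Γ₁ Γ₂) w₁ = 1)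
    (hw₂ : map (projFst Γ₁ Γ₂) w₂ = 1) (hw₂' : map (projSnd Γ₁ Γ₂) w₂ = w₂)
    (hxy : x - y * (w₁ * w₂) ∈ littleO (η₁ * η₂) i) :
    ∃ m ∈ differences {s | s ∈ S ∧ s.2 = 1} * differences {s | s ∈ S ∧ s.1 = 1},
      x - m * (w₁ * w₂) ∈ littleO (η₁ * η₂) i := by
  obtain ⟨y₁, y₂, m, hm, rfl, h1, h1', h2, h2'⟩ := h.exists_split hy
  have hc : w₁ * w₂ = w₂ * w₁ := by
    rw [← hw₁, ← hw₂']
    exact (commute_map_proj _ _).eq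
  obtain ⟨hm1, hm2⟩ := map_mixed hm
  -- Each projection kills the mixed part and one pure part, and shows that the other pure part is
  -- negligible.
  have e1 := h.fst_mem_littleO hxy
  rw [map_sub, hx₁, map_mul, map_mul, map_add, map_add, h1, h2, hm1, hw₁, hw₂, add_zero, add_zero,
    mul_one, zero_sub, neg_mem_iff] at e1
  have e2 := h.snd_mem_littleO hxy
  rw [map_sub, hx₂, map_mul, map_mul, map_add, map_add, h1', h2', hm2, hw₁', hw₂', zero_add,
    add_zero, one_mul, zero_sub, neg_mem_iff] at e2
  refine ⟨m, hm, ?_⟩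
  have e : x - m * (w₁ * w₂) = (x - (y₁ + y₂ + m) * (w₁ * w₂)) + y₁ * w₁ * w₂ + y₂ * w₂ * w₁ := by
    rw [mul_assoc y₂, ← hc]; noncomm_ring
  rw [e]
  exact add_mem (add_mem hxy (littleO_mul_right h.frame.central e1 _))
    (littleO_mul_right h.frame.central e2 _)

/-- An approximable element with vanishing marginals that is annihilated to second order by powers
of `1 - f` on the left and of `1 - g` on the right vanishes to second order. -/
theorem mem_littleO_two {f g x : L1 (Γ₁ × Γ₂)} {N : ℕ}
    (hf : f ∈ approximable h.frame.central) (hfm : mass f = 1) (hfd : Dominates (f ^ N) (U₁ * U₂))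
    (hg : g ∈ approximable h.frame.central) (hgm : mass g = 1) (hgd : Dominates (g ^ N) (U₁ * U₂))
    (hx : x ∈ approximable h.frame.central)
    (hx₁ : map (projFst Γ₁ Γ₂) x = 0) (hx₂ : map (projSnd Γ₁ Γ₂) x = 0)
    {a b : ℕ} (ha : a ≠ 0) (hb : b ≠ 0) (hxf : (1 - f) ^ a * x ∈ littleO (η₁ * η₂) 2)
    (hxg : x * (1 - g) ^ b ∈ littleO (η₁ * η₂) 2) : x ∈ littleO (η₁ * η₂) 2 := by
  set u := U₁ * U₂ with hu_def
  have hu := h.U_mem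
  have hqu := h.map_U
  have hc := h.frame.central
  -- Being annihilated by a power of `1 - map q f` forces `map q x` to be a multiple of the uniform
  -- distribution; its mass is that of `x`, which is zero.
  have hqx : map q x = 0 := by
    have hd : Dominates (map q f ^ N) (uniform F) := by
      have := hfd.map q
      rwa [hqu, map_pow] at this
    obtain ⟨z, hz, -⟩ := exists_mul_one_sub_pow_eq (by rw [mass_map, hfm]) hd ha
    have h0 := map_eq_zero_of_littleO h.frame.map_eq_one (littleO_succ_le 0 (littleO_succ_le 1 hxf))
    rw [map_mul, map_pow, map_sub, map_one] at h0
    have h1 : (1 - uniform F) * map q x = 0 := by rw [← hz, mul_assoc, h0, mul_zero]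
    rw [sub_mul, one_mul, uniform_mul, mass_map, ← mass_map (projFst Γ₁ Γ₂), hx₁, map_zero,
      zero_smul, sub_zero] at h1
    exact h1
  have hx0 : x ∈ littleO (η₁ * η₂) 0 := bigO_le_littleO (h.frame.mem_bigO_of_map_eq_zero hx hqx)
  -- At first order vanishing marginals leave only a mixed product of two differences, already of
  -- order one. No torsion is needed yet.
  have hx1 : x ∈ littleO (η₁ * η₂) 1 := by
    have hr := h.frame.mul_complement_mem hu hqu hg hgm hgd hb zero_le_one hx0 hxg
    obtain ⟨y, hy, hxy⟩ := h.frame.exists_firstOrder hu hqu hx hqx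
    have hxy' : x - y * (U₁ * U₂) ∈ littleO (η₁ * η₂) 1 := by
      have e : x - y * (U₁ * U₂) = x * (1 - u) + (x - y) * u := by noncomm_ring
      rw [e]
      exact add_mem hr hxy
    obtain ⟨m, hm, hxm⟩ := h.mixed_of_marginals hx₁ hx₂ (Submodule.mem_sup_left hy) h.fst_U₁
      h.snd_U₁ h.fst_U₂ h.snd_U₂ hxy'
    have hm1 : m ∈ littleO (η₁ * η₂) 1 := by
      have hle := mul_le_mul'
        (Submodule.span_mono (R := ℝ) (Set.image_mono (f := fun s : Γ₁ × Γ₂ => δ s - 1)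
          (fun s (hs : s ∈ S ∧ s.2 = 1) => hs.1) : _ ⊆ _ '' (S : Set (Γ₁ × Γ₂))))
        (Submodule.span_mono (R := ℝ) (Set.image_mono (f := fun s : Γ₁ × Γ₂ => δ s - 1)
          (fun s (hs : s ∈ S ∧ s.1 = 1) => hs.1) : _ ⊆ _ '' (S : Set (Γ₁ × Γ₂))))
      exact h.frame.differences_mul_le (hle hm)
    have := add_mem hxm (littleO_mul_right hc hm1 (U₁ * U₂))
    rwa [sub_add_cancel] at this
  -- The improved order of `x` is fed back: now both `(1 - u) * x` and `x * (1 - u)` are of second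
  -- order.
  have hl := h.frame.complement_mul_mem hu hqu hf hfm hfd ha le_rfl hx1 hxf
  have hr := h.frame.mul_complement_mem hu hqu hg hgm hgd hb le_rfl hx1 hxg
  obtain ⟨y, hy, hxy⟩ := h.frame.exists_secondOrder hu hqu hx hqx
  have huu : u * u = (U₁ * U₁) * (U₂ * U₂) := by
    rw [hu_def, mul_assoc, ← mul_assoc U₂, ← h.commute_U.eq]; noncomm_ring
  have hxy' : x - y * ((U₁ * U₁) * (U₂ * U₂)) ∈ littleO (η₁ * η₂) 2 := by
    have e : x - y * ((U₁ * U₁) * (U₂ * U₂)) =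
        x * (1 - u) + x * (1 - u) * u + (x - y) * (u * u) := by
      rw [← huu]; noncomm_ring
    rw [e]
    exact add_mem (add_mem hr (littleO_mul_right hc hr u)) hxy
  obtain ⟨m, hm, hxm⟩ := h.mixed_of_marginals hx₁ hx₂ hy
    (by rw [map_mul, h.fst_U₁]) (by rw [map_mul, h.snd_U₁, mul_one])
    (by rw [map_mul, h.fst_U₂, mul_one]) (by rw [map_mul, h.snd_U₂]) hxy'
  rw [← huu] at hxm
  -- The averaging in the first factor cancels the mixed second-order term.
  have hUm : U₁ * m * (u * u) ∈ littleO (η₁ * η₂) 2 := by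
    have hle : differences {s | s ∈ S ∧ s.2 = 1} * differences {s | s ∈ S ∧ s.1 = 1} ≤
        (littleO (η₁ * η₂) 2).comap
          ((LinearMap.mulRight ℝ (u * u)).comp (LinearMap.mulLeft ℝ U₁)) := by
      rw [differences, differences, Submodule.span_mul_span, Submodule.span_le]
      rintro _ ⟨_, ⟨s, ⟨hs, hs'⟩, rfl⟩, _, ⟨t, ⟨ht, ht'⟩, rfl⟩, rfl⟩
      exact h.mixed s hs hs' t ht ht'
    exact hle hm
  have hU₁u : U₁ * u - u ∈ bigO (η₁ * η₂) := by
    refine h.frame.mem_bigO_of_map_eq_zero (finSupp_le_approximable _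
      (sub_mem (mul_mem_finSupp h.U₁_mem hu) hu)) ?_
    rw [map_sub, map_mul, hqu, mul_uniform, mass_map, h.mass_U₁, one_smul, sub_self]
  -- Modulo second order: `x ≈ u * x ≈ U₁ * u * x ≈ U₁ * x ≈ U₁ * m * (u * u) ≈ 0`.
  have e : x = (1 - u) * x - U₁ * ((1 - u) * x) - (U₁ * u - u) * x +
      U₁ * (x - m * (u * u)) + U₁ * m * (u * u) := by noncomm_ring
  rw [e]
  exact add_mem (add_mem (sub_mem (sub_mem hl (littleO_mul_left hl _))
    (bigO_mul_littleO hc hU₁u hx1)) (littleO_mul_left hxm _)) hUm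

end ProductFrame

end Product

end L1

/-! ### Powers of a measure against the product of their marginals -/

namespace L1

open CentralContraction

variable {Γ₁ Γ₂ F : Type*} [Group Γ₁] [Group Γ₂] [Group F]

theorem map_projFst_map_projFst (x : L1 (Γ₁ × Γ₂)) :
    map (projFst Γ₁ Γ₂) (map (projFst Γ₁ Γ₂) x) = map (projFst Γ₁ Γ₂) x := by
  rw [map_map]; rfl

theorem map_projSnd_map_projSnd (x : L1 (Γ₁ × Γ₂)) :
    map (projSnd Γ₁ Γ₂) (map (projSnd Γ₁ Γ₂) x) = map (projSnd Γ₁ Γ₂) x := by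
  rw [map_map]; rfl

theorem map_projFst_map_projSnd (x : L1 (Γ₁ × Γ₂)) :
    map (projFst Γ₁ Γ₂) (map (projSnd Γ₁ Γ₂) x) = algebraMap ℝ _ (mass x) := by
  rw [map_map, ← map_one_hom]; rfl

theorem map_projSnd_map_projFst (x : L1 (Γ₁ × Γ₂)) :
    map (projSnd Γ₁ Γ₂) (map (projFst Γ₁ Γ₂) x) = algebraMap ℝ _ (mass x) := by
  rw [map_map, ← map_one_hom]; rfl

/-- The product of the marginals. -/
def prodMarginals (ν : L1 (Γ₁ × Γ₂)) : L1 (Γ₁ × Γ₂) :=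
  map (projFst Γ₁ Γ₂) ν * map (projSnd Γ₁ Γ₂) ν

/-- The two projections have commuting images. The comparison thus concerns powers of two fixed
elements. -/
theorem prodMarginals_pow (ν : L1 (Γ₁ × Γ₂)) (n : ℕ) :
    prodMarginals ν ^ n = prodMarginals (ν ^ n) := by
  rw [prodMarginals, prodMarginals, (commute_map_proj ν ν).mul_pow, map_pow, map_pow]

theorem norm_prodMarginals_le {ν : L1 (Γ₁ × Γ₂)} (h : ‖ν‖ ≤ 1) : ‖prodMarginals ν‖ ≤ 1 :=
  (norm_mul_le _ _).trans (mul_le_one₀ ((norm_map_le _ _).trans h) (norm_nonneg _)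
    ((norm_map_le _ _).trans h))

theorem mass_prodMarginals {ν : L1 (Γ₁ × Γ₂)} (h : mass ν = 1) : mass (prodMarginals ν) = 1 := by
  rw [prodMarginals, map_mul, mass_map, mass_map, h, mul_one]

theorem map_projFst_prodMarginals {ν : L1 (Γ₁ × Γ₂)} (h : mass ν = 1) :
    map (projFst Γ₁ Γ₂) (prodMarginals ν) = map (projFst Γ₁ Γ₂) ν := by
  rw [prodMarginals, map_mul, map_projFst_map_projFst, map_projFst_map_projSnd, h, map_one, mul_one]

theorem map_projSnd_prodMarginals {ν : L1 (Γ₁ × Γ₂)} (h : mass ν = 1) :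
    map (projSnd Γ₁ Γ₂) (prodMarginals ν) = map (projSnd Γ₁ Γ₂) ν := by
  rw [prodMarginals, map_mul, map_projSnd_map_projSnd, map_projSnd_map_projFst, h, map_one, one_mul]

theorem _root_.Dominates.prodMarginals {p y₁ y₂ : L1 (Γ₁ × Γ₂)} (hp : ‖p‖ ≤ 1) (hy : ‖y₁‖ ≤ 1)
    (h₁ : map (projFst Γ₁ Γ₂) y₁ = y₁) (h₁' : map (projSnd Γ₁ Γ₂) y₁ = 1)
    (h₂ : map (projFst Γ₁ Γ₂) y₂ = 1) (h₂' : map (projSnd Γ₁ Γ₂) y₂ = y₂)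
    (h : Dominates p (y₁ * y₂)) : Dominates (prodMarginals p) (y₁ * y₂) := by
  have d1 := h.map (projFst Γ₁ Γ₂)
  have d2 := h.map (projSnd Γ₁ Γ₂)
  rw [map_mul, h₁, h₂, mul_one] at d1
  rw [map_mul, h₁', h₂', one_mul] at d2
  exact d1.mul ((norm_map_le _ _).trans hp) ((norm_map_le _ _).trans hp) hy d2

namespace ProductFrame

variable [Fintype F] {q : Γ₁ × Γ₂ →* F} {r : F → Γ₁ × Γ₂} {S : Finset (Γ₁ × Γ₂)}
  {η₁ η₂ U₁ U₂ : L1 (Γ₁ × Γ₂)} (h : ProductFrame q r S η₁ η₂ U₁ U₂)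
include h

theorem prodMarginals_mem_approximable {ν : L1 (Γ₁ × Γ₂)}
    (hν : ν ∈ approximable h.frame.central) :
    prodMarginals ν ∈ approximable h.frame.central := by
  obtain ⟨y, hy, hνy⟩ := hν
  refine mul_mem (mem_approximable.2 ⟨map (projFst Γ₁ Γ₂) y, map_mem_finSupp _ hy, ?_⟩)
    (mem_approximable.2 ⟨map (projSnd Γ₁ Γ₂) y, map_mem_finSupp _ hy, ?_⟩)
  · rw [← map_sub]; exact h.fst_mem_littleO hνy
  · rw [← map_sub]; exact h.snd_mem_littleO hνy

/-- The powers of `ν` are asymptotic to the products of their marginals. -/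
theorem tendsto_norm_pow_sub {ν : L1 (Γ₁ × Γ₂)} (hν : ν ∈ approximable h.frame.central)
    (hν1 : ‖ν‖ ≤ 1) (hm : mass ν = 1) (hU : ‖U₁‖ ≤ 1) {N : ℕ} (hN : 0 < N)
    (hdη : Dominates (ν ^ N) (η₁ * η₂)) (hdU : Dominates (ν ^ N) (U₁ * U₂)) :
    Tendsto (fun n : ℕ => ‖ν ^ n - prodMarginals (ν ^ n)‖) atTop (𝓝 0) := by
  set g := prodMarginals ν with hgdef
  have hg := h.prodMarginals_mem_approximable hν
  have hg1 : ‖g‖ ≤ 1 := norm_prodMarginals_le hν1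
  have hgm : mass g = 1 := mass_prodMarginals hm
  have hνN : ‖ν ^ N‖ ≤ 1 := (norm_pow_le _ _).trans (pow_le_one₀ (norm_nonneg _) hν1)
  have hgη : Dominates (g ^ N) (η₁ * η₂) := by
    rw [hgdef, prodMarginals_pow]
    exact hdη.prodMarginals hνN h.central₁.norm_le h.fst_η₁ h.snd_η₁ h.fst_η₂ h.snd_η₂
  have hgU : Dominates (g ^ N) (U₁ * U₂) := by
    rw [hgdef, prodMarginals_pow]
    exact hdU.prodMarginals hνN hU h.fst_U₁ h.snd_U₁ h.fst_U₂ h.snd_U₂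
  -- The polynomials may differ; only the value one at `1` and the annihilation by some powers of `1
  -- - ν` and `1 - g` matter.
  obtain ⟨p, a, hp1, ha, hpa⟩ := h.frame.exists_polynomial hν
  obtain ⟨p', b, hp1', hb, hpb⟩ := h.frame.exists_polynomial hg
  have haeval : ∀ {f : L1 (Γ₁ × Γ₂)}, f ∈ approximable h.frame.central → ∀ p : Polynomial ℝ,
      Polynomial.aeval f p ∈ approximable h.frame.central := fun hf p =>
    Algebra.adjoin_le (Set.singleton_subset_iff.2 hf) (Polynomial.aeval_mem_adjoin_singleton ℝ _)
  have hpν := haeval hν p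
  have hpg := haeval hg p'
  set y := Polynomial.aeval ν p
  set z := Polynomial.aeval g p'
  have hcy : ν * y = y * ν := by
    have : ν = Polynomial.aeval ν (Polynomial.X : Polynomial ℝ) := by simp
    rw [this, ← map_mul, mul_comm, map_mul, ← this]
  have hcz : Commute z (1 - g) := by
    have : (1 - g) = Polynomial.aeval g (1 - Polynomial.X : Polynomial ℝ) := by simp
    rw [this, Commute, SemiconjBy, ← map_mul, mul_comm, map_mul]
  set u := y * z with hu
  have hx : ν * u - u * g = y * (ν - g) * z := by
    have : z * g = g * z := by
      have := hcz.eq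
      rw [mul_sub, sub_mul, mul_one, one_mul] at this
      exact sub_right_injective this
    rw [hu, ← mul_assoc, hcy, mul_assoc y z g, this]; noncomm_ring
  have hum : mass u = 1 := by
    rw [hu, map_mul, ← Polynomial.aeval_algHom_apply, ← Polynomial.aeval_algHom_apply, hm, hgm,
      Polynomial.coe_aeval_eq_eval, hp1]
    simp [hp1']
  have hua : u ∈ approximable h.frame.central := mul_mem hpν hpg
  have hxa : ν * u - u * g ∈ approximable h.frame.central :=
    sub_mem (mul_mem hν hua) (mul_mem hua hg)
  -- The factor `ν - g` makes both marginals vanish; the outer factors provide the annihilation on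
  -- the two sides.
  have key : ν * u - u * g ∈ littleO (η₁ * η₂) 2 := by
    refine h.mem_littleO_two hν hm hdU hg hgm hgU hxa ?_ ?_ ha hb ?_ ?_
    · rw [hx, map_mul, map_mul, map_sub, map_projFst_prodMarginals hm, sub_self, mul_zero, zero_mul]
    · rw [hx, map_mul, map_mul, map_sub, map_projSnd_prodMarginals hm, sub_self, mul_zero, zero_mul]
    · rw [hx, ← mul_assoc, ← mul_assoc]
      exact littleO_mul_right h.frame.central (littleO_mul_right h.frame.central hpa _) _
    · rw [hx, mul_assoc, (hcz.pow_right b).eq]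
      exact littleO_mul_left hpb _
  have t1 := tendsto_pow_mul_sub_mul_pow hν1 hg1
    (h.frame.central.tendsto_mul_zero_of_dominates hν1 hN hdη key).2
    (h.frame.central.tendsto_mul_zero_of_dominates hg1 hN hgη key).1
  have h1u : 1 - u ∈ approximable h.frame.central := sub_mem (one_mem _) hua
  have h1m : mass (1 - u) = 0 := by rw [map_sub, map_one, hum, sub_self]
  -- As `u` has mass one, inserting it next to a high power costs nothing in the limit.
  have t2 := (h.frame.tendsto_zero_of_mass_eq_zero h.map_U hν hdU hν1 hN hdη h1u h1m).2
  have t3 := (h.frame.tendsto_zero_of_mass_eq_zero h.map_U hg hgU hg1 hN hgη h1u h1m).1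
  have T := (t2.add t1).add t3
  rw [add_zero, add_zero] at T
  refine squeeze_zero (fun _ => norm_nonneg _) (fun n => ?_) T
  have e : ν ^ n - prodMarginals (ν ^ n) =
      ν ^ n * (1 - u) + (ν ^ n * u - u * g ^ n) - (1 - u) * g ^ n := by
    rw [← prodMarginals_pow]; noncomm_ring
  rw [e]
  exact (norm_sub_le _ _).trans (add_le_add_left (norm_add_le _ _) _)

end ProductFrame

end L1

/-! ### Virtually abelian groups -/

section GroupTheory

variable {Γ : Type*} [Group Γ]

theorem RandomWalk.VirtuallyAbelian.exists_normal (h : RandomWalk.VirtuallyAbelian Γ) :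
    ∃ A : Subgroup Γ, A.Normal ∧ A.FiniteIndex ∧ ∀ a ∈ A, ∀ b ∈ A, a * b = b * a := by
  obtain ⟨H, hH, hc⟩ := h
  exact ⟨H.normalCore, inferInstance, inferInstance, fun a ha b hb =>
    hc a (H.normalCore_le ha) b (H.normalCore_le hb)⟩

/-- An abelian normal subgroup acts trivially on itself by conjugation, so only the coset matters.
Hence a finite set has finitely many conjugates. -/
theorem conj_eq_of_mem {A : Subgroup Γ} [A.Normal] (hA : ∀ a ∈ A, ∀ b ∈ A, a * b = b * a) {s : Γ}
    (hs : s ∈ A) {g k : Γ} (hgk : g⁻¹ * k ∈ A) : g⁻¹ * s * g = k⁻¹ * s * k := by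
  have h1 : g⁻¹ * s * g ∈ A := by
    simpa using Subgroup.Normal.conj_mem ‹A.Normal› s hs g⁻¹
  have h2 := hA _ h1 _ hgk
  calc g⁻¹ * s * g = (g⁻¹ * k)⁻¹ * ((g⁻¹ * k) * (g⁻¹ * s * g)) := by group
    _ = k⁻¹ * s * k := by rw [← h2]; group

/-- A finite subset of a normal abelian subgroup of finite index is contained in a finite subset
that is invariant under conjugation. -/
theorem exists_finset_conj_invariant {A : Subgroup Γ} [A.Normal] [A.FiniteIndex]
    (hA : ∀ a ∈ A, ∀ b ∈ A, a * b = b * a) {T : Set Γ} (hT : T.Finite) (hTA : T ⊆ A) :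
    ∃ S : Finset Γ, T ⊆ S ∧ (∀ s ∈ S, s ∈ A) ∧ ∀ g, ∀ s ∈ S, g * s * g⁻¹ ∈ S := by
  have hfin : (Set.image2 (fun (f : Γ ⧸ A) t => f.out⁻¹ * t * f.out) Set.univ T).Finite :=
    Set.Finite.image2 _ Set.finite_univ hT
  have key : ∀ g : Γ, ∀ t ∈ T, g⁻¹ * t * g ∈ hfin.toFinset := by
    intro g t ht
    rw [Set.Finite.mem_toFinset]
    refine ⟨(g : Γ ⧸ A), Set.mem_univ _, t, ht, ?_⟩
    refine conj_eq_of_mem hA (hTA ht) ?_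
    rw [← QuotientGroup.eq, QuotientGroup.out_eq']
  refine ⟨hfin.toFinset, fun t ht => by simpa using key 1 t ht, fun s hs => ?_, fun g s hs => ?_⟩
  · obtain ⟨f, -, t, ht, rfl⟩ := hfin.mem_toFinset.1 hs
    simpa using Subgroup.Normal.conj_mem ‹A.Normal› t (hTA ht) f.out⁻¹
  · obtain ⟨f, -, t, ht, rfl⟩ := hfin.mem_toFinset.1 hs
    have := key (f.out * g⁻¹) t ht
    convert this using 1
    group

/-- A finitely generated commutative group without a surjection to `ℤ` is finite. -/
theorem CommGroup.finite_of_no_surjection {M : Type*} [CommGroup M] [Group.FG M]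
    (h : ¬∃ f : M →* Multiplicative ℤ, Function.Surjective f) : Finite M := by
  obtain ⟨ι, j, hι, hj, p, hp, e, ⟨E⟩⟩ := CommGroup.equiv_free_prod_prod_multiplicative_zmod M
  have hempty : IsEmpty j := by
    by_contra hne
    rw [not_isEmpty_iff] at hne
    obtain ⟨i⟩ := hne
    refine h ⟨((Pi.evalMonoidHom (fun _ : j => Multiplicative ℤ) i).comp
      (MonoidHom.fst _ _)).comp E.toMonoidHom, fun z => ?_⟩
    exact ⟨E.symm (fun _ => z, 1), by simp⟩
  have : ∀ i, NeZero (p i ^ e i) := fun i => ⟨pow_ne_zero _ (hp i).ne_zero⟩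
  have : ∀ i, Finite (Multiplicative (ZMod (p i ^ e i))) := fun i =>
    inferInstanceAs (Finite (ZMod (p i ^ e i)))
  exact Finite.of_equiv _ E.symm.toEquiv

/-- Every homomorphism to a commutative group has torsion image, if there is no surjection
to `ℤ`. -/
theorem exists_pow_eq_one_of_no_surjection [Group.FG Γ]
    (h : ¬∃ f : Γ →* Multiplicative ℤ, Function.Surjective f) {M : Type*} [CommGroup M]
    (τ : Γ →* M) (g : Γ) : ∃ k : ℕ, k ≠ 0 ∧ τ g ^ k = 1 := by
  have hfg : Group.FG (Abelianization Γ) :=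
    inferInstanceAs (Group.FG (Γ ⧸ commutator Γ))
  have hfin : Finite (Abelianization Γ) := by
    refine CommGroup.finite_of_no_surjection ?_
    rintro ⟨f, hf⟩
    exact h ⟨f.comp Abelianization.of, hf.comp (QuotientGroup.mk'_surjective _)⟩
  refine ⟨Nat.card (Abelianization Γ), Nat.card_pos.ne', ?_⟩
  rw [← Abelianization.lift_apply_of τ g, ← map_pow, pow_card_eq_one', map_one]

/-- The norm of an element of a normal abelian subgroup of finite index has finite order, if there
is no surjection to `ℤ`. -/
theorem exists_prod_conj_pow_eq_one [Group.FG Γ]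
    (h : ¬∃ f : Γ →* Multiplicative ℤ, Function.Surjective f) {A : Subgroup Γ} [A.Normal]
    [A.FiniteIndex] (hA : ∀ a ∈ A, ∀ b ∈ A, a * b = b * a) [Fintype (Γ ⧸ A)] {s : Γ} (hs : s ∈ A) :
    ∃ k : ℕ, k ≠ 0 ∧
      ((Finset.univ.toList.map fun f : Γ ⧸ A => f.out⁻¹ * s * f.out).prod) ^ k = 1 := by
  let _ : CommGroup A :=
    { (inferInstance : Group A) with mul_comm := fun a b => Subtype.ext (hA a a.2 b b.2) }
  -- The transfer `Γ → A` has a commutative target, hence torsion image. Since `s` fixes every coset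
  -- of `A`, its transfer is the product of its conjugates.
  obtain ⟨k, hk, hpow⟩ := exists_pow_eq_one_of_no_surjection h
    (MonoidHom.transfer (MonoidHom.id A)) s
  refine ⟨k, hk, ?_⟩
  have hmem : ∀ f : Γ ⧸ A, f.out⁻¹ * s * f.out ∈ A := fun f => by
    simpa using Subgroup.Normal.conj_mem ‹A.Normal› s hs f.out⁻¹
  have hsmul : ∀ f : Γ ⧸ A, s⁻¹ • f = f := fun f => by
    obtain ⟨g, rfl⟩ := QuotientGroup.mk_surjective f
    refine QuotientGroup.eq.2 ?_
    simpa [mul_assoc] using Subgroup.Normal.conj_mem ‹A.Normal› s hs g⁻¹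
  have htr : MonoidHom.transfer (MonoidHom.id A) s =
      ∏ f : Γ ⧸ A, (⟨f.out⁻¹ * s * f.out, hmem f⟩ : A) := by
    rw [MonoidHom.transfer_def (MonoidHom.id A) default, Subgroup.leftTransversals.diff]
    have hd : ∀ f : Γ ⧸ A,
        (((default : A.LeftTransversal).2.leftQuotientEquiv f : Γ)) = f.out := fun f =>
      Subgroup.IsComplement.leftQuotientEquiv_apply QuotientGroup.out_eq' f
    refine Finset.prod_congr (by congr; subsingleton) fun f _ => Subtype.ext ?_
    simp [Subgroup.smul_apply_eq_smul_apply_inv_smul, hsmul, hd, mul_assoc]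
  have hval : ((∏ f : Γ ⧸ A, (⟨f.out⁻¹ * s * f.out, hmem f⟩ : A) : A) : Γ) =
      (Finset.univ.toList.map fun f : Γ ⧸ A => f.out⁻¹ * s * f.out).prod := by
    rw [← Finset.prod_map_toList, ← Subgroup.coe_subtype, map_list_prod, List.map_map]
    rfl
  rw [← hval, ← htr, ← Subgroup.coe_pow, hpow, Subgroup.coe_one]

/-- Finitely many letters in a normal abelian subgroup of finite index, invariant under conjugation,
that contain the Schreier generators for a given finite set. -/
theorem exists_schreier_letters {A : Subgroup Γ} [A.Normal] [A.FiniteIndex]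
    (hA : ∀ a ∈ A, ∀ b ∈ A, a * b = b * a) {X : Set Γ} (hX : X.Finite) :
    ∃ S : Finset Γ, (∀ s ∈ S, s ∈ A) ∧ (∀ g, ∀ s ∈ S, g * s * g⁻¹ ∈ S) ∧
      ((1 : Γ ⧸ A).out)⁻¹ ∈ S ∧
      ∀ x ∈ X, ∀ f : Γ ⧸ A, x * f.out * (((x : Γ ⧸ A) * f).out)⁻¹ ∈ S := by
  -- The representative of the trivial coset need not be `1`; its inverse is included to rewrite the
  -- empty word.
  obtain ⟨S, hTS, hSA, hS⟩ := exists_finset_conj_invariant hA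
    (T := insert ((1 : Γ ⧸ A).out)⁻¹
      (Set.image2 (fun (x : Γ) (f : Γ ⧸ A) => x * f.out * (((x : Γ ⧸ A) * f).out)⁻¹) X Set.univ))
    ((hX.image2 _ Set.finite_univ).insert _) (by
      rintro _ (rfl | ⟨x, hx, f, -, rfl⟩)
      · refine A.inv_mem ?_
        rw [← QuotientGroup.eq_one_iff, QuotientGroup.out_eq']
      · change _ ∈ A
        rw [← QuotientGroup.eq_one_iff]
        simp)
  exact ⟨S, hSA, hS, hTS (Set.mem_insert _ _),
    fun x hx f => hTS (Set.mem_insert_of_mem _ ⟨x, hx, f, Set.mem_univ _, rfl⟩)⟩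

/-- The Schreier rewriting process: if every letter can be moved past the section at the price of at
most two letters of a conjugation-invariant set, then every word can be rewritten. -/
theorem exists_rewriting {F : Type*} [Group F] {q : Γ →* F} {r : F → Γ} {S : Finset Γ}
    (hS : ∀ g, ∀ s ∈ S, g * s * g⁻¹ ∈ S) {X : Set Γ}
    (h1 : ∃ l : List Γ, (∀ s ∈ l, s ∈ S) ∧ l.length ≤ 2 ∧ 1 = l.prod * r 1)
    (hX : ∀ x ∈ X, ∀ f, ∃ l : List Γ, (∀ s ∈ l, s ∈ S) ∧ l.length ≤ 2 ∧
      x * r f = l.prod * r (q x * f)) {w : List Γ} (hw : ∀ x ∈ w, x ∈ X) :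
    ∃ l : List Γ, (∀ s ∈ l, s ∈ S) ∧ l.length ≤ 2 * w.length + 2 ∧
      w.prod = l.prod * r (q w.prod) := by
  induction w with
  | nil => simpa using h1
  | cons x w ih =>
    obtain ⟨l, hl, hlen, hlw⟩ := ih fun y hy => hw y (List.mem_cons_of_mem _ hy)
    obtain ⟨l', hl', hlen', hlx⟩ := hX x (hw x List.mem_cons_self) (q w.prod)
    -- Moving `x` to the right across `l` conjugates its letters, which stay in `S`. The length
    -- therefore grows additively, by at most two per letter.
    refine ⟨l.map (MulAut.conj x) ++ l', ?_, ?_, ?_⟩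
    · intro s hs
      rcases List.mem_append.1 hs with hs | hs
      · obtain ⟨t, ht, rfl⟩ := List.mem_map.1 hs
        exact hS x t (hl t ht)
      · exact hl' s hs
    · simp only [List.length_append, List.length_map, List.length_cons]
      omega
    · rw [List.prod_append, ← map_list_prod, MulAut.conj_apply, List.prod_cons, map_mul, mul_assoc,
        ← hlx, mul_assoc, inv_mul_cancel_left, mul_assoc, ← hlw]

end GroupTheory

/-! ### Cancellation of mixed differences by torsion -/

namespace L1

open CentralContraction

/-- The word repeated `k` times represents `1` and has first-order part `k • taylorOne l`, which is
therefore, up to sign, a first-order remainder. -/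
theorem Frame.taylorOne_mem_of_prod_pow {G F : Type*} [Group G] [Group F] {q : G →* F} {r : F → G}
    {S : Finset G} {η : L1 G} (h : Frame q r S η) {l : List G} (hl : ∀ s ∈ l, s ∈ S) {k : ℕ}
    (hk : k ≠ 0) (hlk : l.prod ^ k = 1) : taylorOne l ∈ littleO η 1 := by
  have h1 : ((List.replicate k l).flatten).prod = 1 := by
    rw [List.prod_flatten, List.map_replicate, List.prod_replicate, hlk]
  have h2 : taylorOne (List.replicate k l).flatten = (k : ℝ) • taylorOne l := by
    rw [taylorOne, List.map_flatten, List.sum_flatten, List.map_replicate, List.map_replicate,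
      List.sum_replicate, Nat.cast_smul_eq_nsmul]
    rfl
  have h3 := h.δ_prod_sub_taylorOne_mem (l := (List.replicate k l).flatten) fun s hs => by
    obtain ⟨l', hl', hs'⟩ := List.mem_flatten.1 hs
    rw [List.eq_of_mem_replicate hl'] at hs'
    exact hl s hs'
  rw [h1, h2, δ_one, sub_self, zero_sub, neg_mem_iff] at h3
  simpa [smul_smul, hk] using Submodule.smul_mem _ (k : ℝ)⁻¹ h3

/-- Moving `δ (ρ i)` to the right conjugates `s`, fixes `t`, and is absorbed by `u` up to `bigO η`.
What remains is the sum over the conjugates of `s`, small by assumption, times `δ t - 1`. -/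
theorem Frame.sum_mixed_mem {G F : Type*} [Group G] [Group F] [Fintype F] {q : G →* F} {r : F → G}
    {S : Finset G} {η : L1 G} (h : Frame q r S η) {u : L1 G} (hu : u ∈ finSupp G)
    (hqu : map q u = uniform F) {ι : Type*} (I : Finset ι) (ρ : ι → G) {s t : G}
    (hs : ∀ i, ρ i * s * (ρ i)⁻¹ ∈ S) (ht : t ∈ S) (hρt : ∀ i, ρ i * t = t * ρ i)
    (hsum : ∑ i ∈ I, (δ (ρ i * s * (ρ i)⁻¹) - 1) ∈ littleO η 1) :
    (∑ i ∈ I, δ (ρ i)) * ((δ s - 1) * (δ t - 1)) * (u * u) ∈ littleO η 2 := by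
  have hb := h.letter_bigO t ht
  have e : (∑ i ∈ I, δ (ρ i)) * ((δ s - 1) * (δ t - 1)) * (u * u) =
      (∑ i ∈ I, (δ (ρ i * s * (ρ i)⁻¹) - 1)) * (δ t - 1) * (u * u) +
        ∑ i ∈ I, (δ (ρ i * s * (ρ i)⁻¹) - 1) * (δ t - 1) * (δ (ρ i) * u - u) * u := by
    simp only [Finset.sum_mul]
    rw [← Finset.sum_add_distrib]
    refine Finset.sum_congr rfl fun i _ => ?_
    have e1 : δ (ρ i) * δ s = δ (ρ i * s * (ρ i)⁻¹) * δ (ρ i) := by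
      rw [δ_mul_δ, δ_mul_δ, inv_mul_cancel_right]
    have e2 : δ (ρ i) * δ t = δ t * δ (ρ i) := by rw [δ_mul_δ, δ_mul_δ, hρt]
    have e3 : δ (ρ i) * ((δ s - 1) * (δ t - 1)) =
        (δ (ρ i * s * (ρ i)⁻¹) - 1) * (δ t - 1) * δ (ρ i) := by
      calc δ (ρ i) * ((δ s - 1) * (δ t - 1)) =
          δ (ρ i) * δ s * (δ t - 1) - δ (ρ i) * (δ t - 1) := by noncomm_ring
        _ = (δ (ρ i * s * (ρ i)⁻¹) - 1) * (δ (ρ i) * δ t - δ (ρ i)) := by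
          rw [e1]; noncomm_ring
        _ = _ := by rw [e2]; noncomm_ring
    rw [e3]
    noncomm_ring
  rw [e]
  refine add_mem (littleO_mul_right h.central (littleO_mul_bigO h.central hsum hb) _)
    (sum_mem fun i _ => littleO_mul_right h.central (littleO_mul_bigO h.central
      (bigO_mul_bigO h.central (h.letter_bigO _ (hs i)) hb) (h.δ_mul_sub_mem_bigO hu hqu _)) _)

end L1

/-! ### Averages, and the construction of the product frame -/

namespace L1

open CentralContraction

section Average

variable {G K ι : Type*} [Group G] [Group K] [Fintype ι]

/-- The average of the Dirac masses at the members of a finite family. -/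
def average (g : ι → G) : L1 G := (Fintype.card ι : ℝ)⁻¹ • ∑ i, δ (g i)

theorem map_average (φ : G →* K) (g : ι → G) : map φ (average g) = average fun i => φ (g i) := by
  simp [average, map_sum]

theorem average_mem_finSupp (g : ι → G) : average g ∈ finSupp G :=
  Submodule.smul_mem _ _ (sum_mem fun _ _ => δ_mem_finSupp _)

theorem average_one [Nonempty ι] : average (fun _ : ι => (1 : G)) = 1 := by
  simp [average, ← Nat.cast_smul_eq_nsmul ℝ, smul_smul]

theorem average_mul_average {κ : Type*} [Fintype κ] (g : ι → G) (k : κ → G) :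
    average g * average k = average fun x : ι × κ => g x.1 * k x.2 := by
  rw [average, average, average, smul_mul_smul_comm, Finset.sum_mul_sum, Fintype.sum_prod_type,
    Fintype.card_prod, Nat.cast_mul, mul_inv]
  simp only [δ_mul_δ]

theorem average_inv [Fintype K] : average (fun f : K => f⁻¹) = uniform K := by
  rw [average, uniform]
  congr 1
  exact Fintype.sum_equiv (Equiv.inv K) _ _ fun _ => rfl

/-- The multiplicative closure of the finitely supported probability measures. -/
def probabilities (G : Type*) [Group G] : Submonoid (L1 G) :=
  Submonoid.closure (convexHull ℝ (Set.range δ))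

theorem norm_le_one_of_mem_probabilities {x : L1 G} (hx : x ∈ probabilities G) : ‖x‖ ≤ 1 := by
  induction hx using Submonoid.closure_induction with
  | mem x h =>
    have : convexHull ℝ (Set.range δ) ⊆ Metric.closedBall (0 : L1 G) 1 := by
      refine convexHull_min ?_ (convex_closedBall _ _)
      rintro _ ⟨g, rfl⟩
      simp
    simpa using this h
  | one => simp
  | mul x y _ _ hx hy => exact (norm_mul_le x y).trans (mul_le_one₀ hx (norm_nonneg _) hy)

theorem average_mem_probabilities [Nonempty ι] (g : ι → G) : average g ∈ probabilities G := by
  refine Submonoid.subset_closure ?_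
  rw [average, Finset.smul_sum]
  refine (convex_convexHull ℝ _).sum_mem (fun _ _ => by positivity) (by simp) fun i _ => ?_
  exact subset_convexHull ℝ _ ⟨g i, rfl⟩

theorem lazy_mem_probabilities (s : G) : lazy s ∈ probabilities G := by
  refine Submonoid.subset_closure ?_
  rw [lazy, smul_add, ← δ_one]
  exact convex_convexHull ℝ _ (subset_convexHull ℝ _ (Set.mem_range_self 1))
    (subset_convexHull ℝ _ (Set.mem_range_self s)) (by norm_num) (by norm_num) (by norm_num)

end Average

section ProductFrame

variable {Γ₁ Γ₂ : Type*} [Group Γ₁] [Group Γ₂]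

/-- The letters are Schreier generators of the two abelian subgroups, taken in each factor
separately. The length bound keeps the second moment under control after rewriting. -/
theorem exists_productFrame [Group.FG Γ₁]
    (hhom : ¬∃ f : Γ₁ →* Multiplicative ℤ, Function.Surjective f)
    {A₁ : Subgroup Γ₁} {A₂ : Subgroup Γ₂} [A₁.Normal] [A₂.Normal] [A₁.FiniteIndex] [A₂.FiniteIndex]
    [Fintype (Γ₁ ⧸ A₁)] [Fintype (Γ₂ ⧸ A₂)]
    (h₁ : ∀ a ∈ A₁, ∀ b ∈ A₁, a * b = b * a) (h₂ : ∀ a ∈ A₂, ∀ b ∈ A₂, a * b = b * a)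
    {X : Set (Γ₁ × Γ₂)} (hX : X.Finite)
    (hXw : ∀ g, ∃ w : List (Γ₁ × Γ₂), (∀ x ∈ w, x ∈ X) ∧ w.prod = g) :
    ∃ (q : Γ₁ × Γ₂ →* (Γ₁ ⧸ A₁) × (Γ₂ ⧸ A₂)) (r : (Γ₁ ⧸ A₁) × (Γ₂ ⧸ A₂) → Γ₁ × Γ₂)
      (S : Finset (Γ₁ × Γ₂)) (η₁ η₂ U₁ U₂ : L1 (Γ₁ × Γ₂)),
      ProductFrame q r S η₁ η₂ U₁ U₂ ∧
      (η₁ ∈ probabilities _ ∧ η₂ ∈ probabilities _ ∧ U₁ ∈ probabilities _ ∧ U₂ ∈ probabilities _) ∧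
      ∀ w : List (Γ₁ × Γ₂), (∀ x ∈ w, x ∈ X) → ∃ l : List (Γ₁ × Γ₂), (∀ s ∈ l, s ∈ S) ∧
        l.length ≤ 2 * w.length + 2 ∧ w.prod = l.prod * r (q w.prod) := by
  classical
  obtain ⟨S₁, hSA₁, hS₁, hone₁, hX₁⟩ := exists_schreier_letters h₁ (hX.image Prod.fst)
  obtain ⟨S₂, hSA₂, hS₂, hone₂, hX₂⟩ := exists_schreier_letters h₂ (hX.image Prod.snd)
  set T₁ : Finset (Γ₁ × Γ₂) := S₁.image fun a => (a, 1) with hT₁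
  set T₂ : Finset (Γ₁ × Γ₂) := S₂.image fun b => (1, b) with hT₂
  have memT₁ : ∀ s, s ∈ T₁ ↔ s.1 ∈ S₁ ∧ s.2 = 1 := fun s => by
    rw [hT₁, Finset.mem_image]
    exact ⟨by rintro ⟨a, ha, rfl⟩; exact ⟨ha, rfl⟩, fun h => ⟨s.1, h.1, Prod.ext rfl h.2.symm⟩⟩
  have memT₂ : ∀ s, s ∈ T₂ ↔ s.1 = 1 ∧ s.2 ∈ S₂ := fun s => by
    rw [hT₂, Finset.mem_image]
    exact ⟨by rintro ⟨a, ha, rfl⟩; exact ⟨rfl, ha⟩, fun h => ⟨s.2, h.2, Prod.ext h.1.symm rfl⟩⟩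
  have conj₁ : ∀ g, ∀ s ∈ T₁, g * s * g⁻¹ ∈ T₁ := fun g s hs => by
    rw [memT₁] at *
    exact ⟨hS₁ _ _ hs.1, by simp [hs.2]⟩
  have conj₂ : ∀ g, ∀ s ∈ T₂, g * s * g⁻¹ ∈ T₂ := fun g s hs => by
    rw [memT₂] at *
    exact ⟨by simp [hs.1], hS₂ _ _ hs.2⟩
  obtain ⟨η₁, hη₁, hc₁, hO₁⟩ := exists_smoothing (S := T₁) (fun s hs t ht => by
    rw [memT₁] at *
    exact Prod.ext (h₁ _ (hSA₁ _ hs.1) _ (hSA₁ _ ht.1)) (by simp [hs.2, ht.2])) conj₁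
  obtain ⟨η₂, hη₂, hc₂, hO₂⟩ := exists_smoothing (S := T₂) (fun s hs t ht => by
    rw [memT₂] at *
    exact Prod.ext (by simp [hs.1, ht.1]) (h₂ _ (hSA₂ _ hs.2) _ (hSA₂ _ ht.2))) conj₂
  have hlazy : ∀ T : Set (Γ₁ × Γ₂), Submonoid.closure (lazy '' T) ≤ probabilities _ := fun T => by
    rw [Submonoid.closure_le]
    rintro _ ⟨s, -, rfl⟩
    exact lazy_mem_probabilities s
  set q : Γ₁ × Γ₂ →* (Γ₁ ⧸ A₁) × (Γ₂ ⧸ A₂) :=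
    MonoidHom.prodMap (QuotientGroup.mk' A₁) (QuotientGroup.mk' A₂) with hq
  set r : (Γ₁ ⧸ A₁) × (Γ₂ ⧸ A₂) → Γ₁ × Γ₂ := fun f => (f.1.out, f.2.out) with hr
  have hqr : ∀ f, q (r f) = f := fun f =>
    Prod.ext (QuotientGroup.out_eq' f.1) (QuotientGroup.out_eq' f.2)
  have hqS : ∀ s ∈ T₁ ∪ T₂, q s = 1 := fun s hs => by
    rcases Finset.mem_union.1 hs with hs | hs
    · rw [memT₁] at hs
      exact Prod.ext ((QuotientGroup.eq_one_iff _).2 (hSA₁ _ hs.1)) (by simp [hq, hs.2])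
    · rw [memT₂] at hs
      exact Prod.ext (by simp [hq, hs.1]) ((QuotientGroup.eq_one_iff _).2 (hSA₂ _ hs.2))
  -- A correction in the product is one letter per factor, whence the constant two in the rewriting.
  have hpair : ∀ {a b}, a ∈ S₁ → b ∈ S₂ → ∀ {g k : Γ₁ × Γ₂}, g = (a, b) * k →
      ∃ l : List (Γ₁ × Γ₂), (∀ s ∈ l, s ∈ T₁ ∪ T₂) ∧ l.length ≤ 2 ∧ g = l.prod * k := by
    intro a b ha hb g k hgk
    refine ⟨[(a, 1), (1, b)], fun s hs => ?_, by simp, by simp [hgk]⟩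
    rw [Finset.mem_union, memT₁, memT₂]
    rcases List.mem_pair.1 hs with rfl | rfl
    · exact Or.inl ⟨ha, rfl⟩
    · exact Or.inr ⟨rfl, hb⟩
  have hwords : ∀ w : List (Γ₁ × Γ₂), (∀ x ∈ w, x ∈ X) → ∃ l : List (Γ₁ × Γ₂),
      (∀ s ∈ l, s ∈ T₁ ∪ T₂) ∧ l.length ≤ 2 * w.length + 2 ∧ w.prod = l.prod * r (q w.prod) := by
    intro w hw
    refine exists_rewriting (fun g s hs => ?_) (hpair hone₁ hone₂ ?_) (fun x hx f => ?_) hw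
    · rw [Finset.mem_union] at *
      exact hs.imp (conj₁ g s) (conj₂ g s)
    · exact Prod.ext (inv_mul_cancel _).symm (inv_mul_cancel _).symm
    · exact hpair (hX₁ _ ⟨x, hx, rfl⟩ f.1) (hX₂ _ ⟨x, hx, rfl⟩ f.2)
        (Prod.ext (inv_mul_cancel_right _ _).symm (inv_mul_cancel_right _ _).symm)
  -- Inverses of coset representatives are averaged so that the conjugates produced are exactly
  -- those in the transfer.
  set U₁ : L1 (Γ₁ × Γ₂) := average fun f : Γ₁ ⧸ A₁ => (f.out⁻¹, 1) with hU₁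
  set U₂ : L1 (Γ₁ × Γ₂) := average fun f : Γ₂ ⧸ A₂ => (1, f.out⁻¹) with hU₂
  have hU : map q (U₁ * U₂) = uniform _ := by
    rw [hU₁, hU₂, average_mul_average, map_average, ← average_inv]
    refine congrArg average (funext fun f => ?_)
    rw [Prod.mk_mul_mk, one_mul, mul_one, ← hqr f, ← map_inv, hqr]
    rfl
  have hframe : Frame q r (T₁ ∪ T₂) (η₁ * η₂) :=
    { central := hc₁.mul hc₂
      map_section := hqr
      letter_bigO := fun s hs => by
        rcases Finset.mem_union.1 hs with hs | hs
        · exact bigO_mul_right_le hc₁ hc₂ (hO₁ s hs)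
        · rw [hc₁.comm]
          exact bigO_mul_right_le hc₂ hc₁ (hO₂ s hs)
      map_eq_one := by
        rw [map_mul,
          map_eq_one_of_mem_closure (fun s hs => hqS s (Finset.mem_union_left _ hs)) hη₁,
          map_eq_one_of_mem_closure (fun s hs => hqS s (Finset.mem_union_right _ hs)) hη₂, mul_one]
      exists_word := fun g => by
        obtain ⟨w, hw, rfl⟩ := hXw g
        obtain ⟨l, hl, -, hlw⟩ := hwords w hw
        exact ⟨l, hl, hlw⟩ }
  have m₁ : U₁ ∈ finSupp _ := average_mem_finSupp _
  have m₂ : U₂ ∈ finSupp _ := average_mem_finSupp _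
  refine ⟨q, r, T₁ ∪ T₂, η₁, η₂, U₁, U₂, ?_, ⟨hlazy _ hη₁, hlazy _ hη₂,
    average_mem_probabilities _, average_mem_probabilities _⟩, hwords⟩
  refine
    { frame := hframe
      central₁ := hc₁
      central₂ := hc₂
      letter := fun s hs => ?_
      fst_η₁ := map_eq_self_of_mem_closure (fun s hs => ?_) hη₁
      fst_η₂ := map_eq_one_of_mem_closure (fun s hs => ?_) hη₂
      snd_η₁ := map_eq_one_of_mem_closure (fun s hs => ?_) hη₁
      snd_η₂ := map_eq_self_of_mem_closure (fun s hs => ?_) hη₂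
      fst_U₁ := by rw [hU₁, map_average]; rfl
      fst_U₂ := by rw [hU₂, map_average]; exact average_one
      snd_U₁ := by rw [hU₁, map_average]; exact average_one
      snd_U₂ := by rw [hU₂, map_average]; rfl
      U₁_mem := m₁
      U₂_mem := m₂
      map_U := hU
      mixed := fun s hs hs' t ht ht' => ?_ }
  · rw [Finset.mem_union, memT₁, memT₂] at hs
    exact hs.symm.imp And.left And.right
  · exact Prod.ext rfl ((memT₁ s).1 hs).2.symm
  · exact Prod.ext ((memT₂ s).1 hs).1 rfl
  · exact Prod.ext rfl ((memT₁ s).1 hs).2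
  · exact Prod.ext ((memT₂ s).1 hs).1.symm rfl
  · rcases Finset.mem_union.1 hs with hs₁ | hs₁
    · have hS : ∀ f : Γ₁ ⧸ A₁, ((f.out⁻¹, 1) * s * (f.out⁻¹, 1)⁻¹ : Γ₁ × Γ₂) ∈ T₁ :=
        fun f => conj₁ _ _ hs₁
      rw [hU₁, average, smul_mul_assoc, smul_mul_assoc]
      refine Submodule.smul_mem _ _ (hframe.sum_mixed_mem (mul_mem_finSupp m₁ m₂) hU _ _
        (fun f => Finset.mem_union_left _ (hS f)) ht (fun f => by ext <;> simp [ht']) ?_)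
      -- The sum of the differences over the conjugates is the first-order part of a word whose
      -- product is torsion. The hypothesis on `Γ₁` enters only here.
      obtain ⟨k, hk, hpow⟩ := exists_prod_conj_pow_eq_one hhom h₁ (hSA₁ _ ((memT₁ s).1 hs₁).1)
      have := hframe.taylorOne_mem_of_prod_pow
        (l := Finset.univ.toList.map fun f : Γ₁ ⧸ A₁ => (f.out⁻¹, 1) * s * (f.out⁻¹, 1)⁻¹)
        (fun x hx => by
          obtain ⟨f, -, rfl⟩ := List.mem_map.1 hx
          exact Finset.mem_union_left _ (hS f)) hk (by
          have e : (Finset.univ.toList.map fun f : Γ₁ ⧸ A₁ =>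
              ((f.out⁻¹, 1) * s * (f.out⁻¹, 1)⁻¹ : Γ₁ × Γ₂)) =
              (Finset.univ.toList.map fun f : Γ₁ ⧸ A₁ => f.out⁻¹ * s.1 * f.out).map
                (MonoidHom.inl Γ₁ Γ₂) := by
            rw [List.map_map]
            exact List.map_congr_left fun f _ => by ext <;> simp [hs']
          rw [e, ← map_list_prod, ← map_pow, hpow, map_one])
      rwa [taylorOne, List.map_map, Finset.sum_map_toList] at this
    · have : s = 1 := Prod.ext ((memT₂ s).1 hs₁).1 hs'
      simp [this, δ_one]

end ProductFrame

end L1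

/-! ### Probability measures as elements of the group algebra -/

namespace L1

section Coefficients

variable {G E : Type*} [NormedAddCommGroup E] [NormedSpace ℝ E] [CompleteSpace E]

theorem ext_coeff {x y : L1 G} (h : ∀ g, coeff x g = coeff y g) : x = y := by
  have := hasSum_coeff x
  simp only [h] at this
  exact this.unique (hasSum_coeff y)

theorem lift_apply (b : G → E) (hb : ∀ g, ‖b g‖ ≤ 1) (x : L1 G) :
    lift b hb x = ∑' g, coeff x g • b g := rfl

-- Evaluation at a point is a bounded functional, so coefficients may be taken termwise in
-- convergent sums.
open Classical in
theorem lift_single_eq_coeff (k : G) (x : L1 G) :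
    lift (fun g => if g = k then (1 : ℝ) else 0) (fun g => by split_ifs <;> simp) x =
      coeff x k := by
  simp [lift_apply]

theorem coeff_δ [DecidableEq G] (g k : G) : coeff (δ g) k = if g = k then 1 else 0 := by
  classical
  rw [← lift_single_eq_coeff, lift_δ]
  congr

theorem coeff_lift {K : Type*} (b : G → L1 K) (hb : ∀ g, ‖b g‖ ≤ 1) (x : L1 G) (k : K) :
    coeff (lift b hb x) k = ∑' g, coeff x g * coeff (b g) k := by
  classical
  have := ((hasSum_coeff x).mapL (lift b hb)).mapL (lift (fun g => if g = k then (1 : ℝ) else 0)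
    (fun g => by split_ifs <;> simp))
  simp only [map_smul, lift_δ, lift_single_eq_coeff, smul_eq_mul] at this
  exact this.tsum_eq.symm

theorem norm_sub_coeff_smul_δ (x : L1 G) (g : G) :
    ‖x - coeff x g • δ g‖ = ‖x‖ - |coeff x g| := by
  classical
  have h1 := hasSum_norm_coeff (x - coeff x g • δ g)
  have h2 := (hasSum_norm_coeff x).update g 0
  have e : (fun k => ‖coeff (x - coeff x g • δ g) k‖) =
      Function.update (fun k => ‖coeff x k‖) g 0 := by
    funext k
    have : coeff (x - coeff x g • δ g) k = coeff x k - coeff x g * coeff (δ g) k := rfl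
    rw [this, coeff_δ, Function.update_apply]
    rcases eq_or_ne g k with rfl | hk
    · simp
    · simp [hk, hk.symm]
  rw [e] at h1
  rw [h1.unique h2, Real.norm_eq_abs]
  ring

end Coefficients

section OfPMF

variable {G K : Type*}

/-- A probability measure as an element of `L1 G`. -/
def ofPMF (p : PMF G) : L1 G :=
  show lp (fun _ : G => ℝ) 1 from ⟨fun g => (p g).toReal, memℓp_gen (by
    simpa using ENNReal.summable_toReal p.tsum_coe_ne_top)⟩

theorem coeff_ofPMF (p : PMF G) (g : G) : coeff (ofPMF p) g = (p g).toReal := rfl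

theorem norm_ofPMF (p : PMF G) : ‖ofPMF p‖ = 1 := by
  rw [← (hasSum_norm_coeff _).tsum_eq]
  simp only [coeff_ofPMF, Real.norm_of_nonneg ENNReal.toReal_nonneg]
  rw [← ENNReal.tsum_toReal_eq fun g => p.apply_ne_top g, p.tsum_coe, ENNReal.toReal_one]

theorem ofPMF_pure (g : G) : ofPMF (PMF.pure g) = δ g := by
  classical
  refine ext_coeff fun k => ?_
  rw [coeff_ofPMF, coeff_δ, PMF.pure_apply]
  rcases eq_or_ne g k with rfl | h
  · simp
  · simp [h, h.symm]

theorem ofPMF_bind (p : PMF G) (f : G → PMF K) :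
    ofPMF (p.bind f) = lift (fun g => ofPMF (f g)) (fun _ => (norm_ofPMF _).le) (ofPMF p) := by
  refine ext_coeff fun k => ?_
  rw [coeff_lift, coeff_ofPMF, PMF.bind_apply, ENNReal.tsum_toReal_eq fun g =>
    ENNReal.mul_ne_top (p.apply_ne_top g) ((f g).apply_ne_top k)]
  simp only [ENNReal.toReal_mul, coeff_ofPMF]

theorem ofPMF_map_eq_lift (p : PMF G) (f : G → K) :
    ofPMF (p.map f) = lift (fun g => δ (f g)) (fun _ => (norm_δ _).le) (ofPMF p) := by
  rw [← PMF.bind_pure_comp, ofPMF_bind]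
  simp only [Function.comp_apply, ofPMF_pure]

theorem toReal_toOuterMeasure (p : PMF G) (A : Set G) :
    (p.toOuterMeasure A).toReal = lift (A.indicator fun _ => (1 : ℝ))
      (fun g => by by_cases h : g ∈ A <;> simp [h]) (ofPMF p) := by
  rw [PMF.toOuterMeasure_apply, lift_apply, ENNReal.tsum_toReal_eq fun g => ?_]
  · refine tsum_congr fun g => ?_
    by_cases h : g ∈ A <;> simp [h, coeff_ofPMF]
  · by_cases h : g ∈ A <;> simp [h, p.apply_ne_top]

theorem tvDist_nonneg (p p' : PMF G) : 0 ≤ RandomWalk.tvDist p p' :=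
  Real.iSup_nonneg fun _ => abs_nonneg _

/-- Evaluation on a set is a functional of norm at most one on `L1 G`. -/
theorem tvDist_le (p p' : PMF G) : RandomWalk.tvDist p p' ≤ ‖ofPMF p - ofPMF p'‖ := by
  refine ciSup_le fun A => ?_
  rw [toReal_toOuterMeasure, toReal_toOuterMeasure, ← map_sub, ← Real.norm_eq_abs]
  exact norm_lift_apply_le (E := ℝ) _ _ _

variable [Group G] [Group K]

theorem map_eq_lift (φ : G →* K) (x : L1 G) :
    map φ x = lift (fun g => δ (φ g)) (fun _ => (norm_δ _).le) x :=
  (hasSum_map φ x).tsum_eq.symm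

theorem ofPMF_map (p : PMF G) (φ : G →* K) : ofPMF (p.map φ) = map φ (ofPMF p) := by
  rw [ofPMF_map_eq_lift, map_eq_lift]

theorem mass_ofPMF (p : PMF G) : mass (ofPMF p) = 1 := by
  rw [mass, liftAlgHom_eq_lift (1 : G →* ℝ) (fun _ => by simp), lift_apply]
  simp only [coeff_ofPMF, MonoidHom.one_apply, smul_eq_mul, mul_one]
  rw [← ENNReal.tsum_toReal_eq fun g => p.apply_ne_top g, p.tsum_coe, ENNReal.toReal_one]

theorem ofPMF_convPow (p : PMF G) (n : ℕ) : ofPMF (RandomWalk.convPow p n) = ofPMF p ^ n := by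
  induction n with
  | zero => exact ofPMF_pure 1
  | succ n ih =>
    rw [RandomWalk.convPow, ofPMF_bind, ih, pow_succ]
    simp only [ofPMF_map_eq_lift]
    have : ∀ x y : L1 G, x * y = ∑' g, coeff x g • (δ g * y) := fun x y =>
      (((hasSum_coeff x).mul_right y).congr_fun fun g => (smul_mul_assoc _ _ _).symm).tsum_eq.symm
    rw [this, lift_apply]
    refine tsum_congr fun g => ?_
    rw [mul_def, mulCLM, lift_δ]

end OfPMF

section ProdPMF

variable {Γ₁ Γ₂ : Type*} [Group Γ₁] [Group Γ₂]

theorem ofPMF_prodPMF (p₁ : PMF Γ₁) (p₂ : PMF Γ₂) :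
    ofPMF (RandomWalk.prodPMF p₁ p₂) =
      map (MonoidHom.inl Γ₁ Γ₂) (ofPMF p₁) * map (MonoidHom.inr Γ₁ Γ₂) (ofPMF p₂) := by
  have h₁ := (hasSum_map (MonoidHom.inl Γ₁ Γ₂) (ofPMF p₁)).mul_right
    (map (MonoidHom.inr Γ₁ Γ₂) (ofPMF p₂))
  rw [RandomWalk.prodPMF, ofPMF_bind, lift_apply, ← h₁.tsum_eq]
  refine tsum_congr fun a => ?_
  have h₂ := (hasSum_map (MonoidHom.inr Γ₁ Γ₂) (ofPMF p₂)).mul_left (δ (MonoidHom.inl Γ₁ Γ₂ a))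
  rw [smul_mul_assoc, ofPMF_map_eq_lift, lift_apply, ← h₂.tsum_eq]
  congr 1
  refine tsum_congr fun b => ?_
  rw [mul_smul_comm, δ_mul_δ, MonoidHom.inl_apply, MonoidHom.inr_apply, Prod.mk_mul_mk, mul_one,
    one_mul]

theorem prodMarginals_ofPMF_pow (ν : PMF (Γ₁ × Γ₂)) (n : ℕ) :
    prodMarginals (ofPMF ν ^ n) =
      ofPMF (RandomWalk.prodPMF (RandomWalk.convPow (ν.map Prod.fst) n)
        (RandomWalk.convPow (ν.map Prod.snd) n)) := by
  have h₁ : ofPMF (ν.map Prod.fst) = map (MonoidHom.fst Γ₁ Γ₂) (ofPMF ν) :=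
    ofPMF_map ν (MonoidHom.fst Γ₁ Γ₂)
  have h₂ : ofPMF (ν.map Prod.snd) = map (MonoidHom.snd Γ₁ Γ₂) (ofPMF ν) :=
    ofPMF_map ν (MonoidHom.snd Γ₁ Γ₂)
  rw [ofPMF_prodPMF, ofPMF_convPow, ofPMF_convPow, h₁, h₂, ← map_pow, ← map_pow, map_map, map_map]
  rfl

end ProdPMF

/-! ### Minorization -/

section Minorization

variable {G : Type*} [Group G] {ν : PMF G}

/-- The mass of the atom serves as `ε`: removing the atom lowers the norm by exactly that mass. -/
theorem dominates_of_convPow_ne_zero {n : ℕ} {g : G} (h : RandomWalk.convPow ν n g ≠ 0) :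
    Dominates (ofPMF ν ^ n) (δ g) := by
  rw [← ofPMF_convPow]
  have h0 : 0 < coeff (ofPMF (RandomWalk.convPow ν n)) g :=
    ENNReal.toReal_pos h (PMF.apply_ne_top _ _)
  refine Dominates.of_exists (norm_ofPMF _).le h0 ?_
  rw [norm_sub_coeff_smul_δ, norm_ofPMF, abs_of_pos h0]

theorem norm_ofPMF_pow_le (ν : PMF G) (n : ℕ) : ‖ofPMF ν ^ n‖ ≤ 1 := by
  rw [← ofPMF_convPow, norm_ofPMF]

theorem dominates_pow_mul {m n : ℕ} {y z : L1 G} (hy : ‖y‖ ≤ 1) (h : Dominates (ofPMF ν ^ m) y)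
    (h' : Dominates (ofPMF ν ^ n) z) : Dominates (ofPMF ν ^ (m + n)) (y * z) := by
  rw [pow_add]
  exact h.mul (norm_ofPMF_pow_le _ _) (norm_ofPMF_pow_le _ _) hy h'

theorem dominates_one_one : Dominates (1 : L1 G) 1 :=
  Dominates.of_exists norm_one.le one_pos (by simp)

/-- The lengths of loops at the identity generate all large integers by aperiodicity; a path to `g`
is then prolonged by loops. -/
theorem eventually_dominates_δ (hap : RandomWalk.Aperiodic ν)
    (hgen : Subsemigroup.closure ν.support = ⊤) (g : G) :
    ∀ᶠ n in atTop, Dominates (ofPMF ν ^ n) (δ g) := by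
  have h1 : ∀ n ∈ AddSubmonoid.closure {n | 0 < n ∧ RandomWalk.convPow ν n 1 ≠ 0},
      Dominates (ofPMF ν ^ n) (1 : L1 G) := by
    intro n hn
    induction hn using AddSubmonoid.closure_induction with
    | mem n hn => exact dominates_of_convPow_ne_zero hn.2
    | zero => rw [pow_zero]; exact dominates_one_one
    | add m n _ _ hm hn => simpa using dominates_pow_mul norm_one.le hm hn
  have h2 : ∀ g ∈ Subsemigroup.closure ν.support, ∃ k, Dominates (ofPMF ν ^ k) (δ g) := by
    intro g hg
    induction hg using Subsemigroup.closure_induction with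
    | mem g hg =>
      refine ⟨1, dominates_of_convPow_ne_zero ?_⟩
      have : RandomWalk.convPow ν 1 = ν := by
        simp only [RandomWalk.convPow, PMF.pure_bind, one_mul]
        exact PMF.map_id ν
      rwa [this]
    | mul g k _ _ hg hk =>
      obtain ⟨m, hm⟩ := hg
      obtain ⟨n, hn⟩ := hk
      exact ⟨m + n, by simpa using dominates_pow_mul (norm_δ g).le hm hn⟩
  obtain ⟨k, hk⟩ := h2 g (hgen ▸ Subsemigroup.mem_top g)
  obtain ⟨N, hN⟩ := Nat.exists_mem_closure_of_ge {n | 0 < n ∧ RandomWalk.convPow ν n 1 ≠ 0}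
  filter_upwards [eventually_ge_atTop (N + k)] with n hn
  have hper : Nat.setGcd {n | 0 < n ∧ RandomWalk.convPow ν n 1 ≠ 0} = 1 := hap
  have := dominates_pow_mul norm_one.le
    (h1 _ (hN (n - k) (by omega) (hper ▸ one_dvd _))) hk
  rwa [Nat.sub_add_cancel (by omega), one_mul] at this

theorem eventually_dominates (hap : RandomWalk.Aperiodic ν)
    (hgen : Subsemigroup.closure ν.support = ⊤) {y : L1 G} (hy : y ∈ probabilities G) :
    ∀ᶠ n in atTop, Dominates (ofPMF ν ^ n) y := by
  induction hy using Submonoid.closure_induction with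
  | mem y hy =>
    have hconv : Convex ℝ {y | ∀ᶠ n in atTop, Dominates (ofPMF ν ^ n) y} := by
      intro y hy z hz a b ha hb hab
      filter_upwards [hy, hz] with n hn hn'
      have := Dominates.sum (s := Finset.univ) (w := ![a, b]) (y := ![y, z]) (p := ofPMF ν ^ n)
        (by simp [Fin.forall_fin_two, ha, hb]) (by simp [hab])
        (by simp [Fin.forall_fin_two, hn, hn'])
      simpa using this
    refine convexHull_min ?_ hconv hy
    rintro _ ⟨g, rfl⟩
    exact eventually_dominates_δ hap hgen g
  | one => exact eventually_dominates_δ hap hgen 1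
  | mul y z hy hz ihy ihz =>
    -- Both halves of the exponent tend to infinity, so each factor is dominated by its own half.
    have t1 : Tendsto (fun n : ℕ => n / 2) atTop atTop := Nat.tendsto_div_const_atTop two_ne_zero
    have t2 : Tendsto (fun n : ℕ => n - n / 2) atTop atTop :=
      tendsto_atTop_mono (fun n => by omega) t1
    filter_upwards [t1.eventually ihy, t2.eventually ihz] with n hn hn'
    have := dominates_pow_mul (norm_le_one_of_mem_probabilities hy) hn hn'
    rwa [Nat.add_sub_cancel' (Nat.div_le_self n 2)] at this

end Minorization

end L1

/-! ### Word length, second moments and conclusion -/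

theorem RandomWalk.exists_word_length_eq {G : Type*} [Group G] {S : Set G}
    (hS : Subgroup.closure S = ⊤) (g : G) :
    ∃ l : List G, l.length = RandomWalk.wordLength S g ∧ (∀ s ∈ l, s ∈ S ∨ s⁻¹ ∈ S) ∧
      l.prod = g := by
  have hg : g ∈ (Subgroup.closure S).toSubmonoid := by
    rw [hS]
    exact Subgroup.mem_top g
  rw [Subgroup.closure_toSubmonoid] at hg
  obtain ⟨l, hl, hlg⟩ := Submonoid.exists_list_of_mem_closure hg
  exact Nat.sInf_mem
    (s := {n | ∃ l : List G, l.length = n ∧ (∀ s ∈ l, s ∈ S ∨ s⁻¹ ∈ S) ∧ l.prod = g})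
    ⟨l.length, l, rfl, hl, hlg⟩

open L1 in
theorem RandomWalk.summable_length_sq {G : Type*} [Group G] {ν : PMF G} {S : Set G}
    (hν : ∑' g : G, ((RandomWalk.wordLength S g : ℝ≥0∞) ^ 2 * ν g) < ∞) {n : G → ℕ}
    (hn : ∀ g, n g ≤ 2 * RandomWalk.wordLength S g + 2) :
    Summable fun g => |coeff (ofPMF ν) g| * ((n g : ℝ) + 1) ^ 2 := by
  have h1 := ENNReal.summable_toReal hν.ne
  have h2 := ENNReal.summable_toReal ν.tsum_coe_ne_top
  refine Summable.of_nonneg_of_le (fun g => by positivity) (fun g => ?_)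
    ((h1.mul_left 8).add (h2.mul_left 18))
  have h3 : (n g : ℝ) ≤ 2 * RandomWalk.wordLength S g + 2 := by exact_mod_cast hn g
  rw [coeff_ofPMF, abs_of_nonneg ENNReal.toReal_nonneg, ENNReal.toReal_mul, ENNReal.toReal_pow,
    ENNReal.toReal_natCast]
  set a := (RandomWalk.wordLength S g : ℝ)
  -- From `n g + 1 ≤ 2 * a + 3` and `(2 * a + 3) ^ 2 ≤ 2 * ((2 * a) ^ 2 + 3 ^ 2)`.
  have h4 : ((n g : ℝ) + 1) ^ 2 ≤ 8 * a ^ 2 + 18 := by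
    have : ((n g : ℝ) + 1) ^ 2 ≤ (2 * a + 3) ^ 2 :=
      pow_le_pow_left₀ (by positivity) (by linarith) 2
    nlinarith [sq_nonneg (2 * a - 3)]
  calc (ν g).toReal * ((n g : ℝ) + 1) ^ 2 ≤ (ν g).toReal * (8 * a ^ 2 + 18) :=
        mul_le_mul_of_nonneg_left h4 ENNReal.toReal_nonneg
    _ = _ := by ring

end

theorem theorem3 {Γ₁ Γ₂ : Type*} [Group Γ₁] [Group Γ₂]
    [Group.FG Γ₁] [Group.FG Γ₂]
    (hΓ₁ : RandomWalk.VirtuallyAbelian Γ₁) (hΓ₂ : RandomWalk.VirtuallyAbelian Γ₂)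
    (ν : PMF (Γ₁ × Γ₂))
    (hap : RandomWalk.Aperiodic ν)
    (hmom : RandomWalk.FiniteSecondMoment ν)
    (hgen : Subsemigroup.closure ν.support = ⊤)
    (μ₁ : PMF Γ₁) (hμ₁ : μ₁ = ν.map Prod.fst)
    (μ₂ : PMF Γ₂) (hμ₂ : μ₂ = ν.map Prod.snd)
    (hhom : ¬ ∃ f : Γ₁ →* Multiplicative ℤ, Function.Surjective f) :
    Filter.Tendsto
      (fun n : ℕ => RandomWalk.tvDist (RandomWalk.convPow ν n)
        (RandomWalk.prodPMF (RandomWalk.convPow μ₁ n) (RandomWalk.convPow μ₂ n)))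
      Filter.atTop (nhds 0) := by
  subst hμ₁ hμ₂
  obtain ⟨A₁, hn₁, hf₁, hA₁⟩ := hΓ₁.exists_normal
  obtain ⟨A₂, hn₂, hf₂, hA₂⟩ := hΓ₂.exists_normal
  cases nonempty_fintype (Γ₁ ⧸ A₁)
  cases nonempty_fintype (Γ₂ ⧸ A₂)
  obtain ⟨S, hS, hνS⟩ := hmom
  have hX : {x | x ∈ (S : Set (Γ₁ × Γ₂)) ∨ x⁻¹ ∈ (S : Set (Γ₁ × Γ₂))}.Finite :=
    S.finite_toSet.union S.finite_toSet.inv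
  -- Geodesic words are rewritten in the letters of the frame, so the new lengths are controlled by
  -- the word length in the moment condition.
  choose w hwlen hwX hwg using RandomWalk.exists_word_length_eq hS
  obtain ⟨q, r, T, η₁, η₂, U₁, U₂, h, ⟨hη₁, hη₂, hU₁, hU₂⟩, hT⟩ :=
    L1.exists_productFrame hhom hA₁ hA₂ hX fun g => ⟨w g, hwX g, hwg g⟩
  choose l hl hllen hlw using fun g => hT (w g) (hwX g)
  have happrox : L1.ofPMF ν ∈ L1.approximable h.frame.central :=
    h.frame.mem_approximable_of_moment l hl (fun g => by simpa only [hwg] using hlw g)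
      (RandomWalk.summable_length_sq hνS fun g => by simpa only [hwlen] using hllen g)
  -- A single positive power must dominate both the smoothing element and the averaging element.
  obtain ⟨N, ⟨hNη, hNU⟩, hN⟩ := ((L1.eventually_dominates hap hgen (mul_mem hη₁ hη₂)).and
    (L1.eventually_dominates hap hgen (mul_mem hU₁ hU₂))).and
    (Filter.eventually_gt_atTop 0) |>.exists
  have key := h.tendsto_norm_pow_sub happrox (L1.norm_ofPMF ν).le (L1.mass_ofPMF ν)
    (L1.norm_le_one_of_mem_probabilities hU₁) hN hNη hNU
  refine squeeze_zero (fun n => L1.tvDist_nonneg _ _) (fun n => ?_) key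
  rw [L1.prodMarginals_ofPMF_pow, ← L1.ofPMF_convPow]
  exact L1.tvDist_le _ _
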